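/- Conventions. Manifolds are smooth, Hausdorff, second countable, without boundary and of one dimension. A Lie algebroid $A\to M$ is a smooth real vector bundle of constant rank with an anchor $\rho_A:A\to TM$ and a Lie bracket on its smooth sections satisfying the Leibniz rule; $d_A$ is the Lie algebroid differential on $\Omega^\bullet(A)=\Gamma(\bigwedge^\bullet A^*)$, and $H^1(A)=\ker d_A|_{\Omega^1(A)}/d_A C^\infty(M)$. A morphism $\Phi:A\to B$ is a vector bundle map, over a smooth map of the bases, whose pull-back of forms $\Omega^\bullet(B)\to\Omega^\bullet(A)$ is a chain map; $\tilde\Phi^*:H^1(B)\to H^1(A)$ denotes the induced map. The modular class $\operatorname{Mod}A\in H^1(A)$ is the characteristic class of the line bundle $L^A=\bigwedge^{\mathrm{top}}A\otimes\bigwedge^{\mathrm{top}}T^*M$ with the representation $D_a(\omega\otimes\mu)=[a,\omega]\otimes\mu+\omega\otimes\mathcal L_{\rho_A(a)}\mu$: it is the class of the 1-form $\theta$ given by $D_as=\theta(a)s$, where $s$ is a nowhere vanishing section of $L^A$; if $L^A$ has no such section, it is one half of the class obtained in the same way from $L^A\otimes L^A$ with $D\otimes D$. For a morphism $\Phi:A\to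 B$ put $\operatorname{Mod}\Phi=\operatorname{Mod}A-\tilde\Phi^*(\operatorname{Mod}B)\in H^1(A)$. For a surjective submersion $\phi:P\to M$, the pull-back Lie algebroid $\phi^!A\to P$ has fibre $\{(a,u)\in A_{\phi(p)}\times T_pP:\rho_A(a)=(T\phi)u\}$ at $p$, anchor $(a,u)\mapsto u$, and bracket $$\Big[\big(\textstyle\sum_i f_i\otimes a_i,X\big),\big(\sum_j g_j\otimes b_j,Y\big)\Big]=\Big(\textstyle\sum_{i,j}f_ig_j\otimes[a_i,b_j]+\sum_jX(g_j)\otimes b_j-\sum_iY(f_i)\otimes a_i,\ [X,Y]\Big),$$ and $\hat\phi:H^1(A)\to H^1(\phi^!A)$ is induced by the projection $\phi^!A\to A$. A generalized morphism $\mathcal P=(P,\phi,\Psi)$ from $A\to M$ to $B\to N$ is a surjective submersion $\phi:P\to M$ with a Lie algebroid morphism $\Psi:\phi^!A\to B$ over a map $\psi:P\to N$. An isomorphism between two of them is a diffeomorphism of the manifolds $P$ that is compatible with the maps $\phi$ and, through the induced isomorphism of pull-back Lie algebroids, with the morphisms $\Psi$. A composite of $\mathcal P$ and $\mathcal P'=(P',\phi',\Psi')$,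 where $\mathcal P'$ goes from $B$ to $C$, has the manifold $P\times_NP'$, the submersion $(p,p')\mapsto\phi(p)$ and the morphism $(a,(u,v))\mapsto\Psi'(\Psi(a,u),v)$; the identity of $A$ is $(M,\mathrm{id}_M,\mathrm{id}_A)$. Let $\mathcal Algd$ be the category of Lie algebroids and their morphisms, and $\mathcal Algd'_1$ the one whose arrows are the isomorphism classes of generalized morphisms for which $\phi$ has 1-connected (connected and simply connected) fibres. For an anti-representation $F$ of a category (a contravariant functor to real vector spaces) and a 0-cochain $u$ (an element $u(A)\in F(A)$ for each object $A$), the coboundary $\delta u$ assigns $(\delta u)(f)=u(A)-F(f)(u(B))\in F(A)$ to each arrow $f:A\to B$. **Proposition.** Every Lie algebroid has exactly one modular class, and the following hold. (1) $A\mapsto H^1(A)$, $\Phi\mapsto\tilde\Phi^*$ is an anti-representation of $\mathcal Algd$, and $\operatorname{Mod}\Phi=(\delta\operatorname{Mod})(\Phi)$ for every Lie algebroid morphism $\Phi$. (2) For every generalized morphism $\mathcal P=(P,\phi,\Psi)$ from $A$ to $B$ with 1-connected fibres, $\hat\phi$ is bijective. The map $\tilde{\mathcal P}^*=\hat\phi^{-1}\circ\tilde\Psi^*:H^1(B)\to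 H^1(A)$ depends only on the isomorphism class of $\mathcal P$; it is the identity when $\mathcal P$ is the identity of $A$, and $\tilde{\mathcal P''}^*=\tilde{\mathcal P}^*\circ\tilde{\mathcal P'}^*$ whenever $\mathcal P''$ is a composite of $\mathcal P$ and $\mathcal P'$, all three with 1-connected fibres. So $H^1$ is an anti-representation of $\mathcal Algd'_1$. The modular class $\operatorname{Mod}\mathcal P=\hat\phi^{-1}(\operatorname{Mod}\Psi)\in H^1(A)$ satisfies $$\operatorname{Mod}\mathcal P=(\delta\operatorname{Mod})([\mathcal P])=\operatorname{Mod}A-\tilde{\mathcal P}^*(\operatorname{Mod}B);$$ in particular it depends only on the isomorphism class $[\mathcal P]$. In other words, the modular class of morphisms, and that of generalized morphisms with 1-connected fibres, is the coboundary of the 0-cochain $A\mapsto\operatorname{Mod}A$ with values in the anti-representation $H^1$. -/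

import Mathlib

open Bundle CategoryTheory
open scoped Manifold ContDiff Topology TensorProduct

universe u

noncomputable section
namespace LieAlgd

/-- A smooth real vector bundle of rank `r` over a smooth manifold `M` of dimension `n` (Hausdorff,
second countable, without boundary), bundled. -/
structure VectorBdl : Type (u + 1) where
  n : ℕ
  M : Type u
  [topM : TopologicalSpace M]
  [charted : ChartedSpace (EuclideanSpace ℝ (Fin n)) M]
  [manifold : IsManifold (𝓡 n) ∞ M]
  [t2 : T2Space M]
  [secondCountable : SecondCountableTopology M]
  r : ℕ
  E : M → Type u
  [addE : ∀ x, AddCommGroup (E x)]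
  [modE : ∀ x, Module ℝ (E x)]
  [topE : ∀ x, TopologicalSpace (E x)]
  [topTot : TopologicalSpace (TotalSpace (EuclideanSpace ℝ (Fin r)) E)]
  [fiberBundle : FiberBundle (EuclideanSpace ℝ (Fin r)) E]
  [vectorBundle : VectorBundle ℝ (EuclideanSpace ℝ (Fin r)) E]
  [smoothBundle : ContMDiffVectorBundle ∞ (EuclideanSpace ℝ (Fin r)) E (𝓡 n)]

attribute [instance] VectorBdl.topM VectorBdl.charted VectorBdl.manifold VectorBdl.t2
  VectorBdl.secondCountable VectorBdl.addE VectorBdl.modE VectorBdl.topE VectorBdl.topTot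
  VectorBdl.fiberBundle VectorBdl.vectorBundle VectorBdl.smoothBundle

namespace VectorBdl
variable (A : VectorBdl.{u})

/-- The model fibre. -/
abbrev F : Type := EuclideanSpace ℝ (Fin A.r)

/-- The tangent space of the base at `x`. -/
abbrev T (x : A.M) : Type := TangentSpace (𝓡 A.n) x

/-- The total space. -/
abbrev Tot : Type u := TotalSpace (EuclideanSpace ℝ (Fin A.r)) A.E

/-- Smooth real functions on the base. -/
abbrev Fun : Type u := C^∞⟮𝓡 A.n, A.M; 𝓘(ℝ, ℝ), ℝ⟯

/-- Smooth global sections of the bundle. -/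
abbrev Sec : Type u := Cₛ^∞⟮𝓡 A.n; EuclideanSpace ℝ (Fin A.r), A.E⟯

/-- Smooth vector fields on the base. -/
abbrev Vec : Type u :=
  Cₛ^∞⟮𝓡 A.n; EuclideanSpace ℝ (Fin A.n), (TangentSpace (𝓡 A.n) : A.M → Type)⟯
variable {A}

/-- The product `f a` of a function and a section. -/
def fsmul (f : A.Fun) (a : A.Sec) : A.Sec :=
  ⟨fun x => f x • a x, f.contMDiff.smul_section a.contMDiff⟩

/-- The derivative `u f` of a function along a tangent vector. -/
def deriv {x : A.M} (u : A.T x) (f : A.M → ℝ) : ℝ := mfderiv (𝓡 A.n) 𝓘(ℝ, ℝ) f x u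

/-- A family of alternating `k`-forms on the fibres, with no smoothness required. -/
abbrev RawForm (A : VectorBdl.{u}) (k : ℕ) : Type u := ∀ x, A.E x [⋀^Fin k]→ₗ[ℝ] ℝ

/-- The smooth families: those giving smooth functions on all tuples of smooth sections. -/
def smoothForms (A : VectorBdl.{u}) (k : ℕ) : Submodule ℝ (A.RawForm k) where
  carrier := {α | ∀ a : Fin k → A.Sec,
    ContMDiff (𝓡 A.n) 𝓘(ℝ, ℝ) ∞ (fun x => α x (fun i => a i x))}
  add_mem' hα hβ a := (hα a).add (hβ a)
  zero_mem' _ := contMDiff_const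
  smul_mem' c _ hα a := ((contMDiff_const :
    ContMDiff (𝓡 A.n) 𝓘(ℝ, ℝ) ∞ (fun _ : A.M => c)).mul (hα a))

/-- `Ω^k(A)`: the smooth sections of `⋀^k A*`, as smooth families of alternating forms. -/
def Form (A : VectorBdl.{u}) (k : ℕ) : Type u := A.smoothForms k

instance (k : ℕ) : AddCommGroup (A.Form k) := inferInstanceAs (AddCommGroup (A.smoothForms k))
instance (k : ℕ) : Module ℝ (A.Form k) := inferInstanceAs (Module ℝ (A.smoothForms k))
end VectorBdl

/-- A smooth vector bundle map, over a smooth map of the bases. -/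
structure BdlMap (A B : VectorBdl.{u}) where
  base : A.M → B.M
  base_smooth : ContMDiff (𝓡 A.n) (𝓡 B.n) ∞ base
  fib : ∀ x, A.E x →ₗ[ℝ] B.E (base x)
  smooth : ContMDiff ((𝓡 A.n).prod 𝓘(ℝ, A.F)) ((𝓡 B.n).prod 𝓘(ℝ, B.F)) ∞
    (fun v : A.Tot => (⟨base v.1, fib v.1 v.2⟩ : B.Tot))

/-- A Lie algebroid: a vector bundle with an anchor (a smooth bundle map to the tangent bundle) and a
Lie bracket on the smooth sections, with the Leibniz rule; the anchor preserves brackets. -/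
structure LieAlgebroid extends VectorBdl.{u} where
  anchor : ∀ x, E x →ₗ[ℝ] TangentSpace (𝓡 n) x
  anchor_smooth : ContMDiff ((𝓡 n).prod 𝓘(ℝ, EuclideanSpace ℝ (Fin r))) (𝓡 n).tangent ∞
    (fun v : TotalSpace (EuclideanSpace ℝ (Fin r)) E =>
      (⟨v.1, anchor v.1 v.2⟩ : TangentBundle (𝓡 n) M))
  bracket : toVectorBdl.Sec →ₗ[ℝ] toVectorBdl.Sec →ₗ[ℝ] toVectorBdl.Sec
  bracket_self : ∀ a, bracket a a = 0
  jacobi : ∀ a b c, bracket a (bracket b c) = bracket (bracket a b) c + bracket b (bracket a c)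
  leibniz : ∀ (a b : toVectorBdl.Sec) (f : toVectorBdl.Fun) (x : M),
    bracket a (VectorBdl.fsmul f b) x =
      f x • bracket a b x + VectorBdl.deriv (A := toVectorBdl) (anchor x (a x)) f • b x
  anchor_bracket : ∀ (a b : toVectorBdl.Sec) (x : M), anchor x (bracket a b x) =
    VectorField.mlieBracket (𝓡 n) (fun y => anchor y (a y)) (fun y => anchor y (b y)) x

namespace VectorBdl

/-- Around every point the bundle has a frame of global sections, with smooth coefficient functions. -/
theorem exists_frame (A : VectorBdl.{u}) (y₀ : A.M) :
    ∃ (U : Set A.M) (s : Fin A.r → A.Sec) (c : Fin A.r → A.Tot → ℝ), IsOpen U ∧ y₀ ∈ U ∧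
      (∀ i, ContMDiffOn ((𝓡 A.n).prod 𝓘(ℝ, A.F)) 𝓘(ℝ, ℝ) ∞ (c i) {v | v.1 ∈ U}) ∧
      ∀ y ∈ U, ∀ v : A.E y, v = ∑ i, c i ⟨y, v⟩ • s i y := by
  classical
  set e := trivializationAt A.F A.E y₀ with he
  have hy₀ : y₀ ∈ e.baseSet := FiberBundle.mem_baseSet_trivializationAt' y₀
  let b := (EuclideanSpace.basisFun (Fin A.r) ℝ).toBasis
  obtain ⟨χ, -, hχ⟩ := (SmoothBumpFunction.nhds_basis_tsupport (I := 𝓡 A.n) y₀).mem_iff.1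
    (e.open_baseSet.mem_nhds hy₀)
  obtain ⟨V, hV, hVo, hyV⟩ := eventually_nhds_iff.1 χ.eventuallyEq_one
  refine ⟨V ∩ e.baseSet, fun i => ⟨(χ : A.M → ℝ) • e.localFrame b i, ?_⟩,
    fun i v => (e v).2 i, hVo.inter e.open_baseSet, ⟨hyV, hy₀⟩, ?_, ?_⟩
  · exact ContMDiffOn.smul_section_of_tsupport χ.contMDiff.contMDiffOn e.open_baseSet hχ
      (e.contMDiffOn_localFrame_baseSet ∞ b i)
  · intro i
    have h1 : ContMDiffOn ((𝓡 A.n).prod 𝓘(ℝ, A.F)) ((𝓡 A.n).prod 𝓘(ℝ, A.F)) ∞ e e.source :=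
      e.contMDiffOn
    have h2 : ContMDiff ((𝓡 A.n).prod 𝓘(ℝ, A.F)) 𝓘(ℝ, ℝ) ∞
        (fun p : A.M × A.F => p.2 i) := by
      have : ContMDiff 𝓘(ℝ, A.F) 𝓘(ℝ, ℝ) ∞ (fun p : A.F => p i) := by
        rw [contMDiff_iff_contDiff]
        exact (EuclideanSpace.proj (𝕜 := ℝ) i).contDiff
      exact this.comp contMDiff_snd
    refine (h2.comp_contMDiffOn h1).mono ?_
    intro v hv
    rw [e.mem_source]
    exact hv.2
  · intro y hy v
    have h := (b.map (e.linearEquivAt ℝ y hy.2).symm).sum_repr v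
    have hχ1 : χ y = 1 := hV y hy.1
    conv_lhs => rw [← h]
    refine Finset.sum_congr rfl fun i _ => ?_
    have : (((χ : A.M → ℝ) • e.localFrame b i) y) = b.map (e.linearEquivAt ℝ y hy.2).symm i := by
      simp [hχ1, hy.2, Trivialization.basisAt]
    change _ = _ • (((χ : A.M → ℝ) • e.localFrame b i) y)
    rw [this]
    congr 1

end VectorBdl

namespace BdlMap
variable {A B C : VectorBdl.{u}}

/-- The map of total spaces. -/
def tot (Φ : BdlMap A B) (v : A.Tot) : B.Tot := ⟨Φ.base v.1, Φ.fib v.1 v.2⟩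

/-- Pull-back of fibrewise forms, `(Φ^*β)_x(v_1,…,v_k) = β_{φ(x)}(Φ v_1,…,Φ v_k)`. -/
def pullRaw (Φ : BdlMap A B) (k : ℕ) : B.RawForm k →ₗ[ℝ] A.RawForm k where
  toFun β x := (β (Φ.base x)).compLinearMap (Φ.fib x)
  map_add' _ _ := rfl
  map_smul' _ _ := rfl

theorem pullRaw_mem (Φ : BdlMap A B) (k : ℕ) (β : B.RawForm k) (hβ : β ∈ B.smoothForms k) :
    Φ.pullRaw k β ∈ A.smoothForms k := by
  intro a x₀
  obtain ⟨U, s, c, hU, hx₀, hc, hs⟩ := B.exists_frame (Φ.base x₀)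
  have hUx : Φ.base ⁻¹' U ∈ 𝓝 x₀ :=
    Φ.base_smooth.continuous.continuousAt.preimage_mem_nhds (hU.mem_nhds hx₀)
  have hloc : (fun x => Φ.pullRaw k β x (fun i => a i x)) =ᶠ[𝓝 x₀] fun x =>
      ∑ J : Fin k → Fin B.r, (∏ i, c (J i) (Φ.tot ⟨x, a i x⟩)) *
        β (Φ.base x) (fun i => s (J i) (Φ.base x)) := by
    filter_upwards [hUx] with x hx
    have h1 : Φ.pullRaw k β x (fun i => a i x) = β (Φ.base x)
        (fun i => ∑ j, c j (Φ.tot ⟨x, a i x⟩) • s j (Φ.base x)) := by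
      change β (Φ.base x) (fun i => Φ.fib x (a i x)) = _
      congr 1
      funext i
      exact hs _ hx _
    rw [h1]
    change (β (Φ.base x)).toMultilinearMap _ = _
    rw [MultilinearMap.map_sum]
    refine Finset.sum_congr rfl fun J _ => ?_
    rw [MultilinearMap.map_smul_univ]
    rfl
  refine ContMDiffAt.congr_of_eventuallyEq ?_ hloc
  refine ContMDiffAt.sum fun J _ => ContMDiffAt.mul ?_ ?_
  · refine ContMDiffAt.prod fun i _ => ?_
    have h1 : ContMDiffAt ((𝓡 B.n).prod 𝓘(ℝ, B.F)) 𝓘(ℝ, ℝ) ∞ (c (J i)) (Φ.tot ⟨x₀, a i x₀⟩) := by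
      refine (hc (J i)).contMDiffAt ?_
      have : IsOpen {v : B.Tot | v.1 ∈ U} := hU.preimage (FiberBundle.continuous_proj B.F B.E)
      exact this.mem_nhds hx₀
    exact h1.comp x₀ ((Φ.smooth.comp (a i).contMDiff) x₀)
  · exact ((hβ (fun i => s (J i))).comp Φ.base_smooth) x₀

/-- Pull-back of smooth forms along a bundle map. -/
def pull (Φ : BdlMap A B) (k : ℕ) : B.Form k →ₗ[ℝ] A.Form k :=
  (Φ.pullRaw k).restrict (Φ.pullRaw_mem k)

/-- The identity bundle map. -/
def id (A : VectorBdl.{u}) : BdlMap A A where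
  base := _root_.id
  base_smooth := contMDiff_id
  fib _ := LinearMap.id
  smooth := contMDiff_id

/-- Composition of bundle maps. -/
def comp (Ψ : BdlMap B C) (Φ : BdlMap A B) : BdlMap A C where
  base := Ψ.base ∘ Φ.base
  base_smooth := Ψ.base_smooth.comp Φ.base_smooth
  fib x := (Ψ.fib (Φ.base x)).comp (Φ.fib x)
  smooth := Ψ.smooth.comp Φ.smooth

end BdlMap

namespace VectorBdl
variable {A : VectorBdl.{u}}
theorem deriv_add {x : A.M} (u : A.T x) {f g : A.M → ℝ}
    (hf : ContMDiff (𝓡 A.n) 𝓘(ℝ, ℝ) ∞ f) (hg : ContMDiff (𝓡 A.n) 𝓘(ℝ, ℝ) ∞ g) :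
    deriv u (fun y => f y + g y) = deriv u f + deriv u g := by
  have h := mfderiv_add (hf.mdifferentiableAt (x := x) (by simp))
    (hg.mdifferentiableAt (x := x) (by simp))
  exact DFunLike.congr_fun h u

theorem deriv_const_mul {x : A.M} (u : A.T x) {f : A.M → ℝ} (c : ℝ)
    (hf : ContMDiff (𝓡 A.n) 𝓘(ℝ, ℝ) ∞ f) :
    deriv u (fun y => c * f y) = c * deriv u f := by
  have h := const_smul_mfderiv (hf.mdifferentiableAt (x := x) (by simp)) c
  exact DFunLike.congr_fun h u
end VectorBdl

namespace LieAlgebroid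
variable (A : LieAlgebroid.{u})

/-- The values of a form on tuples of sections. -/
def ev (k : ℕ) : A.Form k →ₗ[ℝ] ((Fin k → A.Sec) → A.M → ℝ) where
  toFun α a x := α.1 x (fun i => a i x)
  map_add' _ _ := rfl
  map_smul' _ _ := rfl

variable {A}

/-- The bracket part of the Chevalley-Eilenberg formula: the sum over pairs `p < q` of
`(-1)^(p+q) α([a_p, a_q], a_0, …, â_p, …, â_q, …)`, with `p = i.castSucc` and `q = j.succ`, `i ≤ j`. -/
def bracketTerm : ∀ {k : ℕ}, A.RawForm k → (Fin (k + 1) → A.Sec) → A.M → ℝ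
  | 0, _, _, _ => 0
  | k + 1, α, a, x => ∑ i : Fin (k + 1), ∑ j ∈ Finset.Ici i,
      (-1) ^ (i + (j + 1) : ℕ) * α x (Matrix.vecCons (A.bracket (a i.castSucc) (a j.succ) x)
        (fun l : Fin k => a (i.castSucc.succAbove (j.succAbove l)) x))

variable (A)

/-- The Lie algebroid differential: `A.d k α (a_0, …, a_k)` is the function `(d_A α)(a_0, …, a_k)`,
`∑ (-1)^i ρ(a_i) α(…, â_i, …) + ∑_{p<q} (-1)^(p+q) α([a_p, a_q], …, â_p, …, â_q, …)`. -/
def d (k : ℕ) : A.Form k →ₗ[ℝ] ((Fin (k + 1) → A.Sec) → A.M → ℝ) where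
  toFun α a x := ∑ i : Fin (k + 1), (-1) ^ (i : ℕ) * VectorBdl.deriv (A.anchor x (a i x))
      (fun y => α.1 y (fun l => a (i.succAbove l) y)) + bracketTerm α.1 a x
  map_add' α β := by
    funext a x
    have h1 : ∀ i : Fin (k + 1), VectorBdl.deriv (A.anchor x (a i x))
        (fun y => (α + β).1 y (fun l => a (i.succAbove l) y)) =
        VectorBdl.deriv (A.anchor x (a i x)) (fun y => α.1 y (fun l => a (i.succAbove l) y)) +
        VectorBdl.deriv (A.anchor x (a i x)) (fun y => β.1 y (fun l => a (i.succAbove l) y)) :=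
      fun i => VectorBdl.deriv_add _ (α.2 _) (β.2 _)
    have h2 : bracketTerm (α + β).1 a x = bracketTerm α.1 a x + bracketTerm β.1 a x := by
      have h : ∀ v, (α + β).1 x v = α.1 x v + β.1 x v := fun _ => rfl
      cases k with
      | zero => simp [bracketTerm]
      | succ k => simp [bracketTerm, h, mul_add, Finset.sum_add_distrib]
    simp only [h1, h2, mul_add, Finset.sum_add_distrib, Pi.add_apply]
    ring
  map_smul' c α := by
    funext a x
    have h1 : ∀ i : Fin (k + 1), VectorBdl.deriv (A.anchor x (a i x))
        (fun y => (c • α).1 y (fun l => a (i.succAbove l) y)) =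
        c * VectorBdl.deriv (A.anchor x (a i x)) (fun y => α.1 y (fun l => a (i.succAbove l) y)) :=
      fun i => VectorBdl.deriv_const_mul _ c (α.2 _)
    have h2 : bracketTerm (c • α).1 a x = c * bracketTerm α.1 a x := by
      have h : ∀ v, (c • α).1 x v = c * α.1 x v := fun _ => rfl
      cases k with
      | zero => simp [bracketTerm]
      | succ k => simp [bracketTerm, h, Finset.mul_sum, mul_left_comm]
    simp only [h1, h2, Pi.smul_apply, RingHom.id_apply, smul_eq_mul, mul_add, Finset.mul_sum]
    simp only [mul_left_comm]

/-- `η = d_A α`, tested on all sections. -/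
def IsDiff {k : ℕ} (α : A.Form k) (η : A.Form (k + 1)) : Prop := A.ev (k + 1) η = A.d k α

/-- Closed 1-forms. -/
def Z1 : Submodule ℝ (A.Form 1) := LinearMap.ker (A.d 1)

/-- Exact 1-forms `d_A f`. -/
def B1 : Submodule ℝ (A.Form 1) := (LinearMap.range (A.d 0)).comap (A.ev 1)

/-- The first Lie algebroid cohomology group. -/
abbrev H1 : Type u := A.Z1 ⧸ A.B1.submoduleOf A.Z1

variable {A} {B C : LieAlgebroid.{u}}

/-- `Φ^* d_B β = d_A Φ^* β` for all `k`-forms `β` on `B`. -/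
def IsChainMapAt (Φ : BdlMap A.toVectorBdl B.toVectorBdl) (k : ℕ) : Prop :=
  ∀ (β : B.Form k) (η : B.Form (k + 1)),
    B.IsDiff β η → A.IsDiff (Φ.pull k β) (Φ.pull (k + 1) η)

theorem IsChainMapAt.mem_Z1 {Φ : BdlMap A.toVectorBdl B.toVectorBdl} (h : IsChainMapAt Φ 1)
    {β : B.Form 1} (hβ : β ∈ B.Z1) : Φ.pull 1 β ∈ A.Z1 := by
  have h1 := h β 0 (by rw [IsDiff, map_zero]; exact (LinearMap.mem_ker.1 hβ).symm)
  rw [IsDiff, map_zero, map_zero] at h1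
  exact LinearMap.mem_ker.2 h1.symm

theorem IsChainMapAt.mem_B1 {Φ : BdlMap A.toVectorBdl B.toVectorBdl} (h : IsChainMapAt Φ 0)
    {β : B.Form 1} (hβ : β ∈ B.B1) : Φ.pull 1 β ∈ A.B1 := by
  obtain ⟨f, hf⟩ := hβ
  exact ⟨Φ.pull 0 f, (h f β hf.symm).symm⟩

/-- The map `H^1(B) → H^1(A)` induced by a bundle map which commutes with the differentials of
functions and of 1-forms. -/
def pullH1 (Φ : BdlMap A.toVectorBdl B.toVectorBdl) (h0 : IsChainMapAt Φ 0)
    (h1 : IsChainMapAt Φ 1) : B.H1 →ₗ[ℝ] A.H1 :=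
  Submodule.mapQ _ _ ((Φ.pull 1).restrict (p := B.Z1) (q := A.Z1) fun _ h => h1.mem_Z1 h)
    fun _ h => h0.mem_B1 h

/-- A morphism of Lie algebroids: a bundle map whose pull-back of forms is a chain map. -/
structure Hom (A B : LieAlgebroid.{u}) extends BdlMap A.toVectorBdl B.toVectorBdl where
  chain : ∀ k, IsChainMapAt toBdlMap k

/-- The category of Lie algebroids and their morphisms. -/
instance : Category LieAlgebroid.{u} where
  Hom := Hom
  id A := ⟨BdlMap.id _, fun _ _ _ h => h⟩
  comp Φ Ψ := ⟨Ψ.toBdlMap.comp Φ.toBdlMap, fun k β η h => Φ.chain k _ _ (Ψ.chain k β η h)⟩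

/-- The map `H^1(B) → H^1(A)` induced by a morphism `A ⟶ B`. -/
def Hom.pullH1 (Φ : A ⟶ B) : B.H1 →ₗ[ℝ] A.H1 :=
  LieAlgebroid.pullH1 Φ.toBdlMap (Φ.chain 0) (Φ.chain 1)

variable (A)

/-- Smooth sections of `⋀^top T*M`. -/
def VolForm : Type u := {μ : ∀ x, A.T x [⋀^Fin A.n]→ₗ[ℝ] ℝ // ∀ X : Fin A.n → A.Vec,
  ContMDiff (𝓡 A.n) 𝓘(ℝ, ℝ) ∞ (fun x => μ x (fun i => X i x))}

/-- The fibre of the line bundle `L^A = ⋀^top A ⊗ ⋀^top T*M`. -/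
abbrev L (x : A.M) : Type u := (⋀[ℝ]^A.r (A.E x)) ⊗[ℝ] (A.T x [⋀^Fin A.n]→ₗ[ℝ] ℝ)

variable {A}

/-- The section `e_1 ∧ … ∧ e_r` of `⋀^top A`. -/
def wedge (e : Fin A.r → A.Sec) (x : A.M) : ⋀[ℝ]^A.r (A.E x) :=
  exteriorPower.ιMulti ℝ A.r (fun i => e i x)

/-- The Lie derivative `[a, e_1 ∧ … ∧ e_r] = ∑ e_1 ∧ … ∧ [a, e_i] ∧ … ∧ e_r`. -/
def bracketWedge (a : A.Sec) (e : Fin A.r → A.Sec) (x : A.M) : ⋀[ℝ]^A.r (A.E x) :=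
  ∑ i, wedge (Function.update e i (A.bracket a (e i))) x

/-- The Lie derivative `(ℒ_{ρ(a)} μ)(X_1, …, X_n)` of a top-degree form on the base. -/
def lieVol (a : A.Sec) (μ : A.VolForm) (X : Fin A.n → A.Vec) (x : A.M) : ℝ :=
  VectorBdl.deriv (A.anchor x (a x)) (fun y => μ.1 y (fun i => X i y)) -
    ∑ j, μ.1 x (Function.update (fun i => X i x) j
      (VectorField.mlieBracket (𝓡 A.n) (fun y => A.anchor y (a y)) (fun y => X j y) x))

/-- The contraction with `X_1, …, X_n` of
`D_a (ω ⊗ μ) = [a, ω] ⊗ μ + ω ⊗ ℒ_{ρ(a)} μ`, where `ω = e_1 ∧ … ∧ e_r`; here `D` is the canonical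
representation of `A` on `L^A`. -/
def repL (a : A.Sec) (e : Fin A.r → A.Sec) (μ : A.VolForm) (X : Fin A.n → A.Vec) (x : A.M) :
    ⋀[ℝ]^A.r (A.E x) :=
  μ.1 x (fun i => X i x) • bracketWedge a e x + lieVol a μ X x • wedge e x

/-- Near `x₀` the section `s` of `L^A` is `(e_1 ∧ … ∧ e_r) ⊗ μ`. -/
def EqNearL (s : ∀ x, A.L x) (e : Fin A.r → A.Sec) (μ : A.VolForm) (x₀ : A.M) : Prop :=
  ∀ᶠ x in 𝓝 x₀, s x = wedge e x ⊗ₜ[ℝ] μ.1 x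

/-- Smooth sections of `L^A`: those which are locally of the form `(e_1 ∧ … ∧ e_r) ⊗ μ` with smooth
`e_i` and `μ`. Every smooth section of the line bundle `L^A` is locally of this form. -/
def IsSmoothL (s : ∀ x, A.L x) : Prop := ∀ x₀, ∃ e μ, EqNearL s e μ x₀

/-- Near `x₀` the section `s` of `L^A ⊗ L^A` is the product of `(e_1 ∧ … ∧ e_r) ⊗ μ` and
`(f_1 ∧ … ∧ f_r) ⊗ μ₂`, where `f = e₂`. -/
def EqNearLL (s : ∀ x, A.L x ⊗[ℝ] A.L x) (e : Fin A.r → A.Sec) (μ : A.VolForm)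
    (e₂ : Fin A.r → A.Sec) (μ₂ : A.VolForm) (x₀ : A.M) : Prop :=
  ∀ᶠ x in 𝓝 x₀, s x = (wedge e x ⊗ₜ[ℝ] μ.1 x) ⊗ₜ[ℝ] (wedge e₂ x ⊗ₜ[ℝ] μ₂.1 x)

/-- Smooth sections of `L^A ⊗ L^A`. -/
def IsSmoothLL (s : ∀ x, A.L x ⊗[ℝ] A.L x) : Prop :=
  ∀ x₀, ∃ e μ e₂ μ₂, EqNearLL s e μ e₂ μ₂ x₀

/-- `D_a s = θ(a) s` for all sections `a`: the characteristic cocycle of a section `s` of `L^A`. -/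
def IsCharCocycle (s : ∀ x, A.L x) (θ : A.Form 1) : Prop :=
  ∀ x₀ e μ, EqNearL s e μ x₀ → ∀ (a : A.Sec) (X : Fin A.n → A.Vec),
    (θ.1 x₀ (fun _ => a x₀) * μ.1 x₀ (fun i => X i x₀)) • wedge e x₀ = repL a e μ X x₀

/-- `(D ⊗ D)_a s = θ(a) s` for all sections `a`, where `s` is a section of `L^A ⊗ L^A` and
`(D ⊗ D)_a (s₁ ⊗ s₂) = D_a s₁ ⊗ s₂ + s₁ ⊗ D_a s₂`. -/
def IsCharCocycleSq (s : ∀ x, A.L x ⊗[ℝ] A.L x) (θ : A.Form 1) : Prop :=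
  ∀ x₀ e μ e₂ μ₂, EqNearLL s e μ e₂ μ₂ x₀ → ∀ (a : A.Sec) (X Y : Fin A.n → A.Vec),
    θ.1 x₀ (fun _ => a x₀) •
        ((μ.1 x₀ (fun i => X i x₀) • wedge e x₀) ⊗ₜ[ℝ] (μ₂.1 x₀ (fun i => Y i x₀) • wedge e₂ x₀)) =
      repL a e μ X x₀ ⊗ₜ[ℝ] (μ₂.1 x₀ (fun i => Y i x₀) • wedge e₂ x₀) +
      (μ.1 x₀ (fun i => X i x₀) • wedge e x₀) ⊗ₜ[ℝ] repL a e₂ μ₂ Y x₀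

variable (A)

/-- `L^A` has a nowhere vanishing smooth section. -/
def OrientableL : Prop := ∃ s : ∀ x, A.L x, IsSmoothL s ∧ ∀ x, s x ≠ 0

/-- `c` is the modular class of `A`, the characteristic class of the representation `D` on `L^A`: the
class of the characteristic cocycle of a nowhere vanishing section of `L^A` if there is one, and one
half of the class obtained in the same way from `L^A ⊗ L^A` otherwise. -/
def IsModularClass (c : A.H1) : Prop :=
  (A.OrientableL ∧ ∃ (s : ∀ x, A.L x) (θ : A.Z1), IsSmoothL s ∧ (∀ x, s x ≠ 0) ∧
    IsCharCocycle s θ.1 ∧ c = Submodule.Quotient.mk θ) ∨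
  (¬ A.OrientableL ∧ ∃ (s : ∀ x, A.L x ⊗[ℝ] A.L x) (θ : A.Z1), IsSmoothLL s ∧ (∀ x, s x ≠ 0) ∧
    IsCharCocycleSq s θ.1 ∧ c = (1 / 2 : ℝ) • Submodule.Quotient.mk θ)

/-- The modular class `Mod A`. -/
def mod : A.H1 := Classical.epsilon A.IsModularClass

variable {A}

/-- The modular class `Mod Φ = Mod A - Φ^* Mod B` of a morphism `Φ : A ⟶ B`. -/
def Hom.mod (Φ : A ⟶ B) : A.H1 := A.mod - Hom.pullH1 Φ B.mod

/-- `Q`, with the bundle map `pr : Q → A` over `φ = pr.base`, is the pull-back Lie algebroid `φ^! A`: the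
fibre at `p` is `{(v, w) ∈ A_{φ(p)} × T_p P | ρ(v) = Tφ(w)}` (the two components being `pr` and the
anchor of `Q`), and for sections `q = (∑ f_i ⊗ b_i, X)` and `q' = (∑ g_j ⊗ c_j, Y)` the `A`-component
of the bracket is `∑ f_i g_j ⊗ [b_i, c_j] + ∑ X(g_j) ⊗ c_j - ∑ Y(f_i) ⊗ b_i`; the other component is
`[X, Y]` as in every Lie algebroid. These properties determine `Q` up to a unique isomorphism. -/
structure IsPullback (A Q : LieAlgebroid.{u}) (pr : BdlMap Q.toVectorBdl A.toVectorBdl) :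
    Prop where
  anchor_comm : ∀ p (q : Q.E p), A.anchor (pr.base p) (pr.fib p q) =
    mfderiv (𝓡 Q.n) (𝓡 A.n) pr.base p (Q.anchor p q)
  fiber : ∀ p (v : A.E (pr.base p)) (w : Q.T p),
    A.anchor (pr.base p) v = mfderiv (𝓡 Q.n) (𝓡 A.n) pr.base p w →
      ∃! q : Q.E p, pr.fib p q = v ∧ Q.anchor p q = w
  bracket : ∀ (q q' : Q.Sec) (k l : ℕ) (f : Fin k → Q.Fun) (b : Fin k → A.Sec)
    (g : Fin l → Q.Fun) (c : Fin l → A.Sec),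
    (∀ p, pr.fib p (q p) = ∑ i, f i p • b i (pr.base p)) →
    (∀ p, pr.fib p (q' p) = ∑ j, g j p • c j (pr.base p)) →
    ∀ p, pr.fib p (Q.bracket q q' p) =
      ∑ i, ∑ j, (f i p * g j p) • A.bracket (b i) (c j) (pr.base p) +
      ∑ j, VectorBdl.deriv (Q.anchor p (q p)) (g j) • c j (pr.base p) -
      ∑ i, VectorBdl.deriv (Q.anchor p (q' p)) (f i) • b i (pr.base p)

theorem _root_.LieAlgd.VectorBdl.exists_sec {A : VectorBdl.{u}} (y : A.M) (v : A.E y) :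
    ∃ a : A.Sec, a y = v := by
  obtain ⟨U, s, c, -, hy, -, hs⟩ := A.exists_frame y
  refine ⟨∑ i, c i ⟨y, v⟩ • s i, ?_⟩
  have h : ∀ t : Finset (Fin A.r), (∑ i ∈ t, c i ⟨y, v⟩ • s i : A.Sec) y =
      ∑ i ∈ t, c i ⟨y, v⟩ • s i y := by
    classical
    intro t
    induction t using Finset.induction_on with
    | empty => rfl
    | insert i t hi ih =>
      rw [Finset.sum_insert hi, Finset.sum_insert hi, ← ih]
      rfl
  rw [h, ← hs y hy v]

theorem _root_.LieAlgd.BdlMap.exists_expansion {Q A : VectorBdl.{u}} (Φ : BdlMap Q A) (q : Q.Sec)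
    (p : Q.M) : ∃ χ : Q.Fun, (∀ᶠ x in 𝓝 p, χ x = 1) ∧
      ∃ (f : Fin A.r → Q.Fun) (s : Fin A.r → A.Sec),
        ∀ x, Φ.fib x (VectorBdl.fsmul χ q x) = ∑ i, f i x • s i (Φ.base x) := by
  obtain ⟨U, s, c, hU, hp, hc, hs⟩ := A.exists_frame (Φ.base p)
  have hUo : IsOpen (Φ.base ⁻¹' U) := hU.preimage Φ.base_smooth.continuous
  obtain ⟨χ, -, hχ⟩ := (SmoothBumpFunction.nhds_basis_tsupport (I := 𝓡 Q.n) p).mem_iff.1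
    (hUo.mem_nhds (show p ∈ Φ.base ⁻¹' U from hp))
  have hsm : ∀ i, ContMDiff (𝓡 Q.n) 𝓘(ℝ, ℝ) ∞ (fun x => χ x * c i (Φ.tot ⟨x, q x⟩)) := by
    intro i
    refine contMDiff_of_tsupport fun x hx => ?_
    have hxU : x ∈ Φ.base ⁻¹' U := hχ (tsupport_mul_subset_left hx)
    refine χ.contMDiff.contMDiffAt.mul ?_
    have h1 : ContMDiffAt ((𝓡 A.n).prod 𝓘(ℝ, A.F)) 𝓘(ℝ, ℝ) ∞ (c i) (Φ.tot ⟨x, q x⟩) := by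
      refine (hc i).contMDiffAt ?_
      have : IsOpen {v : A.Tot | v.1 ∈ U} := hU.preimage (FiberBundle.continuous_proj A.F A.E)
      exact this.mem_nhds hxU
    exact h1.comp x ((Φ.smooth.comp q.contMDiff) x)
  refine ⟨⟨χ, χ.contMDiff⟩, χ.eventuallyEq_one, fun i => ⟨_, hsm i⟩, s, fun x => ?_⟩
  change Φ.fib x (χ x • q x) = ∑ i, (χ x * c i (Φ.tot ⟨x, q x⟩)) • s i (Φ.base x)
  by_cases hx : x ∈ Φ.base ⁻¹' U
  · rw [map_smul]
    conv_lhs => rw [hs _ hx (Φ.fib x (q x))]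
    rw [Finset.smul_sum]
    exact Finset.sum_congr rfl fun i _ => smul_smul _ _ _
  · have : χ x = 0 := image_eq_zero_of_notMem_tsupport fun h => hx (hχ h)
    simp [this]

theorem _root_.LieAlgd.VectorBdl.deriv_congr {A : VectorBdl.{u}} {x : A.M} (w : A.T x)
    {f g : A.M → ℝ} (h : ∀ᶠ y in 𝓝 x, f y = g y) : VectorBdl.deriv w f = VectorBdl.deriv w g := by
  have := Filter.EventuallyEq.mfderiv_eq (I := 𝓡 A.n) (I' := 𝓘(ℝ, ℝ)) h
  exact DFunLike.congr_fun this w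

theorem _root_.LieAlgd.VectorBdl.deriv_const {A : VectorBdl.{u}} {x : A.M} (w : A.T x) (c : ℝ) :
    VectorBdl.deriv w (fun _ => c) = 0 := by
  have : mfderiv (𝓡 A.n) 𝓘(ℝ, ℝ) (fun _ : A.M => c) x = 0 := mfderiv_const
  exact DFunLike.congr_fun this w

theorem _root_.LieAlgd.VectorBdl.deriv_mul {A : VectorBdl.{u}} {x : A.M} (w : A.T x)
    {f g : A.M → ℝ} (hf : ContMDiff (𝓡 A.n) 𝓘(ℝ, ℝ) ∞ f) (hg : ContMDiff (𝓡 A.n) 𝓘(ℝ, ℝ) ∞ g) :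
    VectorBdl.deriv w (fun y => f y * g y) =
      f x * VectorBdl.deriv w g + VectorBdl.deriv w f * g x := by
  have h := ((hf.mdifferentiableAt (x := x) (by simp)).hasMFDerivAt.mul
    (hg.mdifferentiableAt (x := x) (by simp)).hasMFDerivAt).mfderiv
  have h2 := DFunLike.congr_fun h w
  refine h2.trans ?_
  change f x * VectorBdl.deriv w g + g x * VectorBdl.deriv w f = _
  ring

theorem _root_.LieAlgd.VectorBdl.deriv_sum {A : VectorBdl.{u}} {x : A.M} (w : A.T x)
    {ι : Type*} (t : Finset ι) {f : ι → A.M → ℝ}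
    (hf : ∀ i, ContMDiff (𝓡 A.n) 𝓘(ℝ, ℝ) ∞ (f i)) :
    VectorBdl.deriv w (fun y => ∑ i ∈ t, f i y) = ∑ i ∈ t, VectorBdl.deriv w (f i) := by
  classical
  induction t using Finset.induction_on with
  | empty => simpa using VectorBdl.deriv_const w 0
  | insert i t hi ih =>
    simp only [Finset.sum_insert hi, ← ih]
    exact VectorBdl.deriv_add w (hf i) (ContMDiff.sum fun i _ => hf i)

theorem _root_.LieAlgd.VectorBdl.deriv_comp {Q A : VectorBdl.{u}} (φ : Q.M → A.M)
    (hφ : ContMDiff (𝓡 Q.n) (𝓡 A.n) ∞ φ) {p : Q.M} (w : Q.T p) {f : A.M → ℝ}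
    (hf : ContMDiff (𝓡 A.n) 𝓘(ℝ, ℝ) ∞ f) :
    VectorBdl.deriv w (fun y => f (φ y)) =
      VectorBdl.deriv (A := A) (mfderiv (𝓡 Q.n) (𝓡 A.n) φ p w) f := by
  have h := mfderiv_comp p (hf.mdifferentiableAt (x := φ p) (by simp))
    (hφ.mdifferentiableAt (x := p) (by simp))
  exact DFunLike.congr_fun h w

theorem _root_.LieAlgd.VectorBdl.Form.smooth {A : VectorBdl.{u}} {k : ℕ} (α : A.Form k)
    (a : Fin k → A.Sec) : ContMDiff (𝓡 A.n) 𝓘(ℝ, ℝ) ∞ (fun x => α.1 x (fun i => a i x)) :=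
  α.2 a

theorem d_zero_apply (f : A.Form 0) (a : Fin 1 → A.Sec) (x : A.M) :
    A.d 0 f a x = VectorBdl.deriv (A.anchor x (a 0 x)) (fun y => f.1 y ![]) := by
  simp [d, bracketTerm, Matrix.empty_eq]

/-- The linear functionals of a 1-form. -/
def lin (β : A.Form 1) (x : A.M) : A.E x →ₗ[ℝ] ℝ :=
  (AlternatingMap.ofSubsingleton ℝ (A.E x) ℝ (0 : Fin 1)).symm (β.1 x)

theorem lin_apply (β : A.Form 1) (x : A.M) (v : Fin 1 → A.E x) : β.1 x v = lin β x (v 0) := by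
  change _ = β.1 x (Function.const _ (v 0))
  congr 1
  funext i
  rw [Subsingleton.elim i 0]
  rfl

theorem d_one_apply (β : A.Form 1) (a : Fin 2 → A.Sec) (x : A.M) :
    A.d 1 β a x = VectorBdl.deriv (A.anchor x (a 0 x)) (fun y => lin β y (a 1 y)) -
      VectorBdl.deriv (A.anchor x (a 1 x)) (fun y => lin β y (a 0 y)) -
      lin β x (A.bracket (a 0) (a 1) x) := by
  have h : (Finset.Ici (0 : Fin 1)) = {0} := by decide
  simp [d, bracketTerm, lin_apply, Fin.sum_univ_two, h]
  ring

/-- The projection `φ^! A → A` commutes with the differential of functions. -/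
theorem IsPullback.chain_zero {Q : LieAlgebroid.{u}} {pr : BdlMap Q.toVectorBdl A.toVectorBdl}
    (h : IsPullback A Q pr) : IsChainMapAt pr 0 := by
  intro f η hη
  funext q p
  obtain ⟨a, ha⟩ := VectorBdl.exists_sec (pr.base p) (pr.fib p (q 0 p))
  have h1 := congrFun (congrFun hη (fun _ => a)) (pr.base p)
  rw [d_zero_apply] at h1 ⊢
  have h2 : Q.ev 1 (pr.pull 1 η) q p = A.ev 1 η (fun _ => a) (pr.base p) := by
    change η.1 (pr.base p) (fun i => pr.fib p (q i p)) = η.1 (pr.base p) (fun _ => a (pr.base p))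
    congr 1
    funext (i : Fin 1)
    rw [Subsingleton.elim i 0, ha]
  rw [h2, h1, ha, h.anchor_comm]
  have h3 := VectorBdl.deriv_comp pr.base pr.base_smooth (Q.anchor p (q 0 p))
    (f := fun y => f.1 y ![]) (by simpa [Matrix.empty_eq] using f.smooth ![])
  rw [← h3]
  congr 1
  funext y
  change _ = f.1 (pr.base y) _
  congr 1
  exact Subsingleton.elim _ _

theorem bracket_symm (a b : A.Sec) : A.bracket a b = - A.bracket b a := by
  have h := A.bracket_self (a + b)
  simp only [map_add, LinearMap.add_apply, A.bracket_self, zero_add, add_zero] at h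
  exact eq_neg_of_add_eq_zero_right h

theorem _root_.LieAlgd.update_zero {V : Type*} (v w z : V) :
    Function.update ![v, w] 0 z = ![z, w] := by
  funext i
  fin_cases i <;> rfl

theorem _root_.LieAlgd.update_one {V : Type*} (v w z : V) :
    Function.update ![v, w] 1 z = ![v, z] := by
  funext i
  fin_cases i <;> rfl

/-- The bilinear map of an alternating 2-form. -/
def bil {V : Type*} [AddCommGroup V] [Module ℝ V] (w₂ : V [⋀^Fin 2]→ₗ[ℝ] ℝ) : V →ₗ[ℝ] V →ₗ[ℝ] ℝ :=
  LinearMap.mk₂ ℝ (fun v w => w₂ ![v, w])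
    (fun v v' w => by
      have h := w₂.map_update_add ![v, w] 0 v v'
      rwa [update_zero, update_zero, update_zero] at h)
    (fun t v w => by
      have h := w₂.map_update_smul ![v, w] 0 t v
      rwa [update_zero, update_zero] at h)
    (fun v w w' => by
      have h := w₂.map_update_add ![v, w] 1 w w'
      rwa [update_one, update_one, update_one] at h)
    (fun t v w => by
      have h := w₂.map_update_smul ![v, w] 1 t w
      rwa [update_one, update_one] at h)

theorem bracket_fsmul_of_one (a b : A.Sec) (χ : A.Fun) {x : A.M} (hχ : ∀ᶠ y in 𝓝 x, χ y = 1) :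
    A.bracket a (VectorBdl.fsmul χ b) x = A.bracket a b x := by
  rw [A.leibniz, hχ.self_of_nhds, one_smul, VectorBdl.deriv_congr (g := fun _ => 1) _ hχ,
    VectorBdl.deriv_const, zero_smul, add_zero]

/-- The projection `φ^! A → A` commutes with the differential of 1-forms. -/
theorem IsPullback.chain_one {Q : LieAlgebroid.{u}} {pr : BdlMap Q.toVectorBdl A.toVectorBdl}
    (h : IsPullback A Q pr) : IsChainMapAt pr 1 := by
  intro β η hη
  funext q p
  obtain ⟨χ, hχ, f, b, hfb⟩ := pr.exists_expansion (q 0) p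
  obtain ⟨χ', hχ', g, c, hgc⟩ := pr.exists_expansion (q 1) p
  have hβ : ∀ a a' : A.Sec, ∀ y, η.1 y ![a y, a' y] =
      VectorBdl.deriv (A.anchor y (a y)) (fun y => lin β y (a' y)) -
      VectorBdl.deriv (A.anchor y (a' y)) (fun y => lin β y (a y)) -
      lin β y (A.bracket a a' y) := by
    intro a a' y
    have h1 := congrFun (congrFun hη ![a, a']) y
    rw [d_one_apply] at h1
    rw [← show (fun i => (![a, a'] i) y) = ![a y, a' y] by
      funext i; fin_cases i <;> rfl]
    exact h1
  have hlin : ∀ y v, lin (pr.pull 1 β) y v = lin β (pr.base y) (pr.fib y v) := fun _ _ => rfl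
  have hs : ∀ a : A.Sec, ContMDiff (𝓡 A.n) 𝓘(ℝ, ℝ) ∞ (fun y => lin β y (a y)) :=
    fun a => β.smooth (fun _ => a)
  have hev : Q.ev 2 (pr.pull 2 η) q p =
      η.1 (pr.base p) ![pr.fib p (q 0 p), pr.fib p (q 1 p)] := by
    change η.1 (pr.base p) (fun i => pr.fib p (q i p)) = _
    congr 1
    funext (i : Fin 2)
    fin_cases i <;> rfl
  have e0 : pr.fib p (q 0 p) = ∑ i, f i p • b i (pr.base p) := by
    rw [← hfb p]
    change _ = pr.fib p (χ p • q 0 p)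
    rw [hχ.self_of_nhds, one_smul]
  have e1 : pr.fib p (q 1 p) = ∑ i, g i p • c i (pr.base p) := by
    rw [← hgc p]
    change _ = pr.fib p (χ' p • q 1 p)
    rw [hχ'.self_of_nhds, one_smul]
  have d0 : ∀ w : Q.T p, VectorBdl.deriv w (fun y => lin β (pr.base y) (pr.fib y (q 0 y))) =
      ∑ i, (f i p * VectorBdl.deriv (A := A.toVectorBdl) (mfderiv (𝓡 Q.n) (𝓡 A.n) pr.base p w)
          (fun y => lin β y (b i y)) +
        VectorBdl.deriv w (f i) * lin β (pr.base p) (b i (pr.base p))) := by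
    intro w
    have hsm : ∀ i, ContMDiff (𝓡 Q.n) 𝓘(ℝ, ℝ) ∞
        (fun y => lin β (pr.base y) (b i (pr.base y))) := fun i => (hs (b i)).comp pr.base_smooth
    have hsm' : ∀ i, ContMDiff (𝓡 Q.n) 𝓘(ℝ, ℝ) ∞
        (fun y => f i y * lin β (pr.base y) (b i (pr.base y))) :=
      fun i => (f i).contMDiff.mul (hsm i)
    rw [VectorBdl.deriv_congr (g := fun y => ∑ i, f i y * lin β (pr.base y) (b i (pr.base y))) w,
      VectorBdl.deriv_sum w _ hsm']
    · refine Finset.sum_congr rfl fun i _ => ?_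
      rw [VectorBdl.deriv_mul w (f i).contMDiff (hsm i)]
      congr 2
      exact VectorBdl.deriv_comp pr.base pr.base_smooth w (hs (b i))
    · filter_upwards [hχ] with y hy
      have : pr.fib y (q 0 y) = ∑ i, f i y • b i (pr.base y) := by
        rw [← hfb y]
        change _ = pr.fib y (χ y • q 0 y)
        rw [hy, one_smul]
      rw [this, map_sum]
      simp
  have d1 : ∀ w : Q.T p, VectorBdl.deriv w (fun y => lin β (pr.base y) (pr.fib y (q 1 y))) =
      ∑ i, (g i p * VectorBdl.deriv (A := A.toVectorBdl) (mfderiv (𝓡 Q.n) (𝓡 A.n) pr.base p w)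
          (fun y => lin β y (c i y)) +
        VectorBdl.deriv w (g i) * lin β (pr.base p) (c i (pr.base p))) := by
    intro w
    have hsm : ∀ i, ContMDiff (𝓡 Q.n) 𝓘(ℝ, ℝ) ∞
        (fun y => lin β (pr.base y) (c i (pr.base y))) := fun i => (hs (c i)).comp pr.base_smooth
    have hsm' : ∀ i, ContMDiff (𝓡 Q.n) 𝓘(ℝ, ℝ) ∞
        (fun y => g i y * lin β (pr.base y) (c i (pr.base y))) :=
      fun i => (g i).contMDiff.mul (hsm i)
    rw [VectorBdl.deriv_congr (g := fun y => ∑ i, g i y * lin β (pr.base y) (c i (pr.base y))) w,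
      VectorBdl.deriv_sum w _ hsm']
    · refine Finset.sum_congr rfl fun i _ => ?_
      rw [VectorBdl.deriv_mul w (g i).contMDiff (hsm i)]
      congr 2
      exact VectorBdl.deriv_comp pr.base pr.base_smooth w (hs (c i))
    · filter_upwards [hχ'] with y hy
      have : pr.fib y (q 1 y) = ∑ i, g i y • c i (pr.base y) := by
        rw [← hgc y]
        change _ = pr.fib y (χ' y • q 1 y)
        rw [hy, one_smul]
      rw [this, map_sum]
      simp
  have hbr : Q.bracket (q 0) (q 1) p =
      Q.bracket (VectorBdl.fsmul χ (q 0)) (VectorBdl.fsmul χ' (q 1)) p := by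
    rw [bracket_fsmul_of_one _ _ χ' hχ', bracket_symm (q 0) (q 1),
      bracket_symm (VectorBdl.fsmul χ (q 0)) (q 1)]
    change - Q.bracket (q 1) (q 0) p = - Q.bracket (q 1) (VectorBdl.fsmul χ (q 0)) p
    rw [bracket_fsmul_of_one _ _ χ hχ]
  have hbr2 := h.bracket _ _ _ _ f b g c hfb hgc p
  have a0 : VectorBdl.fsmul χ (q 0) p = q 0 p := by
    change χ p • q 0 p = _
    rw [hχ.self_of_nhds, one_smul]
  have a1 : VectorBdl.fsmul χ' (q 1) p = q 1 p := by
    change χ' p • q 1 p = _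
    rw [hχ'.self_of_nhds, one_smul]
  rw [← hbr, a0, a1] at hbr2
  rw [hev, d_one_apply]
  simp only [hlin]
  rw [d0, d1, hbr2, ← h.anchor_comm, ← h.anchor_comm]
  have dl : ∀ {y : A.M} (h0 : A.M → ℝ) (t : Fin A.r → ℝ) (s : Fin A.r → A.E y),
      VectorBdl.deriv (A.anchor y (∑ i, t i • s i)) h0 =
        ∑ i, t i * VectorBdl.deriv (A.anchor y (s i)) h0 := by
    intro y h0 t s
    change (mfderiv (𝓡 A.n) 𝓘(ℝ, ℝ) h0 y) _ = _
    simp only [map_sum, map_smul]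
    rfl
  have hηl : η.1 (pr.base p) ![pr.fib p (q 0 p), pr.fib p (q 1 p)] =
      ∑ i, ∑ j, (f i p * g j p) * η.1 (pr.base p) ![b i (pr.base p), c j (pr.base p)] := by
    change bil (η.1 (pr.base p)) _ _ = ∑ i, ∑ j, _ * bil (η.1 (pr.base p)) _ _
    rw [e0, e1]
    simp only [map_sum, map_smul, LinearMap.sum_apply, LinearMap.smul_apply, smul_eq_mul,
      Finset.mul_sum]
    rw [Finset.sum_comm]
    exact Finset.sum_congr rfl fun i _ => Finset.sum_congr rfl fun j _ => by ring
  rw [hηl, e0, e1]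
  simp only [dl]
  simp only [hβ, map_sub, map_add, map_sum, map_smul, smul_eq_mul]
  simp only [mul_sub, Finset.sum_sub_distrib, Finset.mul_sum, Finset.sum_add_distrib]
  have hc : ∀ G : Fin A.r → Fin A.r → ℝ, ∑ j, ∑ i, G i j = ∑ i, ∑ j, G i j :=
    fun G => Finset.sum_comm
  rw [hc fun i j => g j p * (f i p * VectorBdl.deriv (A.anchor (pr.base p) (b i (pr.base p)))
    fun y => lin β y (c j y))]
  have e2 : ∀ i j, g j p * (f i p * VectorBdl.deriv (A.anchor (pr.base p) (b i (pr.base p)))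
      fun y => lin β y (c j y)) = f i p * g j p *
      VectorBdl.deriv (A.anchor (pr.base p) (b i (pr.base p))) fun y => lin β y (c j y) :=
    fun i j => by ring
  simp only [e2, ← mul_assoc]
  ring

/-- A Lie algebroid is its own pull-back along the identity. -/
theorem isPullback_id (A : LieAlgebroid.{u}) : IsPullback A A (BdlMap.id A.toVectorBdl) where
  anchor_comm p q := by
    have h : mfderiv (𝓡 A.n) (𝓡 A.n) (_root_.id : A.M → A.M) p = ContinuousLinearMap.id ℝ _ :=
      mfderiv_id
    exact (DFunLike.congr_fun h (A.anchor p q)).symm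
  fiber p v w hvw := by
    have h : mfderiv (𝓡 A.n) (𝓡 A.n) (_root_.id : A.M → A.M) p = ContinuousLinearMap.id ℝ _ :=
      mfderiv_id
    refine ⟨v, ⟨rfl, hvw.trans (DFunLike.congr_fun h w)⟩, fun q hq => hq.1⟩
  bracket q q' k l f b g c hq hq' p := by
    have ev : ∀ {m : ℕ} (t : Fin m → A.Sec) (y : A.M), (∑ i, t i) y = ∑ i, t i y := by
      intro m t y
      exact map_sum (ContMDiffSection.coeAddHom (𝓡 A.n) (EuclideanSpace ℝ (Fin A.r)) ∞ A.E
        |>.comp (AddMonoidHom.id _) |> (Pi.evalAddMonoidHom _ y).comp) t _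
    have h1 : q = ∑ i, VectorBdl.fsmul (f i) (b i) := by
      ext y
      rw [ev]
      exact hq y
    have h2 : q' = ∑ j, VectorBdl.fsmul (g j) (c j) := by
      ext y
      rw [ev]
      exact hq' y
    have L2 : ∀ (s t : A.Sec) (χ : A.Fun) (y : A.M), A.bracket (VectorBdl.fsmul χ s) t y =
        χ y • A.bracket s t y - VectorBdl.deriv (A.anchor y (t y)) χ • s y := by
      intro s t χ y
      rw [bracket_symm (VectorBdl.fsmul χ s) t, bracket_symm s t]
      change - A.bracket t (VectorBdl.fsmul χ s) y = χ y • (- A.bracket t s y) - _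
      rw [A.leibniz, smul_neg]
      abel
    have key : A.bracket q q' p = ∑ i, ∑ j, (f i p * g j p) • A.bracket (b i) (c j) p +
      ∑ j, VectorBdl.deriv (A.anchor p (q p)) (g j) • c j p -
      ∑ i, VectorBdl.deriv (A.anchor p (q' p)) (f i) • b i p := by
      conv_lhs => rw [h2]
      rw [map_sum, ev]
      simp only [A.leibniz]
      have h3 : ∀ j, A.bracket q (c j) p = ∑ i, (f i p • A.bracket (b i) (c j) p -
          VectorBdl.deriv (A.anchor p (c j p)) (f i) • b i p) := by
        intro j
        conv_lhs => rw [h1]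
        rw [map_sum, LinearMap.sum_apply, ev]
        exact Finset.sum_congr rfl fun i _ => L2 _ _ _ _
      have h4 : ∀ i, VectorBdl.deriv (A.anchor p (q' p)) (f i) =
          ∑ j, g j p * VectorBdl.deriv (A.anchor p (c j p)) (f i) := by
        intro i
        have : q' p = ∑ j, g j p • c j p := hq' p
        rw [this]
        change (mfderiv (𝓡 A.n) 𝓘(ℝ, ℝ) (f i) p) _ = _
        simp only [map_sum, map_smul]
        rfl
      simp only [h3, h4, Finset.smul_sum, Finset.sum_smul, smul_sub, smul_smul,
        Finset.sum_add_distrib, Finset.sum_sub_distrib]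
      rw [Finset.sum_comm (f := fun j i => (g j p * f i p) • A.bracket (b i) (c j) p),
        Finset.sum_comm (f := fun j i =>
          (g j p * VectorBdl.deriv (A.anchor p (c j p)) (f i)) • b i p)]
      simp only [mul_comm (g _ p) (f _ p)]
      abel
    exact key

/-- The inverse of a bijective linear map (zero if the map is not bijective). -/
def invMap {V W : Type u} [AddCommGroup V] [Module ℝ V] [AddCommGroup W] [Module ℝ W]
    (f : V →ₗ[ℝ] W) : W →ₗ[ℝ] V :=
  open Classical in
  if h : Function.Bijective f then (LinearEquiv.ofBijective f h).symm.toLinearMap else 0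

theorem invMap_comp {V W X : Type u} [AddCommGroup V] [Module ℝ V] [AddCommGroup W] [Module ℝ W]
    [AddCommGroup X] [Module ℝ X] (f : V →ₗ[ℝ] W) (e : W ≃ₗ[ℝ] X) :
    invMap (e.toLinearMap ∘ₗ f) ∘ₗ e.toLinearMap = invMap f := by
  have hiff : Function.Bijective (e.toLinearMap ∘ₗ f) ↔ Function.Bijective f :=
    Function.Bijective.of_comp_iff' e.bijective f
  by_cases h : Function.Bijective f
  · have h' := hiff.2 h
    rw [invMap, invMap, dif_pos h, dif_pos h']
    ext w
    obtain ⟨v, rfl⟩ := h.2 w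
    have h1 : (LinearEquiv.ofBijective f h).symm (f v) = v :=
      (LinearEquiv.ofBijective f h).symm_apply_apply v
    have h2 : (LinearEquiv.ofBijective _ h').symm (e (f v)) = v :=
      (LinearEquiv.ofBijective _ h').symm_apply_apply v
    exact h2.trans h1.symm
  · rw [invMap, invMap, dif_neg h, dif_neg (fun h' => h (hiff.1 h'))]
    rfl

/-- A generalized morphism from `A` to `B`: a manifold `P = Q.M` with a surjective submersion
`φ = pr.base` to the base of `A`, and a Lie algebroid morphism `Ψ` from `Q = φ^! A` to `B`. -/
structure GenMor (A B : LieAlgebroid.{u}) : Type (u + 1) where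
  Q : LieAlgebroid.{u}
  pr : BdlMap Q.toVectorBdl A.toVectorBdl
  isPullback : IsPullback A Q pr
  surj : Function.Surjective pr.base
  submersion : ∀ p, Function.Surjective (mfderiv (𝓡 Q.n) (𝓡 A.n) pr.base p)
  Ψ : Q ⟶ B

namespace GenMor
variable {A B C : LieAlgebroid.{u}}

/-- The fibres of the submersion are 1-connected. -/
def Fibers1Connected (P : GenMor A B) : Prop :=
  ∀ m : A.M, SimplyConnectedSpace {p : P.Q.M // P.pr.base p = m}

/-- The map `H^1(A) → H^1(φ^! A)` induced by the projection. -/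
def hat (P : GenMor A B) : A.H1 →ₗ[ℝ] P.Q.H1 :=
  LieAlgebroid.pullH1 P.pr P.isPullback.chain_zero P.isPullback.chain_one

/-- The map `H^1(B) → H^1(A)` induced by a generalized morphism: `Ψ^*` followed by the inverse of
`H^1(A) → H^1(φ^! A)`. -/
def pull (P : GenMor A B) : B.H1 →ₗ[ℝ] A.H1 := invMap P.hat ∘ₗ Hom.pullH1 P.Ψ

/-- The modular class of a generalized morphism: the preimage of `Mod Ψ` under
`H^1(A) → H^1(φ^! A)`. -/
def mod (P : GenMor A B) : A.H1 := invMap P.hat (Hom.mod P.Ψ)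

/-- Isomorphism of generalized morphisms: a diffeomorphism `P₁ ≅ P₂` over the base of `A` whose induced
isomorphism `σ` of the pull-back Lie algebroids carries `Ψ₂` to `Ψ₁`. (A Lie
algebroid isomorphism commutes with the anchors, so that one with `pr₂ ∘ σ = pr₁` is the induced one.) -/
def Iso (P₁ P₂ : GenMor A B) : Prop :=
  ∃ σ : P₁.Q ≅ P₂.Q, P₁.pr = P₂.pr.comp σ.hom.toBdlMap ∧ P₁.Ψ = σ.hom ≫ P₂.Ψ

theorem Iso.pull_eq {P₁ P₂ : GenMor A B} (h : Iso P₁ P₂) : P₁.pull = P₂.pull := by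
  obtain ⟨σ, h1, h2⟩ := h
  have hc : ∀ {X Y Z : LieAlgebroid.{u}} (f : X ⟶ Y) (g : Y ⟶ Z) (c : Z.H1),
      Hom.pullH1 (f ≫ g) c = Hom.pullH1 f (Hom.pullH1 g c) := by
    intro X Y Z f g c
    induction c using Submodule.Quotient.induction_on
    rfl
  have hi : ∀ {X : LieAlgebroid.{u}} (c : X.H1), Hom.pullH1 (𝟙 X) c = c := by
    intro X c
    induction c using Submodule.Quotient.induction_on
    rfl
  let e : P₂.Q.H1 ≃ₗ[ℝ] P₁.Q.H1 := LinearEquiv.ofLinearMap (Hom.pullH1 σ.hom) (Hom.pullH1 σ.inv)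
    (by
      refine LinearMap.ext fun c => ?_
      change Hom.pullH1 σ.hom (Hom.pullH1 σ.inv c) = c
      rw [← hc, σ.hom_inv_id, hi])
    (by
      refine LinearMap.ext fun c => ?_
      change Hom.pullH1 σ.inv (Hom.pullH1 σ.hom c) = c
      rw [← hc, σ.inv_hom_id, hi])
  have h3 : P₁.hat = e.toLinearMap ∘ₗ P₂.hat := by
    have : ∀ (pr : BdlMap P₁.Q.toVectorBdl A.toVectorBdl) (a : IsChainMapAt pr 0)
        (b : IsChainMapAt pr 1), pr = P₂.pr.comp σ.hom.toBdlMap →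
        LieAlgebroid.pullH1 pr a b = e.toLinearMap ∘ₗ P₂.hat := by
      rintro pr a b rfl
      refine LinearMap.ext fun c => ?_
      induction c using Submodule.Quotient.induction_on
      rfl
    exact this _ _ _ h1
  have h4 : Hom.pullH1 P₁.Ψ = e.toLinearMap ∘ₗ Hom.pullH1 P₂.Ψ := by
    rw [h2]
    exact LinearMap.ext fun c => hc _ _ c
  rw [pull, pull, h3, h4, ← LinearMap.comp_assoc, invMap_comp]

/-- A morphism of Lie algebroids as a generalized morphism, with `P` the base of `A`. -/
def ofHom (Φ : A ⟶ B) : GenMor A B where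
  Q := A
  pr := BdlMap.id _
  isPullback := isPullback_id A
  surj := Function.surjective_id
  submersion p := by
    have h : mfderiv (𝓡 A.n) (𝓡 A.n) (_root_.id : A.M → A.M) p = ContinuousLinearMap.id ℝ _ :=
      mfderiv_id
    exact fun w => ⟨w, DFunLike.congr_fun h w⟩
  Ψ := Φ

theorem ofHom_fibers (Φ : A ⟶ B) : (ofHom Φ).Fibers1Connected := by
  intro m
  have : Unique {p : (ofHom Φ).Q.M // (ofHom Φ).pr.base p = m} :=
    ⟨⟨⟨m, rfl⟩⟩, fun p => Subtype.ext p.2⟩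
  infer_instance

/-- `P₃` is a composite of `P₁` and `P₂` via `χ` and `ξ`: the map `(χ, ξ)` identifies the manifold `P₃`
with the fibre product of `P₁` and `P₂` over the base of `B`, the submersion is `φ₁ ∘ χ`, and `Ψ₃` sends
`q₃` to `Ψ₂ q₂`, where `q₁ = (pr₃ q₃, Tχ(ρ q₃))` and `q₂ = (Ψ₁ q₁, Tξ(ρ q₃))`. -/
structure IsCompositeVia (P₁ : GenMor A B) (P₂ : GenMor B C) (P₃ : GenMor A C)
    (χ : P₃.Q.M → P₁.Q.M) (ξ : P₃.Q.M → P₂.Q.M) : Prop where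
  smooth_fst : ContMDiff (𝓡 P₃.Q.n) (𝓡 P₁.Q.n) ∞ χ
  smooth_snd : ContMDiff (𝓡 P₃.Q.n) (𝓡 P₂.Q.n) ∞ ξ
  embedding : Topology.IsEmbedding (fun z => (χ z, ξ z))
  range : Set.range (fun z => (χ z, ξ z)) = {x | P₁.Ψ.base x.1 = P₂.pr.base x.2}
  immersion : ∀ z (w : P₃.Q.T z), mfderiv (𝓡 P₃.Q.n) (𝓡 P₁.Q.n) χ z w = 0 →
    mfderiv (𝓡 P₃.Q.n) (𝓡 P₂.Q.n) ξ z w = 0 → w = 0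
  base : ∀ z, P₃.pr.base z = P₁.pr.base (χ z)
  map : ∀ z (q₃ : P₃.Q.E z) (q₁ : P₁.Q.E (χ z)) (q₂ : P₂.Q.E (ξ z)),
    P₁.pr.tot ⟨χ z, q₁⟩ = P₃.pr.tot ⟨z, q₃⟩ →
    P₁.Q.anchor (χ z) q₁ = mfderiv (𝓡 P₃.Q.n) (𝓡 P₁.Q.n) χ z (P₃.Q.anchor z q₃) →
    P₂.pr.tot ⟨ξ z, q₂⟩ = P₁.Ψ.tot ⟨χ z, q₁⟩ →
    P₂.Q.anchor (ξ z) q₂ = mfderiv (𝓡 P₃.Q.n) (𝓡 P₂.Q.n) ξ z (P₃.Q.anchor z q₃) →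
    P₃.Ψ.tot ⟨z, q₃⟩ = P₂.Ψ.tot ⟨ξ z, q₂⟩

/-- `P₃` is a composite of `P₁ : A → B` and `P₂ : B → C`. -/
def IsComposite (P₁ : GenMor A B) (P₂ : GenMor B C) (P₃ : GenMor A C) : Prop :=
  ∃ χ ξ, IsCompositeVia P₁ P₂ P₃ χ ξ

end GenMor
end LieAlgebroid

open LieAlgebroid

/-- Generalized morphisms with 1-connected fibres. -/
def GenMor1 (A B : LieAlgebroid.{u}) : Type (u + 1) := {P : GenMor A B // P.Fibers1Connected}

/-- Lie algebroids, as objects of the category whose arrows are the isomorphism classes of generalized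
morphisms with 1-connected fibres. -/
structure Algd1 : Type (u + 1) where
  of ::
  alg : LieAlgebroid.{u}

/-- The arrows are the isomorphism classes of generalized morphisms with 1-connected fibres. -/
instance : Quiver Algd1.{u} where
  Hom A B := Quot fun P₁ P₂ : GenMor1 A.alg B.alg => P₁.1.Iso P₂.1

namespace Algd1
variable {A B C : Algd1.{u}}

/-- The isomorphism class of a generalized morphism. -/
def cls (P : GenMor1 A.alg B.alg) : A ⟶ B := Quot.mk _ P

/-- The identity arrow. -/
def id (A : Algd1.{u}) : A ⟶ A :=
  cls ⟨GenMor.ofHom (𝟙 A.alg), GenMor.ofHom_fibers _⟩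

/-- `h` is the composite of `f` and `g`. -/
def IsComp (f : A ⟶ B) (g : B ⟶ C) (h : A ⟶ C) : Prop :=
  ∃ (P₁ : GenMor1 A.alg B.alg) (P₂ : GenMor1 B.alg C.alg) (P₃ : GenMor1 A.alg C.alg),
    cls P₁ = f ∧ cls P₂ = g ∧ cls P₃ = h ∧ GenMor.IsComposite P₁.1 P₂.1 P₃.1

/-- The map `H^1(B) → H^1(A)` induced by an arrow. -/
def pullH1 (f : A ⟶ B) : B.alg.H1 →ₗ[ℝ] A.alg.H1 :=
  Quot.lift (fun P : GenMor1 A.alg B.alg => P.1.pull) (fun _ _ h => h.pull_eq) f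

end Algd1

/-- The coboundary `(δc)(f) = c(A) - F(f)(c(B))`, for `f : A ⟶ B`, of a 0-cochain `c` with values in the
anti-representation given by the maps `F(f) : H(B) → H(A)`. -/
def coboundary {V : Type*} [Quiver V] {H : V → Type*} [∀ A, AddCommGroup (H A)]
    [∀ A, Module ℝ (H A)] (F : ∀ {A B : V}, (A ⟶ B) → (H B →ₗ[ℝ] H A)) (c : ∀ A, H A)
    {A B : V} (f : A ⟶ B) : H A :=
  c A - F f (c B)

end LieAlgd
end

/-!
A function, a section or a 1-form is handled through its values: a tangent vector is known from the
derivatives of functions along it, and `[γ] = [γ']` in `H^1` means `γ = γ' + d g` for a function `g`.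

**The modular class.** On every bundle `V` over the base there are densities, that is positive top-degree
forms on the fibres defined up to sign (`Dens`); they exist by a partition of unity although `V` need not be
orientable. A derivation `δ` of the sections of `V` has a divergence `Dens.lam` with respect to a
density: in a frame it is the derivative of the logarithm of the density of the frame, minus the trace of
`δ` in the frame. Densities on `A` and on `TM` give the closed 1-form
`θ(a) = div(L_{ρ(a)}) - div([a, ·])` (`exists_modForm`). In a local nowhere vanishing section of `L^A` it differs
from the defining 1-form by the differential of a logarithm, so that its class is a modular class,
and the only one (`isModularClass_mod`).

**Invariance.** For a pull-back Lie algebroid `Q = φ^! A` there are frames of `A`, `TM`, `Q`, `TP` such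
that the last two consist of lifts of the first two and of common vertical vectors (`Adapted`). The
traces of `[q, ·]` and of the Lie derivative on the vertical parts cancel, and the rest is the difference of the
traces on the base. Hence `φ̂ (Mod A) = Mod Q` (`IsPullback.pullH1_mod`).

**Bijectivity of `φ̂`.** Let `η` be a closed 1-form on `Q`, whose restriction to the vertical elements is a
family of closed 1-forms on the fibres of `φ`. By the Poincaré lemma with parameters it has local
primitives on `P` (`IsPullback.exists_vertical_primitive`). A fibre is simply connected, so that they glue to a primitive
on the fibre: it is a section of a covering with fibre `ℝ` (`exists_global_primitive`). After subtraction of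
its values along a local section of `φ` the primitive is smooth across the fibres, and a partition of unity on the
base combines the results to a function `g` on `P` (`exists_vertical_integral`). The form `η - d g` vanishes on
vertical elements; since it is closed and the fibres are connected, it is the pull-back of a closed form
on `A` (`IsPullback.exists_basic`). Injectivity holds because a function without vertical
derivatives comes from the base (`IsPullback.pullH1_bijective`).

**Composites.** If `Ψ₂^* γ = pr₂^* β + d g₂` and `Ψ₁^* β = pr₁^* α + d g₁`, then for the composite
`Ψ₃^* γ = pr₃^* α + d (g₁ ∘ χ + g₂ ∘ ξ)`, where `χ` and `ξ` are the projections of the fibre product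
(`GenMor.IsComposite.pull_eq`). The formula for `Mod P` follows from the invariance and from bijectivity.
-/

universe v
set_option linter.unusedSectionVars false

noncomputable section

/-! ### Functions and derivatives on the base -/

namespace LieAlgd

namespace VectorBdl
variable {A : VectorBdl.{u}}

theorem locallyCompact (A : VectorBdl.{u}) : LocallyCompactSpace A.M :=
  Manifold.locallyCompact_of_finiteDimensional (𝓡 A.n)

theorem sigmaCompact (A : VectorBdl.{u}) : SigmaCompactSpace A.M :=
  have := A.locallyCompact
  inferInstance

/-- A function which is smooth near a point agrees near that point with a global smooth function. -/
theorem exists_fun_eventuallyEq {x₀ : A.M} {f : A.M → ℝ}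
    (hf : ∀ᶠ x in 𝓝 x₀, ContMDiffAt (𝓡 A.n) 𝓘(ℝ, ℝ) ∞ f x) :
    ∃ g : A.Fun, ∀ᶠ x in 𝓝 x₀, g x = f x := by
  obtain ⟨U, hU, hUo, hxU⟩ := eventually_nhds_iff.1 hf
  obtain ⟨χ, -, hχ⟩ := (SmoothBumpFunction.nhds_basis_tsupport (I := 𝓡 A.n) x₀).mem_iff.1
    (hUo.mem_nhds hxU)
  refine ⟨⟨fun x => χ x * f x, contMDiff_of_tsupport fun x hx => ?_⟩, ?_⟩
  · exact χ.contMDiff.contMDiffAt.mul (hU x (hχ (tsupport_mul_subset_left hx)))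
  · filter_upwards [χ.eventuallyEq_one] with x hx
    change χ x * f x = f x
    rw [hx, Pi.one_apply, one_mul]

/-- A smooth bump function supported in a given neighbourhood. -/
theorem exists_bump {x₀ : A.M} {U : Set A.M} (hU : U ∈ 𝓝 x₀) :
    ∃ χ : A.Fun, (∀ᶠ x in 𝓝 x₀, χ x = 1) ∧ tsupport χ ⊆ U := by
  obtain ⟨χ, -, hχ⟩ := (SmoothBumpFunction.nhds_basis_tsupport (I := 𝓡 A.n) x₀).mem_iff.1 hU
  exact ⟨⟨χ, χ.contMDiff⟩, χ.eventuallyEq_one, hχ⟩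

theorem Fun.mdiff (f : A.Fun) (x : A.M) : MDifferentiableAt (𝓡 A.n) 𝓘(ℝ, ℝ) f x :=
  f.contMDiff.mdifferentiableAt (by simp)

theorem mdiff_of_contMDiffAt {f : A.M → ℝ} {x : A.M}
    (h : ContMDiffAt (𝓡 A.n) 𝓘(ℝ, ℝ) ∞ f x) : MDifferentiableAt (𝓡 A.n) 𝓘(ℝ, ℝ) f x :=
  h.mdifferentiableAt (by simp)

section deriv
variable {x : A.M} (w : A.T x) {f g : A.M → ℝ}

theorem deriv_add_at (hf : MDifferentiableAt (𝓡 A.n) 𝓘(ℝ, ℝ) f x)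
    (hg : MDifferentiableAt (𝓡 A.n) 𝓘(ℝ, ℝ) g x) :
    deriv w (fun y => f y + g y) = deriv w f + deriv w g :=
  DFunLike.congr_fun (mfderiv_add hf hg) w

theorem deriv_sub_at (hf : MDifferentiableAt (𝓡 A.n) 𝓘(ℝ, ℝ) f x)
    (hg : MDifferentiableAt (𝓡 A.n) 𝓘(ℝ, ℝ) g x) :
    deriv w (fun y => f y - g y) = deriv w f - deriv w g :=
  DFunLike.congr_fun (mfderiv_sub hf hg) w

theorem deriv_comp_real {F : ℝ → ℝ} {F' : ℝ} (hf : MDifferentiableAt (𝓡 A.n) 𝓘(ℝ, ℝ) f x)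
    (hF : HasDerivAt F F' (f x)) : deriv w (fun y => F (f y)) = F' * deriv w f := by
  have h1 : HasMFDerivAt 𝓘(ℝ, ℝ) 𝓘(ℝ, ℝ) F (f x) _ := hF.hasFDerivAt.hasMFDerivAt
  have h2 := (h1.comp x hf.hasMFDerivAt).mfderiv
  refine (DFunLike.congr_fun h2 w).trans ?_
  change (ContinuousLinearMap.toSpanSingleton ℝ F') (deriv w f) = _
  rw [ContinuousLinearMap.toSpanSingleton_apply, smul_eq_mul, mul_comm]

theorem deriv_add_vec (w w' : A.T x) : deriv (w + w') f = deriv w f + deriv w' f :=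
  map_add (mfderiv (𝓡 A.n) 𝓘(ℝ, ℝ) f x) w w'

theorem deriv_smul_vec (c : ℝ) : deriv (c • w) f = c * deriv w f :=
  map_smul (mfderiv (𝓡 A.n) 𝓘(ℝ, ℝ) f x) c w

theorem deriv_sum_vec {ι : Type*} (t : Finset ι) (c : ι → ℝ) (w : ι → A.T x) :
    deriv (∑ i ∈ t, c i • w i) f = ∑ i ∈ t, c i * deriv (w i) f := by
  change (mfderiv (𝓡 A.n) 𝓘(ℝ, ℝ) f x) _ = _
  simp only [map_sum, map_smul]
  rfl

/-- Functions separate tangent vectors. -/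
theorem eq_of_deriv_eq {w w' : A.T x} (h : ∀ f : A.Fun, deriv w f = deriv w' f) : w = w' := by
  have hx : ∀ᶠ y in 𝓝 x, y ∈ (chartAt (EuclideanSpace ℝ (Fin A.n)) x).source :=
    (chartAt _ x).open_source.mem_nhds (mem_chart_source _ x)
  have hsm : ∀ᶠ y in 𝓝 x, ContMDiffAt (𝓡 A.n) (𝓡 A.n) ∞ (extChartAt (𝓡 A.n) x) y := by
    filter_upwards [hx] with y hy
    exact contMDiffAt_extChartAt' hy
  have hinj := (isInvertible_mfderiv_extChartAt (I := 𝓡 A.n) (x := x)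
    (mem_extChartAt_source x)).injective
  apply hinj
  refine PiLp.ext fun i => ?_
  have h2 : ∀ᶠ y in 𝓝 x, ContMDiffAt (𝓡 A.n) 𝓘(ℝ, ℝ) ∞
      (fun y => (EuclideanSpace.proj (𝕜 := ℝ) i) (extChartAt (𝓡 A.n) x y)) y := by
    filter_upwards [hsm] with y hy
    exact (EuclideanSpace.proj (𝕜 := ℝ) i).contDiff.contMDiff.contMDiffAt.comp y hy
  obtain ⟨g, hg⟩ := exists_fun_eventuallyEq h2
  have h3 : ∀ w : A.T x, deriv w g =
      EuclideanSpace.proj (𝕜 := ℝ) i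
        (mfderiv (𝓡 A.n) 𝓘(ℝ, EuclideanSpace ℝ (Fin A.n)) (extChartAt (𝓡 A.n) x) x w) := by
    intro w
    rw [deriv_congr w hg]
    have h4 := mfderiv_comp x
      ((EuclideanSpace.proj (𝕜 := ℝ) (ι := Fin A.n) i).mdifferentiableAt)
      (hsm.self_of_nhds.mdifferentiableAt (by simp))
    refine (DFunLike.congr_fun h4 w).trans ?_
    rw [ContinuousLinearMap.mfderiv_eq]
    rfl
  exact (h3 w).symm.trans ((h g).trans (h3 w'))

end deriv

/-- Vector fields differentiate smooth functions to smooth functions. -/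
theorem contMDiff_deriv (X : A.Vec) (f : A.Fun) :
    ContMDiff (𝓡 A.n) 𝓘(ℝ, ℝ) ∞ (fun x => deriv (X x) f) := by
  have h1 : ContMDiff (𝓡 A.n).tangent 𝓘(ℝ, ℝ).tangent ∞ (tangentMap (𝓡 A.n) 𝓘(ℝ, ℝ) f) :=
    f.contMDiff.contMDiff_tangentMap (by simp)
  have h2 := h1.comp X.contMDiff
  have h3 : ContMDiff 𝓘(ℝ, ℝ).tangent 𝓘(ℝ, ℝ) ∞ (fun v : TangentBundle 𝓘(ℝ, ℝ) ℝ => v.2) :=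
    contMDiff_snd_tangentBundle_modelSpace ℝ 𝓘(ℝ, ℝ)
  exact h3.comp h2

end VectorBdl
end LieAlgd

/-! ### Vector fields, sections and covector fields -/

namespace LieAlgd
namespace VectorBdl
variable {A : VectorBdl.{u}}

open VectorField in
/-- The Lie bracket of vector fields acts on functions as the commutator of derivations. -/
theorem deriv_mlieBracket (X Y : A.Vec) (f : A.Fun) (x : A.M) :
    deriv (mlieBracket (𝓡 A.n) X Y x) f =
      deriv (X x) (fun y => deriv (Y y) f) - deriv (Y x) (fun y => deriv (X y) f) := by
  set φ := extChartAt (𝓡 A.n) x with hφ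
  have hr : Set.range (𝓡 A.n) = Set.univ := (𝓡 A.n).range_eq_univ
  have htg : ∀ᶠ z in 𝓝 (φ x), z ∈ φ.target := extChartAt_target_mem_nhds x
  have hsymm : ∀ z ∈ φ.target, ContMDiffAt 𝓘(ℝ, EuclideanSpace ℝ (Fin A.n)) (𝓡 A.n) ∞ φ.symm z := by
    intro z hz
    have := contMDiffOn_extChartAt_symm (I := 𝓡 A.n) (n := ∞) x z hz
    exact this.contMDiffAt ((isOpen_extChartAt_target x).mem_nhds hz)
  have hpull : ∀ (Z : A.Vec), ∀ z, mpullbackWithin 𝓘(ℝ, EuclideanSpace ℝ (Fin A.n)) (𝓡 A.n) φ.symm Z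
      (Set.range (𝓡 A.n)) z =
      (mfderiv 𝓘(ℝ, EuclideanSpace ℝ (Fin A.n)) (𝓡 A.n) φ.symm z).inverse (Z (φ.symm z)) := by
    intro Z z
    rw [mpullbackWithin_apply, hr, mfderivWithin_univ]
  set P : A.Vec → EuclideanSpace ℝ (Fin A.n) → EuclideanSpace ℝ (Fin A.n) := fun Z z =>
    mpullbackWithin 𝓘(ℝ, EuclideanSpace ℝ (Fin A.n)) (𝓡 A.n) φ.symm Z (Set.range (𝓡 A.n)) z with hP
  have hPd : ∀ Z : A.Vec, DifferentiableAt ℝ (P Z) (φ x) := by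
    intro Z
    have h1 : MDifferentiableWithinAt (𝓡 A.n) (𝓡 A.n).tangent
        (fun y => (⟨y, Z y⟩ : TangentBundle (𝓡 A.n) A.M)) Set.univ x :=
      (Z.contMDiff.mdifferentiableAt (by simp)).mdifferentiableWithinAt
    have h2 := h1.differentiableWithinAt_mpullbackWithin_vectorField
    have h3 : ((extChartAt (𝓡 A.n) x).symm ⁻¹' Set.univ ∩ Set.range (𝓡 A.n)) = Set.univ := by
      rw [hr, Set.preimage_univ, Set.univ_inter]
    exact (h2.mono h3.symm.subset).differentiableAt Filter.univ_mem
  have hinv : ∀ z ∈ φ.target,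
      (mfderiv 𝓘(ℝ, EuclideanSpace ℝ (Fin A.n)) (𝓡 A.n) φ.symm z).IsInvertible := by
    intro z hz
    have := isInvertible_mfderivWithin_extChartAt_symm (I := 𝓡 A.n) (x := x) hz
    rwa [hr, mfderivWithin_univ] at this
  have hsm : ∀ (g : A.Fun), ∀ z ∈ φ.target, ∀ Z : A.Vec,
      fderiv ℝ (g ∘ φ.symm) z (P Z z) = deriv (Z (φ.symm z)) g := by
    intro g z hz Z
    have h1 := mfderiv_comp z (g.mdiff (φ.symm z)) ((hsymm z hz).mdifferentiableAt (by simp))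
    rw [mfderiv_eq_fderiv] at h1
    refine (DFunLike.congr_fun h1 _).trans ?_
    change mfderiv (𝓡 A.n) 𝓘(ℝ, ℝ) g (φ.symm z)
      (mfderiv 𝓘(ℝ, EuclideanSpace ℝ (Fin A.n)) (𝓡 A.n) φ.symm z (P Z z)) = _
    rw [hP]
    simp only [hpull]
    have h3 : ∀ w, (mfderiv 𝓘(ℝ, EuclideanSpace ℝ (Fin A.n)) (𝓡 A.n) φ.symm z)
        ((mfderiv 𝓘(ℝ, EuclideanSpace ℝ (Fin A.n)) (𝓡 A.n) φ.symm z).inverse w) = w := by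
      intro w
      exact DFunLike.congr_fun (hinv z hz).self_comp_inverse w
    rw [h3]
    rfl
  have hx0 : φ.symm (φ x) = x := extChartAt_to_inv x
  have hf2 : ContDiffAt ℝ ∞ (f ∘ φ.symm) (φ x) := by
    have : ContMDiffAt 𝓘(ℝ, EuclideanSpace ℝ (Fin A.n)) 𝓘(ℝ, ℝ) ∞ (f ∘ φ.symm) (φ x) :=
      f.contMDiff.contMDiffAt.comp _ (hsymm _ (mem_extChartAt_target x))
    exact this.contDiffAt
  -- In the chart the identity is the symmetry of the second derivative.
  have hmain := fderiv_apply_lieBracket (V := P X) (W := P Y) hf2 (by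
    rw [minSmoothness_of_isRCLikeNormedField]
    exact WithTop.coe_le_coe.2 (le_top : (2 : ℕ∞) ≤ ⊤)) (hPd Y) (hPd X)
  have hfun : ∀ Z : A.Vec, (fun z => fderiv ℝ (f ∘ φ.symm) z (P Z z)) =ᶠ[𝓝 (φ x)]
      ((⟨_, contMDiff_deriv Z f⟩ : A.Fun) : A.M → ℝ) ∘ φ.symm := by
    intro Z
    filter_upwards [htg] with z hz
    exact hsm f z hz Z
  have hxt : φ x ∈ φ.target := mem_extChartAt_target x
  have h1 : ∀ Z Z' : A.Vec, fderiv ℝ (fun z => fderiv ℝ (f ∘ φ.symm) z (P Z z)) (φ x) (P Z' (φ x)) =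
      deriv (Z' x) (fun y => deriv (Z y) f) := by
    intro Z Z'
    rw [(hfun Z).fderiv_eq]
    refine (hsm _ _ hxt Z').trans ?_
    rw [hx0]
    rfl
  rw [h1, h1] at hmain
  refine Eq.trans ?_ hmain
  have h4 : mlieBracket (𝓡 A.n) X Y x =
      (mfderiv (𝓡 A.n) 𝓘(ℝ, EuclideanSpace ℝ (Fin A.n)) φ x).inverse
        (lieBracket ℝ (P X) (P Y) (φ x)) := by
    rw [← mlieBracketWithin_univ, mlieBracketWithin_apply, Set.preimage_univ, Set.univ_inter]
    change (mfderiv (𝓡 A.n) 𝓘(ℝ, EuclideanSpace ℝ (Fin A.n)) φ x).inverse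
        (lieBracketWithin ℝ (P X) (P Y) (Set.range (𝓡 A.n)) (φ x)) = _
    have h5 : lieBracketWithin ℝ (P X) (P Y) (Set.range (𝓡 A.n)) (φ x) =
        lieBracket ℝ (P X) (P Y) (φ x) := by
      rw [hr, lieBracketWithin_univ]
    exact congrArg _ h5
  have h5 : ∀ᶠ y in 𝓝 x, f y = (f ∘ φ.symm) (φ y) := by
    filter_upwards [extChartAt_source_mem_nhds (I := 𝓡 A.n) x] with y hy
    exact congrArg f (φ.left_inv hy).symm
  have h6 := mfderiv_comp x (hf2.differentiableAt (by simp)).mdifferentiableAt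
    (mdifferentiableAt_extChartAt (I := 𝓡 A.n) (mem_chart_source _ x))
  rw [mfderiv_eq_fderiv] at h6
  rw [h4, deriv_congr _ h5]
  refine (DFunLike.congr_fun h6 _).trans ?_
  change fderiv ℝ (f ∘ φ.symm) (φ x) (mfderiv (𝓡 A.n) 𝓘(ℝ, EuclideanSpace ℝ (Fin A.n)) φ x
    ((mfderiv (𝓡 A.n) 𝓘(ℝ, EuclideanSpace ℝ (Fin A.n)) φ x).inverse _)) = _
  congr 1
  have h7 := (isInvertible_mfderiv_extChartAt (I := 𝓡 A.n) (x := x) (mem_extChartAt_source x))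
  exact DFunLike.congr_fun h7.self_comp_inverse _

/-- The Lie bracket of smooth vector fields, as a smooth vector field. -/
def vbracket (X Y : A.Vec) : A.Vec :=
  ⟨fun x => VectorField.mlieBracket (𝓡 A.n) X Y x, fun x => by
    have h2 : IsManifold (𝓡 A.n) (minSmoothness ℝ 2) A.M := by
      rw [minSmoothness_of_isRCLikeNormedField]
      infer_instance
    have h3 : IsManifold (𝓡 A.n) (((⊤ : ℕ∞) : WithTop ℕ∞) + 1) A.M := inferInstanceAs (IsManifold (𝓡 A.n) ∞ A.M)
    have h : minSmoothness ℝ (((⊤ : ℕ∞) : WithTop ℕ∞) + 1) ≤ ((⊤ : ℕ∞) : WithTop ℕ∞) := by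
      rw [minSmoothness_of_isRCLikeNormedField]
      exact le_rfl
    exact ContMDiffAt.mlieBracket_vectorField (n := ⊤) (X.contMDiff x) (Y.contMDiff x) h⟩

section Sections
variable {m : ℕ} {V : A.M → Type v} [∀ x, AddCommGroup (V x)] [∀ x, Module ℝ (V x)]
  [∀ x, TopologicalSpace (V x)] [TopologicalSpace (TotalSpace (EuclideanSpace ℝ (Fin m)) V)]
  [FiberBundle (EuclideanSpace ℝ (Fin m)) V] [VectorBundle ℝ (EuclideanSpace ℝ (Fin m)) V]
  [ContMDiffVectorBundle ∞ (EuclideanSpace ℝ (Fin m)) V (𝓡 A.n)]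

variable (A m V) in
/-- Smooth global sections of an arbitrary smooth vector bundle `V` of rank `m` over the base of `A`. -/
abbrev SecOf : Type (max u v) := Cₛ^∞⟮𝓡 A.n; EuclideanSpace ℝ (Fin m), V⟯

theorem sec_sum_apply {ι : Type*} (t : Finset ι) (Y : ι → SecOf A m V) (x : A.M) :
    (∑ i ∈ t, Y i) x = ∑ i ∈ t, Y i x := by
  classical
  induction t using Finset.induction_on with
  | empty => rfl
  | insert i t hi ih =>
    rw [Finset.sum_insert hi, Finset.sum_insert hi, ← ih]
    rfl

/-- The product of a function and a section. -/
def smulSec (f : A.Fun) (Y : SecOf A m V) : SecOf A m V :=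
  ⟨fun x => f x • Y x, f.contMDiff.smul_section Y.contMDiff⟩

theorem smulSec_apply (f : A.Fun) (Y : SecOf A m V) (x : A.M) : smulSec f Y x = f x • Y x := rfl

/-- The coordinates of `v` in a local frame, times a bump function, give the section. -/
theorem exists_sec_through (x₀ : A.M) (v : V x₀) : ∃ Y : SecOf A m V, Y x₀ = v := by
  classical
  set e := trivializationAt (EuclideanSpace ℝ (Fin m)) V x₀ with he
  have hx₀ : x₀ ∈ e.baseSet := FiberBundle.mem_baseSet_trivializationAt' x₀
  let b := (EuclideanSpace.basisFun (Fin m) ℝ).toBasis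
  obtain ⟨χ, -, hχ⟩ := (SmoothBumpFunction.nhds_basis_tsupport (I := 𝓡 A.n) x₀).mem_iff.1
    (e.open_baseSet.mem_nhds hx₀)
  let s : Fin m → SecOf A m V := fun i => ⟨(χ : A.M → ℝ) • e.localFrame b i,
    ContMDiffOn.smul_section_of_tsupport χ.contMDiff.contMDiffOn e.open_baseSet hχ
      (e.contMDiffOn_localFrame_baseSet ∞ b i)⟩
  refine ⟨∑ i, (e.linearEquivAt ℝ x₀ hx₀ v) i • s i, ?_⟩
  rw [sec_sum_apply]
  have h := (b.map (e.linearEquivAt ℝ x₀ hx₀).symm).sum_repr v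
  conv_rhs => rw [← h]
  refine Finset.sum_congr rfl fun i _ => ?_
  have h1 : (((χ : A.M → ℝ) • e.localFrame b i) x₀) = b.map (e.linearEquivAt ℝ x₀ hx₀).symm i := by
    simp [hx₀, Trivialization.basisAt]
  change ((e.linearEquivAt ℝ x₀ hx₀ v) i) • (((χ : A.M → ℝ) • e.localFrame b i) x₀) = _
  rw [h1]
  congr 1

variable (m) in
/-- A smooth covector field on `V`: a family of functionals on the fibres which is smooth on the total
space. -/
def IsSmoothCov (c : ∀ x, V x →ₗ[ℝ] ℝ) : Prop :=
  ContMDiff ((𝓡 A.n).prod 𝓘(ℝ, EuclideanSpace ℝ (Fin m))) 𝓘(ℝ, ℝ) ∞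
    (fun v : TotalSpace (EuclideanSpace ℝ (Fin m)) V => c v.1 v.2)

theorem IsSmoothCov.eval {c : ∀ x, V x →ₗ[ℝ] ℝ} (hc : IsSmoothCov m c) (Y : SecOf A m V) :
    ContMDiff (𝓡 A.n) 𝓘(ℝ, ℝ) ∞ (fun x => c x (Y x)) :=
  hc.comp Y.contMDiff

/-- The function `c(Y)`. -/
def IsSmoothCov.app {c : ∀ x, V x →ₗ[ℝ] ℝ} (hc : IsSmoothCov m c) (Y : SecOf A m V) : A.Fun :=
  ⟨_, hc.eval Y⟩

/-- The fibre coordinates of a trivialization, cut off by a bump function, are global smooth covector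
fields; at `x₀` they form a basis of the dual of the fibre. -/
theorem exists_covectors (x₀ : A.M) : ∃ c : Fin m → ∀ x, V x →ₗ[ℝ] ℝ, (∀ i, IsSmoothCov m (c i)) ∧
    Function.Bijective (fun (v : V x₀) i => c i x₀ v) := by
  set e := trivializationAt (EuclideanSpace ℝ (Fin m)) V x₀ with he
  have hx₀ : x₀ ∈ e.baseSet := FiberBundle.mem_baseSet_trivializationAt' x₀
  obtain ⟨χ, -, hχ⟩ := (SmoothBumpFunction.nhds_basis_tsupport (I := 𝓡 A.n) x₀).mem_iff.1
    (e.open_baseSet.mem_nhds hx₀)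
  refine ⟨fun i x => χ x • ((EuclideanSpace.proj (𝕜 := ℝ) i).toLinearMap ∘ₗ e.linearMapAt ℝ x),
    fun i => ?_, ?_⟩
  · refine contMDiff_of_tsupport fun v hv => ?_
    have hcont : Continuous (fun v : TotalSpace (EuclideanSpace ℝ (Fin m)) V => v.1) :=
      FiberBundle.continuous_proj _ V
    have hv1 : v.1 ∈ tsupport χ := by
      have h1 : tsupport (fun v : TotalSpace (EuclideanSpace ℝ (Fin m)) V => (χ v.1 •
          ((EuclideanSpace.proj (𝕜 := ℝ) i).toLinearMap ∘ₗ e.linearMapAt ℝ v.1)) v.2) ⊆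
          (fun v : TotalSpace (EuclideanSpace ℝ (Fin m)) V => v.1) ⁻¹' tsupport χ := by
        refine closure_minimal (fun w hw => subset_tsupport _ fun h0 => hw ?_)
          ((isClosed_tsupport _).preimage hcont)
        simp only [h0, zero_smul, LinearMap.zero_apply]
      exact h1 hv
    have hvb : v.1 ∈ e.baseSet := hχ hv1
    have h2 : ContMDiffAt ((𝓡 A.n).prod 𝓘(ℝ, EuclideanSpace ℝ (Fin m)))
        ((𝓡 A.n).prod 𝓘(ℝ, EuclideanSpace ℝ (Fin m))) ∞ e v :=
      e.contMDiffOn.contMDiffAt (e.open_source.mem_nhds (e.mem_source.2 hvb))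
    have h3 : ContMDiffAt ((𝓡 A.n).prod 𝓘(ℝ, EuclideanSpace ℝ (Fin m))) 𝓘(ℝ, ℝ) ∞
        (fun v => (e v).2 i) v :=
      (EuclideanSpace.proj (𝕜 := ℝ) i).contDiff.contMDiff.contMDiffAt.comp v
        (contMDiffAt_snd.comp v h2)
    have h4 : ContMDiffAt ((𝓡 A.n).prod 𝓘(ℝ, EuclideanSpace ℝ (Fin m))) 𝓘(ℝ, ℝ) ∞
        (fun v : TotalSpace (EuclideanSpace ℝ (Fin m)) V => χ v.1) v :=
      χ.contMDiff.contMDiffAt.comp v (contMDiff_proj V v)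
    refine (h4.mul h3).congr_of_eventuallyEq ?_
    filter_upwards [(e.open_baseSet.preimage hcont).mem_nhds hvb] with w hw
    change χ w.1 * (e.linearMapAt ℝ w.1 w.2) i = χ w.1 * (e w).2 i
    rw [e.coe_linearMapAt_of_mem hw]
  · have : (fun (v : V x₀) i => (χ x₀ • ((EuclideanSpace.proj (𝕜 := ℝ) i).toLinearMap ∘ₗ
        e.linearMapAt ℝ x₀)) v) = (WithLp.equiv 2 _) ∘ (e.linearEquivAt ℝ x₀ hx₀) := by
      funext v i
      change χ x₀ * (e.linearMapAt ℝ x₀ v) i = _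
      rw [χ.eq_one, one_mul, e.coe_linearMapAt_of_mem hx₀]
      rfl
    rw [this]
    exact (WithLp.equiv 2 _).bijective.comp (LinearEquiv.bijective _)

end Sections

end VectorBdl
end LieAlgd

/-! ### Frames and derivations -/

namespace LieAlgd
namespace VectorBdl
variable {A : VectorBdl.{u}}

theorem contMDiff_det {ι : Type*} [Fintype ι] [DecidableEq ι] {G : A.M → Matrix ι ι ℝ}
    (hG : ∀ i j, ContMDiff (𝓡 A.n) 𝓘(ℝ, ℝ) ∞ (fun x => G x i j)) :
    ContMDiff (𝓡 A.n) 𝓘(ℝ, ℝ) ∞ (fun x => (G x).det) := by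
  simp only [Matrix.det_apply']
  exact ContMDiff.sum fun σ _ => contMDiff_const.mul (ContMDiff.prod fun i _ => hG _ _)

/-- The solution of a linear system with smooth coefficients is smooth where it is unique. -/
theorem contMDiffAt_inv_mulVec {ι : Type*} [Fintype ι] [DecidableEq ι] {G : A.M → Matrix ι ι ℝ}
    (hG : ∀ i j, ContMDiff (𝓡 A.n) 𝓘(ℝ, ℝ) ∞ (fun x => G x i j)) {r : ι → A.M → ℝ}
    (hr : ∀ i, ContMDiff (𝓡 A.n) 𝓘(ℝ, ℝ) ∞ (r i)) {x : A.M} (hx : (G x).det ≠ 0) (i : ι) :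
    ContMDiffAt (𝓡 A.n) 𝓘(ℝ, ℝ) ∞ (fun x => ((G x)⁻¹.mulVec fun j => r j x) i) x := by
  have hadj : ∀ i j, ContMDiff (𝓡 A.n) 𝓘(ℝ, ℝ) ∞ (fun x => (G x).adjugate i j) := by
    intro i j
    simp only [Matrix.adjugate_apply]
    refine contMDiff_det fun k l => ?_
    simp only [Matrix.updateRow_apply]
    split_ifs
    · exact contMDiff_const
    · exact hG k l
  have h : (fun x => ((G x)⁻¹.mulVec fun j => r j x) i) =
      fun x => ∑ j, ((G x).det⁻¹ * (G x).adjugate i j) * r j x := by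
    funext x
    simp [Matrix.mulVec, dotProduct, Matrix.inv_def, Ring.inverse_eq_inv']
  rw [h]
  refine ContMDiffAt.sum fun j _ => (ContMDiffAt.mul ?_ (hadj i j x)).mul (hr j x)
  exact (contMDiff_det hG x).inv₀ hx

section Sections
variable {m : ℕ} {V : A.M → Type v} [∀ x, AddCommGroup (V x)] [∀ x, Module ℝ (V x)]
  [∀ x, TopologicalSpace (V x)] [TopologicalSpace (TotalSpace (EuclideanSpace ℝ (Fin m)) V)]
  [FiberBundle (EuclideanSpace ℝ (Fin m)) V] [VectorBundle ℝ (EuclideanSpace ℝ (Fin m)) V]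
  [ContMDiffVectorBundle ∞ (EuclideanSpace ℝ (Fin m)) V (𝓡 A.n)]

/-- A section with prescribed smooth values of pointwise independent covector fields, and with a
prescribed value at one point. -/
theorem exists_sec_covectors {ι : Type*} [Fintype ι] {c : ι → ∀ x, V x →ₗ[ℝ] ℝ}
    (hc : ∀ i, IsSmoothCov m (c i)) {x₀ : A.M}
    (hsurj : Function.Surjective (fun (v : V x₀) i => c i x₀ v)) (b : ι → A.Fun) {v₀ : V x₀}
    (hv : ∀ i, c i x₀ v₀ = b i x₀) :
    ∃ Y : SecOf A m V, Y x₀ = v₀ ∧ ∀ᶠ x in 𝓝 x₀, ∀ i, c i x (Y x) = b i x := by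
  classical
  obtain ⟨Y₀, hY₀⟩ := exists_sec_through (m := m) x₀ v₀
  choose w hw using fun j : ι => hsurj (Pi.single j 1)
  choose Y hY using fun j : ι => exists_sec_through (m := m) x₀ (w j)
  let G : A.M → Matrix ι ι ℝ := fun x => Matrix.of fun i j => c i x (Y j x)
  have hG : ∀ i j, ContMDiff (𝓡 A.n) 𝓘(ℝ, ℝ) ∞ (fun x => G x i j) := fun i j => (hc i).eval (Y j)
  have hG0 : G x₀ = 1 := by
    ext i j
    change c i x₀ (Y j x₀) = _
    rw [hY]
    refine (congrFun (hw j) i).trans ?_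
    rw [Pi.single_apply]
    exact Matrix.one_apply.symm
  have hdet : ∀ᶠ x in 𝓝 x₀, (G x).det ≠ 0 := by
    refine (contMDiff_det hG).continuous.continuousAt.eventually_ne ?_
    rw [hG0, Matrix.det_one]
    exact one_ne_zero
  have hr : ∀ i, ContMDiff (𝓡 A.n) 𝓘(ℝ, ℝ) ∞ (fun x => b i x - c i x (Y₀ x)) :=
    fun i => (b i).contMDiff.sub ((hc i).eval Y₀)
  choose t ht using fun j => exists_fun_eventuallyEq
    (hdet.mono fun x hx => contMDiffAt_inv_mulVec hG hr hx j)
  have hcomb : ∀ x, (Y₀ + ∑ j, smulSec (t j) (Y j)) x = Y₀ x + ∑ j, t j x • Y j x := by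
    intro x
    change Y₀ x + (∑ j, smulSec (t j) (Y j)) x = _
    rw [sec_sum_apply]
    rfl
  refine ⟨Y₀ + ∑ j, smulSec (t j) (Y j), ?_, ?_⟩
  · have h0 : ∀ j, t j x₀ = 0 := by
      intro j
      rw [(ht j).self_of_nhds]
      have : (fun j => b j x₀ - c j x₀ (Y₀ x₀)) = 0 := by
        funext i
        rw [hY₀, hv, sub_self]
        rfl
      rw [this, Matrix.mulVec_zero]
      rfl
    rw [hcomb]
    simp [h0, hY₀]
  · filter_upwards [hdet, Filter.eventually_all.2 ht] with x hx htx i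
    rw [hcomb, map_add, map_sum]
    have h1 : ∑ j, c i x (t j x • Y j x) =
        ((G x).mulVec ((G x)⁻¹.mulVec fun j => b j x - c j x (Y₀ x))) i := by
      refine Finset.sum_congr rfl fun j _ => ?_
      rw [map_smul, htx j, smul_eq_mul, mul_comm]
      rfl
    rw [h1, Matrix.mulVec_mulVec, Matrix.mul_nonsing_inv _ (Ne.isUnit hx), Matrix.one_mulVec]
    ring

/-- The fibres carry no norm, so that their finite dimension is read off from a trivialization. -/
theorem finrank_fibre (x : A.M) :
    FiniteDimensional ℝ (V x) ∧ Module.finrank ℝ (V x) = m := by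
  let e := (trivializationAt (EuclideanSpace ℝ (Fin m)) V x).linearEquivAt ℝ x
    (FiberBundle.mem_baseSet_trivializationAt' x)
  exact ⟨e.symm.finiteDimensional, by rw [e.finrank_eq, finrank_euclideanSpace, Fintype.card_fin]⟩

variable (m V) in
/-- A family of global sections of `V` together with smooth covector fields, meant to be dual bases near
the points of interest. -/
structure Frame (ι : Type*) where
  sec : ι → SecOf A m V
  coord : ι → ∀ x, V x →ₗ[ℝ] ℝ
  smooth : ∀ i, IsSmoothCov m (coord i)

namespace Frame
variable {ι : Type*} [Fintype ι] [DecidableEq ι]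

/-- Near `x` the sections form a basis, and the covector fields form the dual basis. -/
def ValidAt (S : Frame m V ι) (x : A.M) : Prop :=
  ∀ᶠ y in 𝓝 x, (∀ i j, S.coord i y (S.sec j y) = if i = j then 1 else 0) ∧
    ∀ v, v = ∑ i, S.coord i y v • S.sec i y

theorem ValidAt.eventually {S : Frame m V ι} {x : A.M} (h : S.ValidAt x) :
    ∀ᶠ y in 𝓝 x, S.ValidAt y := eventually_eventually_nhds.2 h

theorem ValidAt.dual {S : Frame m V ι} {x : A.M} (h : S.ValidAt x) (i j : ι) :
    S.coord i x (S.sec j x) = if i = j then 1 else 0 := (h.self_of_nhds).1 i j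

theorem ValidAt.expand {S : Frame m V ι} {x : A.M} (h : S.ValidAt x) (v : V x) :
    v = ∑ i, S.coord i x v • S.sec i x := (h.self_of_nhds).2 v

/-- The basis of the fibre at a point where the frame is valid. -/
def ValidAt.basis {S : Frame m V ι} {x : A.M} (h : S.ValidAt x) : Module.Basis ι ℝ (V x) :=
  Module.Basis.ofEquivFun
    { toFun := fun v i => S.coord i x v
      map_add' := fun v w => by funext i; exact map_add _ _ _
      map_smul' := fun a v => by funext i; exact map_smul _ _ _
      invFun := fun t => ∑ i, t i • S.sec i x
      left_inv := fun v => (h.expand v).symm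
      right_inv := fun t => by
        funext i
        simp [h.dual] }

/-- Smooth covector fields which form a basis at a point belong to a frame. -/
theorem exists_of_coframe {c : ι → ∀ x, V x →ₗ[ℝ] ℝ} (hc : ∀ i, IsSmoothCov m (c i)) {x₀ : A.M}
    (hbij : Function.Bijective (fun (v : V x₀) i => c i x₀ v)) :
    ∃ S : Frame m V ι, S.coord = c ∧ S.ValidAt x₀ := by
  choose w hw using fun j : ι => hbij.2 (Pi.single j 1)
  choose s hs0 hs using fun j : ι => exists_sec_covectors hc hbij.2
    (fun i => (ContMDiffMap.const (if i = j then (1 : ℝ) else 0) : A.Fun)) (v₀ := w j)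
    (fun i => (congrFun (hw j) i).trans (Pi.single_apply _ _ _))
  refine ⟨⟨s, c, hc⟩, rfl, ?_⟩
  have hcard : Fintype.card ι = m := by
    have := (finrank_fibre (m := m) (V := V) x₀).1
    let f : V x₀ →ₗ[ℝ] (ι → ℝ) := LinearMap.pi fun i => c i x₀
    rw [← (finrank_fibre (m := m) (V := V) x₀).2, (LinearEquiv.ofBijective f hbij).finrank_eq,
      Module.finrank_fintype_fun_eq_card]
  filter_upwards [Filter.eventually_all.2 hs] with y hy
  have hd : ∀ i j, c i y (s j y) = if i = j then 1 else 0 := fun i j => hy j i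
  refine ⟨hd, fun v => ?_⟩
  have hfd := (finrank_fibre (m := m) (V := V) y).1
  let f : V y →ₗ[ℝ] (ι → ℝ) := LinearMap.pi fun i => c i y
  have hsurj : Function.Surjective f := fun t => ⟨∑ j, t j • s j y, by
    funext i
    change c i y _ = _
    simp [hd]⟩
  have hinj : Function.Injective f := by
    refine (LinearMap.injective_iff_surjective_of_finrank_eq_finrank ?_).2 hsurj
    rw [(finrank_fibre (m := m) (V := V) y).2, Module.finrank_fintype_fun_eq_card, hcard]
  apply hinj
  funext i
  change c i y v = c i y _
  simp [hd]

/-- Frames valid at a given point exist: the coframe of a trivialization is completed by dual sections. -/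
theorem exists_validAt (x₀ : A.M) : ∃ S : Frame m V (Fin m), S.ValidAt x₀ := by
  obtain ⟨c, hc, hb⟩ := exists_covectors (m := m) (V := V) x₀
  obtain ⟨S, -, hS⟩ := exists_of_coframe hc hb
  exact ⟨S, hS⟩

end Frame
end Sections
end VectorBdl
end LieAlgd

namespace LieAlgd

section LinearAlgebra
variable {ι W N : Type*} [Fintype ι] [DecidableEq ι] [AddCommGroup W] [Module ℝ W]
  [AddCommGroup N] [Module ℝ N]

/-- Values of an alternating map in top degree change by the determinant of the matrix of coefficients;
`e` need not be linearly independent. -/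
theorem alternating_matrix (α : W [⋀^ι]→ₗ[ℝ] N) (h : Matrix ι ι ℝ) (e : ι → W) :
    α (fun i => ∑ j, h i j • e j) = h.det • α e := by
  rw [← sub_eq_zero, ← Module.forall_dual_apply_eq_zero_iff ℝ]
  intro φ
  rw [map_sub, map_smul, sub_eq_zero]
  let f : (ι → ℝ) [⋀^ι]→ₗ[ℝ] ℝ := (φ.compAlternatingMap α).compLinearMap (Fintype.linearCombination ℝ e)
  have h1 := congrArg (fun g : (ι → ℝ) [⋀^ι]→ₗ[ℝ] ℝ => g h) (AlternatingMap.eq_smul_basis_det (Pi.basisFun ℝ ι) f)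
  change f h = f (Pi.basisFun ℝ ι) * (Pi.basisFun ℝ ι).det h at h1
  rw [Pi.basisFun_det] at h1
  have h2 : f (Pi.basisFun ℝ ι) = φ (α e) := by
    change φ (α fun i => Fintype.linearCombination ℝ e (Pi.basisFun ℝ ι i)) = _
    simp
  rw [h2] at h1
  refine Eq.trans ?_ (h1.trans (mul_comm _ _))
  rfl

/-- The derivative of the determinant at `g` in direction `g * C` is `tr C · det g`; no invertibility of
`g` is assumed. -/
theorem sum_det_updateRow_mul (g C : Matrix ι ι ℝ) :
    ∑ i, (g.updateRow i ((g * C) i)).det = C.trace * g.det := by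
  have h : ∀ i, (g.updateRow i ((g * C) i)).det = ∑ j, (g * C) i j * g.adjugate j i := by
    intro i
    have h1 := Matrix.cramer_apply g.transpose ((g * C) i) i
    rw [Matrix.updateCol_transpose, Matrix.det_transpose] at h1
    rw [← h1, Matrix.cramer_eq_adjugate_mulVec, ← Matrix.adjugate_transpose]
    simp [Matrix.mulVec, dotProduct, mul_comm]
  calc ∑ i, (g.updateRow i ((g * C) i)).det = (g * C * g.adjugate).trace := by
        simp only [h]; rfl
    _ = C.trace * g.det := by
        rw [Matrix.trace_mul_comm, ← Matrix.mul_assoc, Matrix.adjugate_mul, Matrix.smul_mul,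
          Matrix.one_mul, Matrix.trace_smul, smul_eq_mul, mul_comm]

end LinearAlgebra

namespace VectorBdl
variable {A : VectorBdl.{u}}

theorem deriv_prod {x : A.M} (w : A.T x) {ι : Type*} [DecidableEq ι] (t : Finset ι) {f : ι → A.M → ℝ}
    (hf : ∀ i, ContMDiff (𝓡 A.n) 𝓘(ℝ, ℝ) ∞ (f i)) :
    deriv w (fun y => ∏ i ∈ t, f i y) = ∑ i ∈ t, deriv w (f i) * ∏ j ∈ t.erase i, f j x := by
  induction t using Finset.induction_on with
  | empty => simpa using deriv_const w 1
  | insert i t hi ih =>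
    simp only [Finset.prod_insert hi]
    rw [deriv_mul w (hf i) (ContMDiff.prod fun i _ => hf i), ih, Finset.sum_insert hi,
      Finset.erase_insert hi, add_comm, Finset.mul_sum]
    congr 1
    refine Finset.sum_congr rfl fun k hk => ?_
    rw [Finset.erase_insert_of_ne (by rintro rfl; exact hi hk : i ≠ k), Finset.prod_insert
      (fun h => hi (Finset.mem_of_mem_erase h))]
    ring

/-- The derivative of a determinant is the sum over the rows of the determinants with that row differentiated. -/
theorem deriv_det {x : A.M} (w : A.T x) {ι : Type*} [Fintype ι] [DecidableEq ι]
    {G : A.M → Matrix ι ι ℝ} (hG : ∀ i j, ContMDiff (𝓡 A.n) 𝓘(ℝ, ℝ) ∞ (fun x => G x i j)) :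
    deriv w (fun y => (G y).det) =
      ∑ i, ((G x).updateRow i (fun j => deriv w (fun y => G y i j))).det := by
  simp only [← Matrix.det_transpose (M := Matrix.updateRow _ _ _)]
  simp only [← Matrix.det_transpose (M := G _)]
  simp only [Matrix.det_apply', Matrix.transpose_apply]
  have hp : ∀ σ : Equiv.Perm ι, ContMDiff (𝓡 A.n) 𝓘(ℝ, ℝ) ∞ (fun y => ∏ i, G y i (σ i)) :=
    fun σ => ContMDiff.prod fun i _ => hG _ _
  rw [deriv_sum (f := fun (σ : Equiv.Perm ι) y => ((Equiv.Perm.sign σ : ℤ) : ℝ) * ∏ i, G y i (σ i)) w _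
    (fun σ => contMDiff_const.mul (hp σ)), Finset.sum_comm]
  refine Finset.sum_congr rfl fun σ _ => ?_
  rw [deriv_const_mul w _ (hp σ), deriv_prod (f := fun i y => G y i (σ i)) w _ (fun i => hG _ _),
    Finset.mul_sum]
  refine Finset.sum_congr rfl fun i _ => ?_
  congr 1
  rw [← Finset.mul_prod_erase _ _ (Finset.mem_univ i)]
  congr 1
  · simp
  · refine Finset.prod_congr rfl fun k hk => ?_
    rw [Matrix.updateRow_ne (Finset.ne_of_mem_erase hk)]

section Sections
variable {m : ℕ} {V : A.M → Type v} [∀ x, AddCommGroup (V x)] [∀ x, Module ℝ (V x)]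
  [∀ x, TopologicalSpace (V x)] [TopologicalSpace (TotalSpace (EuclideanSpace ℝ (Fin m)) V)]
  [FiberBundle (EuclideanSpace ℝ (Fin m)) V] [VectorBundle ℝ (EuclideanSpace ℝ (Fin m)) V]
  [ContMDiffVectorBundle ∞ (EuclideanSpace ℝ (Fin m)) V (𝓡 A.n)]

variable (m V) in
/-- A derivation of the module of sections of `V`, over a vector field on the base. -/
structure Der where
  X : A.Vec
  D : SecOf A m V → SecOf A m V
  add : ∀ Y Z, D (Y + Z) = D Y + D Z
  leibniz : ∀ f Y x, D (smulSec f Y) x = f x • D Y x + deriv (X x) f • Y x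

namespace Der
variable (δ : Der m V)

theorem sum {ι : Type*} (t : Finset ι) (Y : ι → SecOf A m V) :
    δ.D (∑ i ∈ t, Y i) = ∑ i ∈ t, δ.D (Y i) :=
  map_sum (AddMonoidHom.mk' δ.D δ.add) Y t

/-- A derivation is a local operator. -/
theorem congr {Y Z : SecOf A m V} {x : A.M} (h : ∀ᶠ y in 𝓝 x, Y y = Z y) : δ.D Y x = δ.D Z x := by
  obtain ⟨χ, hχ1, hχ⟩ := exists_bump h
  have h1 : ∀ Y : SecOf A m V, δ.D (smulSec χ Y) x = δ.D Y x := by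
    intro Y
    rw [δ.leibniz, hχ1.self_of_nhds, one_smul, deriv_congr (g := fun _ => 1) _ hχ1, deriv_const,
      zero_smul, add_zero]
  rw [← h1 Y, ← h1 Z]
  congr 2
  ext y
  rw [smulSec_apply, smulSec_apply]
  by_cases hy : y ∈ tsupport χ
  · rw [show Y y = Z y from hχ hy]
  · rw [image_eq_zero_of_notMem_tsupport hy, zero_smul, zero_smul]

variable {ι : Type*} [Fintype ι] [DecidableEq ι]

/-- The matrix of a derivation in a frame. -/
def matrix (S : Frame m V ι) (x : A.M) : Matrix ι ι ℝ :=
  Matrix.of fun i j => S.coord j x (δ.D (S.sec i) x)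

/-- The coefficients of a tuple of sections in a frame. -/
def _root_.LieAlgd.VectorBdl.Frame.coeff (S : Frame m V ι) {κ : Type*} (Y : κ → SecOf A m V) (x : A.M) :
    Matrix κ ι ℝ := Matrix.of fun i j => S.coord j x (Y i x)

theorem _root_.LieAlgd.VectorBdl.Frame.coeff_smooth (S : Frame m V ι) {κ : Type*} (Y : κ → SecOf A m V) (i j) :
    ContMDiff (𝓡 A.n) 𝓘(ℝ, ℝ) ∞ (fun x => S.coeff Y x i j) := (S.smooth j).eval (Y i)

/-- A derivation in a frame: the matrix of coefficients is multiplied by the matrix of the derivation and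
differentiated entrywise. -/
theorem apply_eq {S : Frame m V ι} {x : A.M} (h : S.ValidAt x) {κ : Type*} [Fintype κ]
    (Y : κ → SecOf A m V) (i : κ) :
    δ.D (Y i) x = ∑ k, ((S.coeff Y x * δ.matrix S x) i k +
      deriv (δ.X x) (fun y => S.coeff Y y i k)) • S.sec k x := by
  have h1 : ∀ᶠ y in 𝓝 x, Y i y = (∑ j, smulSec ((S.smooth j).app (Y i)) (S.sec j)) y := by
    filter_upwards [h] with y hy
    rw [sec_sum_apply]
    exact hy.2 (Y i y)
  rw [δ.congr h1, δ.sum, sec_sum_apply]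
  simp only [δ.leibniz, add_smul, Finset.sum_add_distrib]
  congr 1
  have h2 : ∀ j, (S.smooth j).app (Y i) x • δ.D (S.sec j) x =
      ∑ k, (S.coeff Y x i j * δ.matrix S x j k) • S.sec k x := by
    intro j
    conv_lhs => rw [h.expand (δ.D (S.sec j) x)]
    rw [Finset.smul_sum]
    exact Finset.sum_congr rfl fun k _ => smul_smul _ _ _
  simp only [h2]
  rw [Finset.sum_comm]
  refine Finset.sum_congr rfl fun k _ => ?_
  rw [← Finset.sum_smul]
  rfl

/-- The Lie derivative of a top-degree product in terms of a frame. -/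
theorem sum_update {S : Frame m V ι} {x : A.M} (h : S.ValidAt x) (Y : ι → SecOf A m V)
    {N : Type*} [AddCommGroup N] [Module ℝ N] (α : V x [⋀^ι]→ₗ[ℝ] N) :
    ∑ i, α (Function.update (fun j => Y j x) i (δ.D (Y i) x)) =
      (deriv (δ.X x) (fun y => (S.coeff Y y).det) + (δ.matrix S x).trace * (S.coeff Y x).det) •
        α (fun i => S.sec i x) := by
  have h1 : ∀ i, α (Function.update (fun j => Y j x) i (δ.D (Y i) x)) =
      ((S.coeff Y x).updateRow i (fun k => (S.coeff Y x * δ.matrix S x) i k +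
        deriv (δ.X x) (fun y => S.coeff Y y i k))).det • α (fun i => S.sec i x) := by
    intro i
    rw [← alternating_matrix]
    congr 1
    funext j
    by_cases hj : j = i
    · subst hj
      simp only [Function.update_self, Matrix.updateRow_self]
      exact δ.apply_eq h Y j
    · rw [Function.update_of_ne hj]
      simp only [Matrix.updateRow_ne hj]
      exact h.expand (Y j x)
  have h2 : ∀ i, ((S.coeff Y x).updateRow i (fun k => (S.coeff Y x * δ.matrix S x) i k +
        deriv (δ.X x) (fun y => S.coeff Y y i k))).det =
      ((S.coeff Y x).updateRow i ((S.coeff Y x * δ.matrix S x) i)).det +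
      ((S.coeff Y x).updateRow i (fun k => deriv (δ.X x) (fun y => S.coeff Y y i k))).det :=
    fun i => Matrix.det_updateRow_add _ _ _ _
  simp only [h1, h2]
  rw [← Finset.sum_smul, Finset.sum_add_distrib, sum_det_updateRow_mul,
    ← deriv_det (δ.X x) (S.coeff_smooth Y), add_comm]

end Der
end Sections
end VectorBdl
end LieAlgd

/-! ### Densities and the divergence of a derivation -/

namespace LieAlgd
namespace VectorBdl
variable {A : VectorBdl.{u}}
section Sections
variable {m : ℕ} {V : A.M → Type v} [∀ x, AddCommGroup (V x)] [∀ x, Module ℝ (V x)]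
  [∀ x, TopologicalSpace (V x)] [TopologicalSpace (TotalSpace (EuclideanSpace ℝ (Fin m)) V)]
  [FiberBundle (EuclideanSpace ℝ (Fin m)) V] [VectorBundle ℝ (EuclideanSpace ℝ (Fin m)) V]
  [ContMDiffVectorBundle ∞ (EuclideanSpace ℝ (Fin m)) V (𝓡 A.n)]

namespace Frame
/-- The determinant of the coordinates in a frame, as a top-degree form on the fibres. -/
def vol {ι : Type*} [Fintype ι] [DecidableEq ι] (S : Frame m V ι) (x : A.M) : V x [⋀^ι]→ₗ[ℝ] ℝ :=
  Matrix.detRowAlternating.compLinearMap (LinearMap.pi fun i => S.coord i x)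

variable {ι : Type*} [Fintype ι] [DecidableEq ι]

theorem vol_apply (S : Frame m V ι) (x : A.M) (Y : ι → SecOf A m V) :
    S.vol x (fun i => Y i x) = (S.coeff Y x).det := rfl

theorem vol_smooth (S : Frame m V ι) (Y : ι → SecOf A m V) :
    ContMDiff (𝓡 A.n) 𝓘(ℝ, ℝ) ∞ (fun x => S.vol x (fun i => Y i x)) :=
  contMDiff_det (S.coeff_smooth Y)

theorem ValidAt.coeff_self {S : Frame m V ι} {x : A.M} (h : S.ValidAt x) : S.coeff S.sec x = 1 := by
  ext i j
  refine (h.dual j i).trans ?_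
  rw [Matrix.one_apply]
  simp only [eq_comm]

theorem ValidAt.vol_self {S : Frame m V ι} {x : A.M} (h : S.ValidAt x) :
    S.vol x (fun i => S.sec i x) = 1 := by
  rw [vol_apply, h.coeff_self, Matrix.det_one]

/-- A top-degree form is determined by its value on a frame. -/
theorem ValidAt.eq_smul_vol {S : Frame m V ι} {x : A.M} (h : S.ValidAt x) {N : Type*}
    [AddCommGroup N] [Module ℝ N] (α : V x [⋀^ι]→ₗ[ℝ] N) (v : ι → V x) :
    α v = S.vol x v • α (fun i => S.sec i x) := by
  refine Eq.trans ?_ (alternating_matrix α (Matrix.of fun i j => S.coord j x (v i)) _)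
  congr 1
  funext i
  exact h.expand (v i)

end Frame

variable (m V) in
/-- A smooth positive density on `V`, given by top-degree forms on the fibres, each determined up to
sign; only their squares are required to depend smoothly on the point. -/
structure Dens where
  form : ∀ x, V x [⋀^Fin m]→ₗ[ℝ] ℝ
  ne : ∀ x, form x ≠ 0
  smooth : ∀ Y : Fin m → SecOf A m V,
    ContMDiff (𝓡 A.n) 𝓘(ℝ, ℝ) ∞ (fun x => form x (fun i => Y i x) ^ 2)

namespace Dens

variable (m V) in
/-- Densities exist on every bundle, orientable or not: a partition of unity combines the squares of local
volume forms to a quadratic function `q`, and the form `√q · vol` at each point is chosen without regard to sign. -/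
theorem nonempty : Nonempty (Dens m V) := by
  classical
  have := A.sigmaCompact
  choose S hS using Frame.exists_validAt (m := m) (V := V)
  choose U hU hUo hxU using fun x => eventually_nhds_iff.1 (hS x).eventually
  obtain ⟨ρ, hρ⟩ := SmoothPartitionOfUnity.exists_isSubordinate (𝓡 A.n) isClosed_univ U hUo
    (fun x _ => Set.mem_iUnion.2 ⟨x, hxU x⟩)
  let a : A.M → A.M → ℝ := fun i x => (S i).vol x (fun j => (S x).sec j x)
  let q : A.M → ℝ := fun x => ∑ᶠ i, ρ i x • (a i x) ^ 2
  have hq : ∀ x, q x = ∑ i ∈ ρ.finsupport x, ρ i x • (a i x) ^ 2 := by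
    intro x
    exact (ρ.sum_finsupport_smul_eq_finsum x (fun i x => (a i x) ^ 2)).symm
  have hpos : ∀ x, 0 < q x := by
    intro x
    rw [hq]
    obtain ⟨i, hi⟩ := ρ.exists_pos_of_mem (Set.mem_univ x)
    refine Finset.sum_pos' (fun j _ => mul_nonneg (ρ.nonneg j x) (sq_nonneg _))
      ⟨i, (ρ.mem_finsupport x).2 hi.ne', mul_pos hi (pow_pos ?_ 2 |>.trans_le (sq_abs _).le)⟩
    have hx : x ∈ U i := hρ i (subset_tsupport _ hi.ne')
    have h1 := (hU i x hx).eq_smul_vol ((S x).vol x) (fun j => (S x).sec j x)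
    rw [(hS x).vol_self] at h1
    refine abs_pos.2 fun h0 => ?_
    change (S i).vol x (fun j => (S x).sec j x) = 0 at h0
    rw [h0, zero_smul] at h1
    exact one_ne_zero h1
  refine ⟨⟨fun x => Real.sqrt (q x) • (S x).vol x, fun x h0 => ?_, fun Y => ?_⟩⟩
  · have h1 := DFunLike.congr_fun h0 (fun j => (S x).sec j x)
    rw [AlternatingMap.smul_apply, (hS x).vol_self] at h1
    simp only [smul_eq_mul, mul_one, AlternatingMap.zero_apply] at h1
    exact (Real.sqrt_pos.2 (hpos x)).ne' h1
  -- The frame `S x` may vary discontinuously with `x`, but the square is `∑ ρ i * ((S i).vol)^2`, without `S x`.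
  · have h1 : (fun x => (Real.sqrt (q x) • (S x).vol x) (fun i => Y i x) ^ 2) =
        fun x => ∑ᶠ i, ρ i x • ((S i).vol x (fun j => Y j x)) ^ 2 := by
      funext x
      rw [AlternatingMap.smul_apply, smul_eq_mul, mul_pow, Real.sq_sqrt (hpos x).le, hq,
        ← ρ.sum_finsupport_smul_eq_finsum x (fun i x => ((S i).vol x (fun j => Y j x)) ^ 2),
        Finset.sum_mul]
      refine Finset.sum_congr rfl fun i _ => ?_
      rw [(hS x).eq_smul_vol ((S i).vol x) (fun j => Y j x)]
      simp only [smul_eq_mul, a]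
      ring
    rw [h1]
    exact ρ.contMDiff_finsum_smul fun i x _ => ((S i).vol_smooth Y x).pow 2

variable (ν : Dens m V)

theorem sec_ne {S : Frame m V (Fin m)} {x : A.M} (h : S.ValidAt x) :
    ν.form x (fun i => S.sec i x) ≠ 0 := fun h0 => ν.ne x <| by
  ext v
  rw [h.eq_smul_vol (ν.form x) v, h0, smul_zero]
  rfl

theorem ne_of_form_ne {x : A.M} {Y : Fin m → SecOf A m V} (h : ν.form x (fun i => Y i x) ≠ 0) :
    ∀ᶠ y in 𝓝 x, ν.form y (fun i => Y i y) ≠ 0 := by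
  have h1 := (ν.smooth Y).continuous.continuousAt.eventually_ne (pow_ne_zero 2 h)
  filter_upwards [h1] with y hy h0
  exact hy (by rw [h0, zero_pow two_ne_zero])

/-- The logarithm of a density is smooth; note that `Real.log` is `log |·|`. -/
theorem log_smooth {x : A.M} {Y : Fin m → SecOf A m V} (h : ν.form x (fun i => Y i x) ≠ 0) :
    ContMDiffAt (𝓡 A.n) 𝓘(ℝ, ℝ) ∞ (fun y => Real.log (ν.form y (fun i => Y i y))) x := by
  have h1 : (fun y => Real.log (ν.form y (fun i => Y i y))) =
      fun y => (1 / 2 : ℝ) * Real.log (ν.form y (fun i => Y i y) ^ 2) := by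
    funext y
    rw [Real.log_pow]
    push_cast
    ring
  rw [h1]
  exact contMDiffAt_const.mul
    ((Real.contDiffAt_log.2 (pow_ne_zero 2 h)).contMDiffAt.comp x (ν.smooth Y x))

/-- The divergence-like function of a derivation with respect to a density, computed in a frame: the
Lie derivative of the density is the product of this function and the density. -/
def lamIn (δ : Der m V) (S : Frame m V (Fin m)) (x : A.M) : ℝ :=
  deriv (δ.X x) (fun y => Real.log (ν.form y (fun i => S.sec i y))) - (δ.matrix S x).trace

theorem sum_update_lamIn (δ : Der m V) {S : Frame m V (Fin m)} {x : A.M} (h : S.ValidAt x)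
    {Y : Fin m → SecOf A m V} (hY : ν.form x (fun i => Y i x) ≠ 0)
    {N : Type*} [AddCommGroup N] [Module ℝ N] (α : V x [⋀^Fin m]→ₗ[ℝ] N) :
    ∑ i, α (Function.update (fun j => Y j x) i (δ.D (Y i) x)) =
      (deriv (δ.X x) (fun y => Real.log (ν.form y (fun i => Y i y))) - ν.lamIn δ S x) •
        α (fun i => Y i x) := by
  rw [δ.sum_update h, h.eq_smul_vol α (fun i => Y i x), smul_smul, S.vol_apply]
  congr 1
  have hdet : ∀ᶠ y in 𝓝 x, (S.coeff Y y).det ≠ 0 ∧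
      Real.log (ν.form y (fun i => Y i y)) =
      Real.log (S.coeff Y y).det + Real.log (ν.form y (fun i => S.sec i y)) := by
    filter_upwards [h.eventually, ν.ne_of_form_ne hY] with y hy hYy
    have h1 := hy.eq_smul_vol (ν.form y) (fun i => Y i y)
    rw [S.vol_apply, smul_eq_mul] at h1
    have h2 : (S.coeff Y y).det ≠ 0 := fun h0 => hYy (by rw [h1, h0, zero_mul])
    exact ⟨h2, by rw [h1, Real.log_mul h2 (ν.sec_ne hy)]⟩
  have hd := hdet.self_of_nhds.1
  have hdm : MDifferentiableAt (𝓡 A.n) 𝓘(ℝ, ℝ) (fun y => (S.coeff Y y).det) x :=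
    mdiff_of_contMDiffAt (contMDiff_det (S.coeff_smooth Y) x)
  rw [deriv_congr _ (hdet.mono fun y hy => hy.2), deriv_add_at, deriv_comp_real _ hdm
    (Real.hasDerivAt_log hd), lamIn]
  · field_simp
    ring
  · exact mdiff_of_contMDiffAt ((Real.contDiffAt_log.2 hd).contMDiffAt.comp x
      (contMDiff_det (S.coeff_smooth Y) x))
  · exact mdiff_of_contMDiffAt (ν.log_smooth (ν.sec_ne h))

/-- The expression for the divergence does not depend on the frame. -/
theorem lamIn_eq (δ : Der m V) {S S' : Frame m V (Fin m)} {x : A.M} (h : S.ValidAt x)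
    (h' : S'.ValidAt x) : ν.lamIn δ S x = ν.lamIn δ S' x := by
  have h1 := ν.sum_update_lamIn δ h (ν.sec_ne h') (S'.vol x)
  rw [δ.sum_update h', deriv_congr (g := fun _ => 1) _ (h'.eventually.mono fun y hy => by
    rw [hy.coeff_self, Matrix.det_one]), deriv_const, h'.coeff_self, Matrix.det_one,
    h'.vol_self] at h1
  simp only [smul_eq_mul, mul_one, zero_add] at h1
  rw [lamIn, lamIn, h1, lamIn]
  ring

/-- The function by which the Lie derivative along a derivation multiplies a density. -/
def lam (δ : Der m V) (x : A.M) : ℝ :=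
  ν.lamIn δ (Frame.exists_validAt (m := m) (V := V) x).choose x

theorem lam_eq (δ : Der m V) {S : Frame m V (Fin m)} {x : A.M} (h : S.ValidAt x) :
    ν.lam δ x = deriv (δ.X x) (fun y => Real.log (ν.form y (fun i => S.sec i y))) -
      (δ.matrix S x).trace :=
  ν.lamIn_eq δ (Frame.exists_validAt (m := m) (V := V) x).choose_spec h

/-- The action of a derivation on a top-degree product, in terms of a density instead of a frame. The
forms `ν.form y` need not be continuous in `y`, but the logarithm of `|ν.form y (Y y)|` is smooth. -/
theorem sum_update (δ : Der m V) {x : A.M} {Y : Fin m → SecOf A m V}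
    (hY : ν.form x (fun i => Y i x) ≠ 0) {N : Type*} [AddCommGroup N] [Module ℝ N]
    (α : V x [⋀^Fin m]→ₗ[ℝ] N) :
    ∑ i, α (Function.update (fun j => Y j x) i (δ.D (Y i) x)) =
      (deriv (δ.X x) (fun y => Real.log (ν.form y (fun i => Y i y))) - ν.lam δ x) •
        α (fun i => Y i x) :=
  ν.sum_update_lamIn δ (Frame.exists_validAt (m := m) (V := V) x).choose_spec hY α

/-- Near a point, `lam` is given by a frame and a smooth function `u`, the logarithm of the density. -/
theorem lam_eventually_eq {S : Frame m V (Fin m)} {x : A.M} (h : S.ValidAt x) :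
    ∃ u : A.Fun, ∀ δ : Der m V, ∀ᶠ y in 𝓝 x, ν.lam δ y = deriv (δ.X y) u - (δ.matrix S y).trace := by
  obtain ⟨u, hu⟩ := exists_fun_eventuallyEq (h.eventually.mono fun y hy => ν.log_smooth (ν.sec_ne hy))
  refine ⟨u, fun δ => ?_⟩
  filter_upwards [h.eventually, eventually_eventually_nhds.2 hu] with y hy huy
  rw [ν.lam_eq δ hy, deriv_congr _ huy]

theorem trace_smooth (δ : Der m V) (S : Frame m V (Fin m)) :
    ContMDiff (𝓡 A.n) 𝓘(ℝ, ℝ) ∞ (fun x => (δ.matrix S x).trace) :=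
  ContMDiff.sum fun i _ => (S.smooth i).eval (δ.D (S.sec i))

theorem lam_smooth (δ : Der m V) : ContMDiff (𝓡 A.n) 𝓘(ℝ, ℝ) ∞ (ν.lam δ) := by
  intro x
  obtain ⟨S, hS⟩ := Frame.exists_validAt (m := m) (V := V) x
  obtain ⟨u, hu⟩ := ν.lam_eventually_eq hS
  exact ((contMDiff_deriv δ.X u x).sub (trace_smooth δ S x)).congr_of_eventuallyEq (hu δ)

theorem lam_add {δ₁ δ₂ δ₃ : Der m V} {x : A.M} (hX : δ₃.X x = δ₁.X x + δ₂.X x)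
    (hD : ∀ Y, δ₃.D Y x = δ₁.D Y x + δ₂.D Y x) : ν.lam δ₃ x = ν.lam δ₁ x + ν.lam δ₂ x := by
  obtain ⟨S, hS⟩ := Frame.exists_validAt (m := m) (V := V) x
  simp only [ν.lam_eq _ hS, hX, deriv_add_vec, Matrix.trace, Matrix.diag, Der.matrix,
    Matrix.of_apply, hD, map_add, Finset.sum_add_distrib]
  ring

/-- The divergence of a derivation `f δ - ξ ⊗ b`, the shape of the bracket with a multiple of a section. -/
theorem lam_smul {δ δ' : Der m V} {x : A.M} (f : ℝ) (ξ : V x →ₗ[ℝ] ℝ) (b : V x)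
    (hX : δ'.X x = f • δ.X x) (hD : ∀ Y, δ'.D Y x = f • δ.D Y x - ξ (Y x) • b) :
    ν.lam δ' x = f * ν.lam δ x + ξ b := by
  obtain ⟨S, hS⟩ := Frame.exists_validAt (m := m) (V := V) x
  have h1 : ξ b = ∑ i, ξ (S.sec i x) * S.coord i x b := by
    conv_lhs => rw [hS.expand b]
    rw [map_sum]
    refine Finset.sum_congr rfl fun i _ => ?_
    rw [map_smul, smul_eq_mul, mul_comm]
  simp only [ν.lam_eq _ hS, hX, deriv_smul_vec, Matrix.trace, Matrix.diag, Der.matrix,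
    Matrix.of_apply, hD, map_sub, map_smul, Finset.sum_sub_distrib, smul_eq_mul, h1,
    ← Finset.mul_sum]
  ring

/-- `lam` is a cocycle for a flat family of derivations. -/
theorem lam_flat {δ₁ δ₂ δ₃ : Der m V}
    (hX : ∀ x (f : A.Fun), deriv (δ₃.X x) f =
      deriv (δ₁.X x) (fun y => deriv (δ₂.X y) f) - deriv (δ₂.X x) (fun y => deriv (δ₁.X y) f))
    (hD : ∀ Y, δ₃.D Y = δ₁.D (δ₂.D Y) - δ₂.D (δ₁.D Y)) (x : A.M) :
    ν.lam δ₃ x = deriv (δ₁.X x) (ν.lam δ₂) - deriv (δ₂.X x) (ν.lam δ₁) := by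
  obtain ⟨S, hS⟩ := Frame.exists_validAt (m := m) (V := V) x
  obtain ⟨u, hu⟩ := ν.lam_eventually_eq hS
  have hd : ∀ δ δ' : Der m V, deriv (δ.X x) (ν.lam δ') =
      deriv (δ.X x) (fun y => deriv (δ'.X y) u) -
        ∑ i, deriv (δ.X x) (fun y => δ'.matrix S y i i) := by
    intro δ δ'
    rw [deriv_congr _ (hu δ'), deriv_sub_at _ (mdiff_of_contMDiffAt (contMDiff_deriv δ'.X u x))
      (mdiff_of_contMDiffAt (trace_smooth δ' S x))]
    congr 1
    exact deriv_sum _ _ fun i => (S.smooth i).eval (δ'.D (S.sec i))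
  have hDD : ∀ δ δ' : Der m V, ∑ i, S.coord i x (δ.D (δ'.D (S.sec i)) x) =
      (δ'.matrix S x * δ.matrix S x).trace +
        ∑ i, deriv (δ.X x) (fun y => δ'.matrix S y i i) := by
    intro δ δ'
    have h1 : ∀ i, S.coord i x (δ.D (δ'.D (S.sec i)) x) =
        (δ'.matrix S x * δ.matrix S x) i i + deriv (δ.X x) (fun y => δ'.matrix S y i i) := by
      intro i
      rw [δ.apply_eq hS (fun j => δ'.D (S.sec j)) i]
      simp only [map_sum, map_smul, hS.dual, smul_eq_mul, mul_ite, mul_one, mul_zero,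
        Finset.sum_ite_eq, Finset.mem_univ, if_true]
      rfl
    simp only [h1, Finset.sum_add_distrib]
    rfl
  have h3 : (δ₃.matrix S x).trace = ∑ i, S.coord i x (δ₁.D (δ₂.D (S.sec i)) x) -
      ∑ i, S.coord i x (δ₂.D (δ₁.D (S.sec i)) x) := by
    rw [← Finset.sum_sub_distrib]
    refine Finset.sum_congr rfl fun i _ => ?_
    change S.coord i x (δ₃.D (S.sec i) x) = _
    rw [hD, ← map_sub]
    rfl
  rw [(hu δ₃).self_of_nhds, hX, hd, hd, h3, hDD, hDD, Matrix.trace_mul_comm]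
  ring

end Dens
end Sections
end VectorBdl
end LieAlgd

/-! ### 1-forms and the modular cocycle -/

namespace LieAlgd

namespace LieAlgebroid
open VectorBdl
variable {A : LieAlgebroid.{u}}

/-- A 1-form is given by its values on sections: a smooth-valued function of a section which is linear
over the smooth functions. -/
theorem exists_form_one (Θ : A.Sec → A.M → ℝ) (hadd : ∀ a b x, Θ (a + b) x = Θ a x + Θ b x)
    (hsmul : ∀ f a x, Θ (fsmul f a) x = f x * Θ a x)
    (hs : ∀ a, ContMDiff (𝓡 A.n) 𝓘(ℝ, ℝ) ∞ (Θ a)) :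
    ∃ α : A.Form 1, ∀ a x, lin α x (a x) = Θ a x := by
  have hsum : ∀ x {ι : Type} (t : Finset ι) (a : ι → A.Sec), Θ (∑ i ∈ t, a i) x = ∑ i ∈ t, Θ (a i) x :=
    fun x ι t a => map_sum (AddMonoidHom.mk' (fun a => Θ a x) (fun a b => hadd a b x)) a t
  have h0 : ∀ a x, a x = 0 → Θ a x = 0 := by
    intro a x hax
    obtain ⟨S, hS⟩ := Frame.exists_validAt (m := A.r) (V := A.E) x
    obtain ⟨χ, hχ1, hχ⟩ := exists_bump hS
    have h1 : fsmul χ a = ∑ j, fsmul (χ * (S.smooth j).app a) (S.sec j) := by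
      ext y
      refine Eq.trans ?_ (sec_sum_apply _ _ _).symm
      change χ y • a y = ∑ j, (χ y * S.coord j y (a y)) • S.sec j y
      by_cases hy : y ∈ tsupport χ
      · conv_lhs => rw [(hχ hy).2 (a y)]
        rw [Finset.smul_sum]
        exact Finset.sum_congr rfl fun i _ => smul_smul _ _ _
      · simp [image_eq_zero_of_notMem_tsupport hy]
    have h2 : Θ (fsmul χ a) x = Θ a x := by rw [hsmul, hχ1.self_of_nhds, one_mul]
    rw [← h2, h1, hsum]
    refine Finset.sum_eq_zero fun j _ => ?_
    rw [hsmul]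
    change (χ x * S.coord j x (a x)) * _ = 0
    rw [hax, map_zero, mul_zero, zero_mul]
  have hneg : ∀ a x, Θ (-a) x = - Θ a x := fun a x =>
    map_neg (AddMonoidHom.mk' (fun a => Θ a x) (fun a b => hadd a b x)) a
  have heq : ∀ a b x, a x = b x → Θ a x = Θ b x := by
    intro a b x h
    have h1 := h0 (a + -b) x (by
      change a x + - b x = 0
      rw [h, add_neg_cancel])
    rw [hadd, hneg] at h1
    linarith
  choose s hs' using fun (x : A.M) (v : A.E x) => exists_sec (A := A.toVectorBdl) x v
  let l : ∀ x, A.E x →ₗ[ℝ] ℝ := fun x =>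
    { toFun := fun v => Θ (s x v) x
      map_add' := fun v w => by
        rw [← hadd]
        refine heq _ _ _ ?_
        change _ = s x v x + s x w x
        simp only [hs']
      map_smul' := fun c v => by
        have h1 := hsmul ⟨fun _ => c, contMDiff_const⟩ (s x v) x
        refine Eq.trans (heq _ _ _ ?_) h1
        change _ = c • s x v x
        simp only [hs'] }
  have hl : ∀ a x, l x (a x) = Θ a x := fun a x => heq _ _ _ (hs' _ _)
  refine ⟨⟨fun x => AlternatingMap.ofSubsingleton ℝ (A.E x) ℝ (0 : Fin 1) (l x), fun a => ?_⟩, hl⟩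
  refine (hs (a 0)).congr fun x => ?_
  exact hl (a 0) x

/-- The anchor of a section, as a vector field. -/
def anchorVec (a : A.Sec) : A.Vec :=
  ⟨fun x => A.anchor x (a x), A.anchor_smooth.comp a.contMDiff⟩

/-- The anchor of a bracket acts on functions as the commutator. -/
theorem deriv_anchor_bracket (a b : A.Sec) (f : A.Fun) (x : A.M) :
    VectorBdl.deriv (A.anchor x (A.bracket a b x)) f =
      VectorBdl.deriv (A.anchor x (a x)) (fun y => VectorBdl.deriv (A.anchor y (b y)) f) -
      VectorBdl.deriv (A.anchor x (b x)) (fun y => VectorBdl.deriv (A.anchor y (a y)) f) := by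
  rw [A.anchor_bracket]
  exact deriv_mlieBracket (anchorVec a) (anchorVec b) f x

theorem lin_smooth (α : A.Form 1) (a : A.Sec) :
    ContMDiff (𝓡 A.n) 𝓘(ℝ, ℝ) ∞ (fun x => lin α x (a x)) := α.2 (fun _ => a)

theorem form_one_ext {α β : A.Form 1} (h : ∀ x v, lin α x v = lin β x v) : α = β := by
  refine Subtype.ext ?_
  funext x
  refine AlternatingMap.ext fun v => ?_
  rw [lin_apply, lin_apply, h]

/-- A 1-form is closed if and only if it satisfies the usual identity on pairs of sections. -/
theorem mem_Z1_iff (α : A.Form 1) : α ∈ A.Z1 ↔ ∀ (a b : A.Sec) x,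
    lin α x (A.bracket a b x) = VectorBdl.deriv (A.anchor x (a x)) (fun y => lin α y (b y)) -
      VectorBdl.deriv (A.anchor x (b x)) (fun y => lin α y (a y)) := by
  rw [Z1, LinearMap.mem_ker]
  constructor
  · intro h a b x
    have h1 := congrFun (congrFun h ![a, b]) x
    rw [d_one_apply] at h1
    change VectorBdl.deriv (A.anchor x (a x)) (fun y => lin α y (b y)) -
      VectorBdl.deriv (A.anchor x (b x)) (fun y => lin α y (a y)) - lin α x (A.bracket a b x) = 0 at h1
    linarith
  · intro h
    funext a x
    rw [d_one_apply, h (a 0) (a 1) x]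
    exact sub_self _

/-- The differential of a function. -/
def exact (g : A.Fun) : A.Form 1 :=
  ⟨fun x => AlternatingMap.ofSubsingleton ℝ (A.E x) ℝ (0 : Fin 1)
    ((mfderiv (𝓡 A.n) 𝓘(ℝ, ℝ) g x).toLinearMap.comp (A.anchor x)),
    fun a => contMDiff_deriv (anchorVec (a 0)) g⟩

theorem lin_exact (g : A.Fun) (x : A.M) (v : A.E x) :
    lin (exact g) x v = VectorBdl.deriv (A.anchor x v) g := rfl

theorem exact_mem_Z1 (g : A.Fun) : exact g ∈ A.Z1 :=
  (mem_Z1_iff _).2 fun a b x => deriv_anchor_bracket a b g x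

theorem mem_B1_iff (α : A.Form 1) : α ∈ A.B1 ↔ ∃ g : A.Fun, α = exact g := by
  constructor
  · rintro ⟨f, hf⟩
    refine ⟨⟨fun x => f.1 x ![], by simpa [Matrix.empty_eq] using f.smooth ![]⟩,
      form_one_ext fun x v => ?_⟩
    obtain ⟨a, rfl⟩ := exists_sec (A := A.toVectorBdl) x v
    have h1 := congrFun (congrFun hf (fun _ => a)) x
    rw [d_zero_apply] at h1
    exact h1.symm
  · rintro ⟨g, rfl⟩
    let f : A.Form 0 := ⟨fun x => AlternatingMap.constOfIsEmpty ℝ (A.E x) (Fin 0) (g x),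
      fun a => g.contMDiff⟩
    refine ⟨f, ?_⟩
    funext a x
    exact d_zero_apply f a x

/-- Closed 1-forms have the same class if and only if they differ by the differential of a function. -/
theorem mk_eq_iff (α β : A.Z1) :
    (Submodule.Quotient.mk α : A.H1) = Submodule.Quotient.mk β ↔
      ∃ g : A.Fun, ∀ x v, lin α.1 x v = lin β.1 x v + VectorBdl.deriv (A.anchor x v) g := by
  rw [Submodule.Quotient.eq]
  change α.1 - β.1 ∈ A.B1 ↔ _
  rw [mem_B1_iff]
  refine exists_congr fun g => ⟨fun h x v => ?_, fun h => form_one_ext fun x v => ?_⟩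
  · rw [← lin_exact, ← h]
    change _ = lin β.1 x v + (lin α.1 x v - lin β.1 x v)
    ring
  · rw [lin_exact]
    change lin α.1 x v - lin β.1 x v = _
    rw [h]
    ring

/-- The adjoint action of a section on sections. -/
def ad (a : A.Sec) : Der (A := A.toVectorBdl) A.r A.E where
  X := anchorVec a
  D := A.bracket a
  add := map_add _
  leibniz f Y x := A.leibniz a Y f x

end LieAlgebroid

namespace VectorBdl
variable {A : VectorBdl.{u}}

/-- The Lie derivative along a vector field, as a derivation of the module of vector fields. -/
def lie (X : A.Vec) : Der (A := A) A.n A.T where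
  X := X
  D := vbracket X
  add Y Z := by
    ext x
    refine eq_of_deriv_eq fun f => ?_
    refine (deriv_mlieBracket X (Y + Z) f x).trans ?_
    change _ = deriv (vbracket X Y x + vbracket X Z x) f
    rw [deriv_add_vec]
    erw [deriv_mlieBracket X Y f x, deriv_mlieBracket X Z f x]
    have h1 : (fun y => deriv ((Y + Z) y) f) = fun y => deriv (Y y) f + deriv (Z y) f := by
      funext y
      exact deriv_add_vec _ _
    rw [h1, deriv_add _ (contMDiff_deriv Y f) (contMDiff_deriv Z f)]
    erw [deriv_add_vec]
    ring
  leibniz g Y x := by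
    refine eq_of_deriv_eq fun f => ?_
    refine (deriv_mlieBracket X (smulSec g Y) f x).trans ?_
    rw [deriv_add_vec, deriv_smul_vec, deriv_smul_vec]
    erw [deriv_mlieBracket X Y f x]
    have h1 : (fun y => deriv (smulSec g Y y) f) = fun y => g y * deriv (Y y) f := by
      funext y
      exact deriv_smul_vec _ _
    rw [h1, deriv_mul _ g.contMDiff (contMDiff_deriv Y f), smulSec_apply]
    erw [deriv_smul_vec]
    ring

theorem deriv_lie (X Y : A.Vec) (f : A.Fun) (x : A.M) : deriv ((lie X).D Y x) f =
      deriv (X x) (fun y => deriv (Y y) f) - deriv (Y x) (fun y => deriv (X y) f) :=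
  deriv_mlieBracket X Y f x

end VectorBdl

namespace LieAlgebroid
open VectorBdl
variable {A : LieAlgebroid.{u}} (ν : Dens (A := A.toVectorBdl) A.r A.E)
  (τ : Dens (A := A.toVectorBdl) A.n A.T)

theorem bracket_fsmul_left (f : A.Fun) (a b : A.Sec) (x : A.M) :
    A.bracket (fsmul f a) b x = f x • A.bracket a b x - VectorBdl.deriv (A.anchor x (b x)) f • a x := by
  rw [bracket_symm (fsmul f a) b, bracket_symm a b]
  change - A.bracket b (fsmul f a) x = f x • (- A.bracket b a x) - _
  rw [A.leibniz, smul_neg]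
  abel

/-- The modular cocycle defined by densities on the bundle and on the base. -/
theorem exists_modForm : ∃ θ : A.Z1, ∀ (a : A.Sec) x,
    lin θ.1 x (a x) = τ.lam (lie (anchorVec a)) x - ν.lam (ad a) x := by
  suffices h : ∃ θ : A.Form 1, ∀ a x,
      lin θ x (a x) = τ.lam (lie (anchorVec a)) x - ν.lam (ad a) x by
    obtain ⟨θ, hθ⟩ := h
    refine ⟨⟨θ, (mem_Z1_iff _).2 fun a b x => ?_⟩, hθ⟩
    have h1 := ν.lam_flat (δ₁ := ad a) (δ₂ := ad b) (δ₃ := ad (A.bracket a b))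
      (fun x f => deriv_anchor_bracket a b f x) (fun Y => eq_sub_of_add_eq (A.jacobi a b Y).symm) x
    have h2 := τ.lam_flat (δ₁ := lie (anchorVec a)) (δ₂ := lie (anchorVec b))
      (δ₃ := lie (anchorVec (A.bracket a b)))
      (fun x f => deriv_anchor_bracket a b f x) (fun Y => by
        ext x
        refine eq_of_deriv_eq fun f => ?_
        change _ = VectorBdl.deriv ((lie (anchorVec a)).D ((lie (anchorVec b)).D Y) x -
          (lie (anchorVec b)).D ((lie (anchorVec a)).D Y) x) f
        rw [sub_eq_add_neg, ← neg_one_smul ℝ, deriv_add_vec, deriv_smul_vec]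
        have hc : ∀ X Z : A.Vec, ContMDiff (𝓡 A.n) 𝓘(ℝ, ℝ) ∞
            (fun y => VectorBdl.deriv (X y) (fun z => VectorBdl.deriv (Z z) f)) :=
          fun X Z => contMDiff_deriv X ⟨_, contMDiff_deriv Z f⟩
        have key : ∀ X Z : A.Vec, ∀ W : A.Vec, VectorBdl.deriv (W x)
            (fun y => VectorBdl.deriv ((lie X).D Z y) f) =
            VectorBdl.deriv (W x) (fun y => VectorBdl.deriv (X y) (fun z => VectorBdl.deriv (Z z) f)) -
            VectorBdl.deriv (W x)
              (fun y => VectorBdl.deriv (Z y) (fun z => VectorBdl.deriv (X z) f)) := by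
          intro X Z W
          simp only [deriv_lie]
          exact deriv_sub_at _ (mdiff_of_contMDiffAt (hc X Z x)) (mdiff_of_contMDiffAt (hc Z X x))
        have hab : ∀ y (F : A.Fun), VectorBdl.deriv (anchorVec (A.bracket a b) y) F =
            VectorBdl.deriv (anchorVec a y) (fun z => VectorBdl.deriv (anchorVec b z) F) -
            VectorBdl.deriv (anchorVec b y) (fun z => VectorBdl.deriv (anchorVec a z) F) :=
          fun y F => deriv_anchor_bracket a b F y
        have k2 := hab x ⟨_, contMDiff_deriv Y f⟩
        have k3 : VectorBdl.deriv (Y x) (fun y => VectorBdl.deriv (anchorVec (A.bracket a b) y) f) =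
            VectorBdl.deriv (Y x) (fun y => VectorBdl.deriv (anchorVec a y)
              (fun z => VectorBdl.deriv (anchorVec b z) f)) -
            VectorBdl.deriv (Y x) (fun y => VectorBdl.deriv (anchorVec b y)
              (fun z => VectorBdl.deriv (anchorVec a z) f)) := by
          simp only [hab]
          exact deriv_sub_at _ (mdiff_of_contMDiffAt (hc _ _ x)) (mdiff_of_contMDiffAt (hc _ _ x))
        have k4 := deriv_lie (anchorVec b) Y ⟨_, contMDiff_deriv (anchorVec a) f⟩ x
        have k5 := deriv_lie (anchorVec a) Y ⟨_, contMDiff_deriv (anchorVec b) f⟩ x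
        rw [deriv_lie, deriv_lie, deriv_lie, key, key, k3]
        erw [k2, k4, k5]
        simp only [ContMDiffMap.coeFn_mk]
        ring) x
    rw [hθ, h1, h2]
    simp only [hθ]
    rw [deriv_sub_at _ (mdiff_of_contMDiffAt (τ.lam_smooth _ x)) (mdiff_of_contMDiffAt (ν.lam_smooth _ x)),
      deriv_sub_at _ (mdiff_of_contMDiffAt (τ.lam_smooth _ x)) (mdiff_of_contMDiffAt (ν.lam_smooth _ x))]
    exact sub_sub_sub_comm _ _ _ _
  refine exists_form_one _ (fun a b x => ?_) (fun f a x => ?_)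
    (fun a => (τ.lam_smooth _).sub (ν.lam_smooth _))
  · have e : ∀ x, anchorVec (a + b) x = anchorVec a x + anchorVec b x :=
      fun x => map_add (A.anchor x) (a x) (b x)
    have h1 : ν.lam (ad (a + b)) x = ν.lam (ad a) x + ν.lam (ad b) x :=
      ν.lam_add (e x) fun Y => by
        change A.bracket (a + b) Y x = _
        rw [map_add]
        rfl
    have h2 : τ.lam (lie (anchorVec (a + b))) x =
        τ.lam (lie (anchorVec a)) x + τ.lam (lie (anchorVec b)) x := by
      refine τ.lam_add (e x) fun Y => eq_of_deriv_eq fun f => ?_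
      rw [deriv_add_vec]
      simp only [deriv_lie, e, deriv_add_vec]
      rw [deriv_add _ (contMDiff_deriv (anchorVec a) f) (contMDiff_deriv (anchorVec b) f)]
      ring
    rw [h1, h2]
    ring
  · have e : ∀ x, anchorVec (fsmul f a) x = f x • anchorVec a x :=
      fun x => map_smul (A.anchor x) (f x) (a x)
    rw [ν.lam_smul (δ := ad a) (f x) ((mfderiv (𝓡 A.n) 𝓘(ℝ, ℝ) f x).toLinearMap.comp (A.anchor x)) (a x)
      (e x) (fun Y => bracket_fsmul_left f a Y x),
      τ.lam_smul (δ := lie (anchorVec a)) (f x) (mfderiv (𝓡 A.n) 𝓘(ℝ, ℝ) f x).toLinearMap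
        (anchorVec a x) (e x) (fun Y => ?_)]
    · change _ + VectorBdl.deriv (A.anchor x (a x)) f - (_ + VectorBdl.deriv (A.anchor x (a x)) f) = _
      ring
    · refine eq_of_deriv_eq fun g => ?_
      change _ = VectorBdl.deriv (f x • (lie (anchorVec a)).D Y x -
        VectorBdl.deriv (Y x) f • anchorVec a x) g
      rw [sub_eq_add_neg, ← neg_smul, deriv_add_vec, deriv_smul_vec, deriv_smul_vec]
      simp only [deriv_lie, e, deriv_smul_vec]
      rw [deriv_mul _ f.contMDiff (contMDiff_deriv (anchorVec a) g)]
      ring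

end LieAlgebroid
end LieAlgd

/-! ### Existence and uniqueness of the modular class -/

namespace LieAlgd
namespace LieAlgebroid
open VectorBdl
variable {A : LieAlgebroid.{u}}

theorem tmul_ne_zero {V W : Type*} [AddCommGroup V] [Module ℝ V] [AddCommGroup W] [Module ℝ W]
    {v : V} {w : W} (hv : v ≠ 0) (hw : w ≠ 0) : v ⊗ₜ[ℝ] w ≠ (0 : V ⊗[ℝ] W) := by
  intro h
  obtain ⟨f, hf⟩ : ∃ f : Module.Dual ℝ V, f v ≠ 0 := by
    by_contra! h
    exact hv ((Module.forall_dual_apply_eq_zero_iff ℝ v).1 h)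
  obtain ⟨g, hg⟩ : ∃ g : Module.Dual ℝ W, g w ≠ 0 := by
    by_contra! h
    exact hw ((Module.forall_dual_apply_eq_zero_iff ℝ w).1 h)
  have h1 := congrArg (TensorProduct.lift ((LinearMap.mul ℝ ℝ).compl₁₂ f g)) h
  rw [map_zero] at h1
  exact mul_ne_zero hf hg h1

theorem smul_tmul_add {V W : Type*} [AddCommGroup V] [Module ℝ V] [AddCommGroup W] [Module ℝ W]
    (c c' : ℝ) (v : V) (w : W) :
    (c • v) ⊗ₜ[ℝ] w + v ⊗ₜ[ℝ] (c' • w) = (c + c') • (v ⊗ₜ[ℝ] w) := by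
  rw [← TensorProduct.smul_tmul', TensorProduct.tmul_smul, add_smul]

variable (ν : Dens (A := A.toVectorBdl) A.r A.E)
  (τ : Dens (A := A.toVectorBdl) A.n A.T)

theorem _root_.LieAlgd.VectorBdl.Dens.exists_vec_ne {B : VectorBdl.{u}} {m : ℕ} {V : B.M → Type v}
    [∀ x, AddCommGroup (V x)] [∀ x, Module ℝ (V x)]
    [∀ x, TopologicalSpace (V x)] [TopologicalSpace (TotalSpace (EuclideanSpace ℝ (Fin m)) V)]
    [FiberBundle (EuclideanSpace ℝ (Fin m)) V] [VectorBundle ℝ (EuclideanSpace ℝ (Fin m)) V]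
    [ContMDiffVectorBundle ∞ (EuclideanSpace ℝ (Fin m)) V (𝓡 B.n)] (τ : Dens m V) (x : B.M) :
    ∃ w, τ.form x w ≠ 0 := by
  by_contra! h
  exact τ.ne x (AlternatingMap.ext h)

/-- The quotient of a top-degree form on the base by a density. -/
def ratio (x : A.M) : (A.T x [⋀^Fin A.n]→ₗ[ℝ] ℝ) →ₗ[ℝ] ℝ where
  toFun μ := μ (τ.exists_vec_ne x).choose / τ.form x (τ.exists_vec_ne x).choose
  map_add' _ _ := add_div _ _ _
  map_smul' c _ := mul_div_assoc c _ _

theorem ratio_eq {x : A.M} (μ : A.T x [⋀^Fin A.n]→ₗ[ℝ] ℝ) {w : Fin A.n → A.T x}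
    (hw : τ.form x w ≠ 0) : ratio τ x μ = μ w / τ.form x w := by
  obtain ⟨S, hS⟩ := Frame.exists_validAt (m := A.n) (V := A.T) x
  have h1 : ∀ v, μ v * τ.form x (fun i => S.sec i x) = τ.form x v * μ (fun i => S.sec i x) := by
    intro v
    rw [hS.eq_smul_vol μ v, hS.eq_smul_vol (τ.form x) v]
    simp only [smul_eq_mul]
    ring
  have h2 := (τ.exists_vec_ne x).choose_spec
  change μ (τ.exists_vec_ne x).choose / τ.form x (τ.exists_vec_ne x).choose = _
  rw [div_eq_div_iff h2 hw]
  have h3 := τ.sec_ne hS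
  refine mul_right_cancel₀ h3 ?_
  have e1 := h1 w
  have e2 := h1 (τ.exists_vec_ne x).choose
  linear_combination (τ.form x w) * e2 - (τ.form x (τ.exists_vec_ne x).choose) * e1

/-- The trivialization of the fibres of `L^A` given by densities; it is determined up to sign. -/
def ell (x : A.M) : A.L x →ₗ[ℝ] ℝ :=
  TensorProduct.lift ((LinearMap.mul ℝ ℝ).compl₁₂
    (exteriorPower.alternatingMapLinearEquiv (ν.form x)) (ratio τ x))

theorem ell_tmul (x : A.M) (e : Fin A.r → A.Sec) (μ : A.T x [⋀^Fin A.n]→ₗ[ℝ] ℝ) :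
    ell ν τ x (wedge e x ⊗ₜ[ℝ] μ) = ν.form x (fun i => e i x) * ratio τ x μ := by
  rw [ell, TensorProduct.lift.tmul, LinearMap.compl₁₂_apply, wedge,
    exteriorPower.alternatingMapLinearEquiv_apply_ιMulti]
  rfl

variable {S : Frame (A := A.toVectorBdl) A.r A.E (Fin A.r)}
  {Z : Frame (A := A.toVectorBdl) A.n A.T (Fin A.n)} {x : A.M}

theorem ratio_vol (hZ : Z.ValidAt x) : ratio τ x (Z.vol x) = (τ.form x (fun i => Z.sec i x))⁻¹ := by
  rw [ratio_eq τ _ (τ.sec_ne hZ), hZ.vol_self, one_div]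

theorem ell_frame_ne (hS : S.ValidAt x) (hZ : Z.ValidAt x) :
    ell ν τ x (wedge S.sec x ⊗ₜ[ℝ] Z.vol x) ≠ 0 := by
  rw [ell_tmul, ratio_vol τ hZ]
  exact mul_ne_zero (ν.sec_ne hS) (inv_ne_zero (τ.sec_ne hZ))

theorem exists_smul_wedge (hS : S.ValidAt x) (w : ⋀[ℝ]^A.r (A.E x)) :
    ∃ c : ℝ, w = c • wedge S.sec x := by
  have h : LinearMap.id = (exteriorPower.alternatingMapLinearEquiv (S.vol x)).smulRight
      (wedge S.sec x) := by
    refine exteriorPower.linearMap_ext (AlternatingMap.ext fun e => ?_)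
    refine (hS.eq_smul_vol (exteriorPower.ιMulti ℝ A.r) e).trans ?_
    change _ = exteriorPower.alternatingMapLinearEquiv (S.vol x) (exteriorPower.ιMulti ℝ A.r e) •
      wedge S.sec x
    rw [exteriorPower.alternatingMapLinearEquiv_apply_ιMulti]
    rfl
  exact ⟨_, DFunLike.congr_fun h w⟩

/-- The fibres of `L^A` are lines. -/
theorem eq_smul_frame (hS : S.ValidAt x) (hZ : Z.ValidAt x) (t : A.L x) :
    t = (ell ν τ x t / ell ν τ x (wedge S.sec x ⊗ₜ[ℝ] Z.vol x)) • (wedge S.sec x ⊗ₜ[ℝ] Z.vol x) := by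
  set t₀ : A.L x := wedge S.sec x ⊗ₜ[ℝ] Z.vol x with ht₀
  have h0 : ell ν τ x t₀ ≠ 0 := ell_frame_ne ν τ hS hZ
  obtain ⟨c, hc⟩ : ∃ c : ℝ, t = c • t₀ := by
    induction t using TensorProduct.induction_on with
    | zero => exact ⟨0, (zero_smul _ _).symm⟩
    | add t t' ht ht' =>
      obtain ⟨c, rfl⟩ := ht
      obtain ⟨c', rfl⟩ := ht'
      exact ⟨c + c', (add_smul _ _ _).symm⟩
    | tmul w μ =>
      obtain ⟨c, hc⟩ := exists_smul_wedge hS w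
      have h2 : μ = μ (fun i => Z.sec i x) • Z.vol x := by
        refine AlternatingMap.ext fun v => ?_
        rw [hZ.eq_smul_vol μ v, AlternatingMap.smul_apply, smul_eq_mul, smul_eq_mul, mul_comm]
      exact ⟨c * μ (fun i => Z.sec i x), by
        conv_lhs => rw [hc, h2]
        exact TensorProduct.smul_tmul_smul _ _ _ _⟩
  have h1 : ell ν τ x t = c * ell ν τ x t₀ := by
    rw [hc, map_smul, smul_eq_mul]
  rw [h1, mul_div_cancel_right₀ _ h0, ← hc]

theorem ell_injective (x : A.M) : Function.Injective (ell ν τ x) := by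
  obtain ⟨S, hS⟩ := Frame.exists_validAt (m := A.r) (V := A.E) x
  obtain ⟨Z, hZ⟩ := Frame.exists_validAt (m := A.n) (V := A.T) x
  intro t t' h
  rw [eq_smul_frame ν τ hS hZ t, eq_smul_frame ν τ hS hZ t', h]

theorem ell_surjective (x : A.M) : Function.Surjective (ell ν τ x) := by
  obtain ⟨S, hS⟩ := Frame.exists_validAt (m := A.r) (V := A.E) x
  obtain ⟨Z, hZ⟩ := Frame.exists_validAt (m := A.n) (V := A.T) x
  exact LinearMap.surjective fun h => ell_frame_ne ν τ hS hZ (by rw [h]; rfl)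

theorem ell_ne {e : Fin A.r → A.Sec} {μ : A.VolForm} (h : wedge e x ⊗ₜ[ℝ] μ.1 x ≠ (0 : A.L x)) :
    ν.form x (fun i => e i x) ≠ 0 ∧ ratio τ x (μ.1 x) ≠ 0 := by
  have h1 : ell ν τ x (wedge e x ⊗ₜ[ℝ] μ.1 x) ≠ 0 := fun h0 =>
    h (ell_injective ν τ x (by rw [h0, map_zero]))
  rw [ell_tmul] at h1
  exact ⟨left_ne_zero_of_mul h1, right_ne_zero_of_mul h1⟩

/-- Where the ratio of a top-degree form and a density does not vanish, its logarithm is smooth, and it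
can be computed in any frame. -/
theorem log_ratio_smooth {μ : A.VolForm} (h : ratio τ x (μ.1 x) ≠ 0) :
    ContMDiffAt (𝓡 A.n) 𝓘(ℝ, ℝ) ∞ (fun y => Real.log (ratio τ y (μ.1 y))) x ∧
    ∀ (Z : Frame (A := A.toVectorBdl) A.n A.T (Fin A.n)), Z.ValidAt x →
      μ.1 x (fun i => Z.sec i x) ≠ 0 ∧
      (∀ᶠ y in 𝓝 x, Real.log (ratio τ y (μ.1 y)) =
        Real.log (μ.1 y (fun i => Z.sec i y)) - Real.log (τ.form y (fun i => Z.sec i y))) := by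
  have key : ∀ (Z : Frame (A := A.toVectorBdl) A.n A.T (Fin A.n)), Z.ValidAt x →
      μ.1 x (fun i => Z.sec i x) ≠ 0 ∧
      (∀ᶠ y in 𝓝 x, Real.log (ratio τ y (μ.1 y)) =
        Real.log (μ.1 y (fun i => Z.sec i y)) - Real.log (τ.form y (fun i => Z.sec i y))) := by
    intro Z hZ
    have h1 : μ.1 x (fun i => Z.sec i x) ≠ 0 := by
      rw [ratio_eq τ _ (τ.sec_ne hZ)] at h
      exact fun h0 => h (by rw [h0, zero_div])
    refine ⟨h1, ?_⟩
    filter_upwards [hZ.eventually, (μ.2 Z.sec).continuous.continuousAt.eventually_ne h1] with y hy hμ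
    rw [ratio_eq τ _ (τ.sec_ne hy), Real.log_div hμ (τ.sec_ne hy)]
  refine ⟨?_, key⟩
  obtain ⟨Z, hZ⟩ := Frame.exists_validAt (m := A.n) (V := A.T) x
  obtain ⟨h1, h2⟩ := key Z hZ
  refine ContMDiffAt.congr_of_eventuallyEq ?_ h2
  exact ((Real.contDiffAt_log.2 h1).contMDiffAt.comp x (μ.2 Z.sec x)).sub (τ.log_smooth (τ.sec_ne hZ))

/-- The Lie derivative of a top-degree form along `ρ(a)`, in terms of the divergence of a density. -/
theorem lieVol_eq {μ : A.VolForm} (h : ratio τ x (μ.1 x) ≠ 0) (a : A.Sec) (X : Fin A.n → A.Vec) :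
    lieVol a μ X x = (τ.lam (lie (anchorVec a)) x +
      VectorBdl.deriv (A.anchor x (a x)) (fun y => Real.log (ratio τ y (μ.1 y)))) *
        μ.1 x (fun i => X i x) := by
  obtain ⟨Z, hZ⟩ := Frame.exists_validAt (m := A.n) (V := A.T) x
  obtain ⟨h1, h2⟩ := (log_ratio_smooth τ h).2 Z hZ
  have hμ := μ.2 Z.sec
  have hd : ∀ᶠ y in 𝓝 x, μ.1 y (fun i => X i y) =
      (Z.coeff X y).det * μ.1 y (fun i => Z.sec i y) := by
    filter_upwards [hZ.eventually] with y hy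
    exact hy.eq_smul_vol (μ.1 y) (fun i => X i y)
  have hs := (lie (anchorVec a)).sum_update hZ X (μ.1 x)
  change ∑ j, μ.1 x (Function.update (fun i => X i x) j
      (VectorField.mlieBracket (𝓡 A.n) (fun y => A.anchor y (a y)) (fun y => X j y) x)) = _ at hs
  rw [lieVol, hs, deriv_congr _ hd, VectorBdl.deriv_mul _ (contMDiff_det (Z.coeff_smooth X)) hμ,
    deriv_congr _ h2, deriv_sub_at (f := fun y => Real.log (μ.1 y (fun i => Z.sec i y))) _
      (mdiff_of_contMDiffAt ((Real.contDiffAt_log.2 h1).contMDiffAt.comp x (hμ x)))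
      (mdiff_of_contMDiffAt (τ.log_smooth (τ.sec_ne hZ))),
    deriv_comp_real _ (mdiff_of_contMDiffAt (hμ x)) (Real.hasDerivAt_log h1), hd.self_of_nhds,
    τ.lam_eq _ hZ]
  change _ - (VectorBdl.deriv (A.anchor x (a x)) _ + _) • _ =
    (VectorBdl.deriv (A.anchor x (a x)) _ - _ + _) * _
  simp only [smul_eq_mul]
  field_simp
  ring

/-- The action of `[a, ·]` on the top exterior power of `A`, in terms of the divergence of a density. -/
theorem bracketWedge_eq {e : Fin A.r → A.Sec} (h : ν.form x (fun i => e i x) ≠ 0) (a : A.Sec) :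
    bracketWedge a e x = (VectorBdl.deriv (A.anchor x (a x))
      (fun y => Real.log (ν.form y (fun i => e i y))) - ν.lam (ad a) x) • wedge e x := by
  refine Eq.trans ?_ (ν.sum_update (ad a) h (exteriorPower.ιMulti ℝ A.r))
  refine Finset.sum_congr rfl fun i _ => ?_
  change exteriorPower.ιMulti ℝ A.r _ = _
  congr 1
  funext j
  by_cases hj : j = i
  · subst hj
    simp only [Function.update_self]
    rfl
  · rw [Function.update_of_ne hj, Function.update_of_ne hj]

/-- The logarithm of the norm of `(e_1 ∧ … ∧ e_r) ⊗ μ` with respect to densities. -/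
def logNorm (e : Fin A.r → A.Sec) (μ : A.VolForm) (y : A.M) : ℝ :=
  Real.log (ν.form y (fun i => e i y)) + Real.log (ratio τ y (μ.1 y))

variable {ν τ} in
/-- The canonical representation in terms of densities: the modular cocycle, corrected by the logarithmic
derivative of the norm. -/
theorem repL_eq {θ : A.Z1} (hθ : ∀ (a : A.Sec) x,
      lin θ.1 x (a x) = τ.lam (lie (anchorVec a)) x - ν.lam (ad a) x)
    {e : Fin A.r → A.Sec} {μ : A.VolForm} (h : wedge e x ⊗ₜ[ℝ] μ.1 x ≠ (0 : A.L x)) (a : A.Sec)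
    (X : Fin A.n → A.Vec) : repL a e μ X x =
      (lin θ.1 x (a x) + VectorBdl.deriv (A.anchor x (a x)) (logNorm ν τ e μ)) •
        (μ.1 x (fun i => X i x) • wedge e x) := by
  obtain ⟨h1, h2⟩ := ell_ne ν τ h
  rw [repL, bracketWedge_eq ν h1, lieVol_eq τ h2, hθ, smul_smul, smul_smul, ← add_smul]
  congr 1
  have h3 : VectorBdl.deriv (A.anchor x (a x)) (logNorm ν τ e μ) = _ :=
    deriv_add_at _ (mdiff_of_contMDiffAt (ν.log_smooth h1))
      (mdiff_of_contMDiffAt (log_ratio_smooth τ h2).1)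
  rw [h3]
  ring

theorem logNorm_smooth {e : Fin A.r → A.Sec} {μ : A.VolForm}
    (h : wedge e x ⊗ₜ[ℝ] μ.1 x ≠ (0 : A.L x)) :
    ContMDiffAt (𝓡 A.n) 𝓘(ℝ, ℝ) ∞ (logNorm ν τ e μ) x := by
  obtain ⟨h1, h2⟩ := ell_ne ν τ h
  exact (ν.log_smooth h1).add (log_ratio_smooth τ h2).1

theorem logNorm_eq {e : Fin A.r → A.Sec} {μ : A.VolForm}
    (h : wedge e x ⊗ₜ[ℝ] μ.1 x ≠ (0 : A.L x)) :
    logNorm ν τ e μ x = Real.log (ell ν τ x (wedge e x ⊗ₜ[ℝ] μ.1 x)) := by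
  obtain ⟨h1, h2⟩ := ell_ne ν τ h
  rw [ell_tmul, Real.log_mul h1 h2, logNorm]

theorem exists_vec_fields_ne {μ : A.VolForm} (h : μ.1 x ≠ 0) :
    ∃ X : Fin A.n → A.Vec, μ.1 x (fun i => X i x) ≠ 0 := by
  obtain ⟨Z, hZ⟩ := Frame.exists_validAt (m := A.n) (V := A.T) x
  refine ⟨Z.sec, fun h0 => h (AlternatingMap.ext fun v => ?_)⟩
  rw [hZ.eq_smul_vol (μ.1 x) v, h0, smul_zero]
  rfl

variable {ν τ}

/-- The characteristic cocycles of a section of `L^A` represent the class of the modular cocycle. -/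
theorem charCocycle_iff {θ : A.Z1} (hθ : ∀ (a : A.Sec) x,
      lin θ.1 x (a x) = τ.lam (lie (anchorVec a)) x - ν.lam (ad a) x)
    {s : ∀ x, A.L x} (hs : IsSmoothL s) (hs0 : ∀ x, s x ≠ 0) :
    ∃ g : A.Fun, ∀ θ' : A.Form 1, IsCharCocycle s θ' ↔
      ∀ x v, lin θ' x v = lin θ.1 x v + VectorBdl.deriv (A.anchor x v) g := by
  have hne : ∀ {x e μ}, EqNearL s e μ x → wedge e x ⊗ₜ[ℝ] μ.1 x ≠ (0 : A.L x) :=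
    fun h => by rw [← h.self_of_nhds]; exact hs0 _
  have hg : ∀ {x e μ}, EqNearL s e μ x →
      ∀ᶠ y in 𝓝 x, Real.log (ell ν τ y (s y)) = logNorm ν τ e μ y := by
    intro x e μ h
    filter_upwards [h] with y hy
    rw [logNorm_eq ν τ (by rw [← hy]; exact hs0 y), hy]
  let g : A.Fun := ⟨fun x => Real.log (ell ν τ x (s x)), fun x => by
    obtain ⟨e, μ, h⟩ := hs x
    exact (logNorm_smooth ν τ (hne h)).congr_of_eventuallyEq (hg h)⟩
  refine ⟨g, fun θ' => ⟨fun h x v => ?_, fun h x e μ hx a X => ?_⟩⟩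
  · obtain ⟨e, μ, hx⟩ := hs x
    obtain ⟨a, rfl⟩ := exists_sec (A := A.toVectorBdl) x v
    have h0 := hne hx
    obtain ⟨X, hX⟩ := exists_vec_fields_ne (μ := μ) (x := x) fun h => h0 (by
      rw [h, TensorProduct.tmul_zero])
    have h1 := h x e μ hx a X
    rw [repL_eq hθ h0, mul_smul, ← deriv_congr (A.anchor x (a x)) (hg hx)] at h1
    refine smul_left_injective ℝ (smul_ne_zero hX fun h => h0 (by
      rw [h, TensorProduct.zero_tmul])) h1
  · rw [repL_eq hθ (hne hx), mul_smul, ← deriv_congr (A.anchor x (a x)) (hg hx)]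
    exact congrArg (· • _) (h x (a x))

/-- The characteristic cocycles of a section of the square of `L^A` represent twice the class of the
modular cocycle. -/
theorem charCocycleSq_iff {θ : A.Z1} (hθ : ∀ (a : A.Sec) x,
      lin θ.1 x (a x) = τ.lam (lie (anchorVec a)) x - ν.lam (ad a) x)
    {s : ∀ x, A.L x ⊗[ℝ] A.L x} (hs : IsSmoothLL s) (hs0 : ∀ x, s x ≠ 0) :
    ∃ g : A.Fun, ∀ θ' : A.Form 1, IsCharCocycleSq s θ' ↔
      ∀ x v, lin θ' x v = lin ((2 : ℝ) • θ).1 x v + VectorBdl.deriv (A.anchor x v) g := by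
  have hne : ∀ {x e μ e₂ μ₂}, EqNearLL s e μ e₂ μ₂ x →
      wedge e x ⊗ₜ[ℝ] μ.1 x ≠ (0 : A.L x) ∧ wedge e₂ x ⊗ₜ[ℝ] μ₂.1 x ≠ (0 : A.L x) := by
    intro x e μ e₂ μ₂ h
    have h1 := hs0 x
    rw [h.self_of_nhds] at h1
    exact ⟨fun h0 => h1 (by rw [h0, TensorProduct.zero_tmul]),
      fun h0 => h1 (by rw [h0, TensorProduct.tmul_zero])⟩
  let ll : ∀ x, A.L x ⊗[ℝ] A.L x →ₗ[ℝ] ℝ := fun x =>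
    TensorProduct.lift ((LinearMap.mul ℝ ℝ).compl₁₂ (ell ν τ x) (ell ν τ x))
  have hg : ∀ {x e μ e₂ μ₂}, EqNearLL s e μ e₂ μ₂ x → ∀ᶠ y in 𝓝 x,
      Real.log (ll y (s y)) = logNorm ν τ e μ y + logNorm ν τ e₂ μ₂ y := by
    intro x e μ e₂ μ₂ h
    filter_upwards [eventually_eventually_nhds.2 h] with y hy
    obtain ⟨h1, h2⟩ := hne hy
    rw [logNorm_eq ν τ h1, logNorm_eq ν τ h2, hy.self_of_nhds, ← Real.log_mul]
    · rfl
    · exact fun h0 => h1 (ell_injective ν τ y (by rw [h0, map_zero]))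
    · exact fun h0 => h2 (ell_injective ν τ y (by rw [h0, map_zero]))
  let g : A.Fun := ⟨fun x => Real.log (ll x (s x)), fun x => by
    obtain ⟨e, μ, e₂, μ₂, h⟩ := hs x
    exact ((logNorm_smooth ν τ (hne h).1).add (logNorm_smooth ν τ (hne h).2)).congr_of_eventuallyEq
      (hg h)⟩
  have hdg : ∀ {x e μ e₂ μ₂}, EqNearLL s e μ e₂ μ₂ x → ∀ w : A.T x, VectorBdl.deriv w g =
      VectorBdl.deriv w (logNorm ν τ e μ) + VectorBdl.deriv w (logNorm ν τ e₂ μ₂) := by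
    intro x e μ e₂ μ₂ h w
    rw [← deriv_add_at _ (mdiff_of_contMDiffAt (logNorm_smooth ν τ (hne h).1))
      (mdiff_of_contMDiffAt (logNorm_smooth ν τ (hne h).2))]
    exact deriv_congr _ (hg h)
  have h2 : ∀ x v, lin ((2 : ℝ) • θ).1 x v = 2 * lin θ.1 x v := fun _ _ => rfl
  refine ⟨g, fun θ' => ⟨fun h x v => ?_, fun h x e μ e₂ μ₂ hx a X Y => ?_⟩⟩
  · obtain ⟨e, μ, e₂, μ₂, hx⟩ := hs x
    obtain ⟨a, rfl⟩ := exists_sec (A := A.toVectorBdl) x v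
    obtain ⟨h01, h02⟩ := hne hx
    obtain ⟨X, hX⟩ := exists_vec_fields_ne (μ := μ) (x := x) fun h => h01 (by
      rw [h, TensorProduct.tmul_zero])
    obtain ⟨Y, hY⟩ := exists_vec_fields_ne (μ := μ₂) (x := x) fun h => h02 (by
      rw [h, TensorProduct.tmul_zero])
    have h1 := h x e μ e₂ μ₂ hx a X Y
    rw [repL_eq hθ h01, repL_eq hθ h02] at h1
    have h3 : lin θ' x (a x) = _ := smul_left_injective ℝ (tmul_ne_zero
      (smul_ne_zero hX fun h => h01 (by rw [h, TensorProduct.zero_tmul]))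
      (smul_ne_zero hY fun h => h02 (by rw [h, TensorProduct.zero_tmul])))
      (h1.trans (smul_tmul_add _ _ _ _))
    rw [h3, h2, hdg hx]
    ring
  · obtain ⟨h01, h02⟩ := hne hx
    rw [repL_eq hθ h01, repL_eq hθ h02]
    refine Eq.trans ?_ (smul_tmul_add _ _ _ _).symm
    congr 1
    refine (h x (a x)).trans ?_
    rw [h2, hdg hx]
    ring

/-- Every modular class is the class of the cocycle given by densities. -/
theorem eq_of_isModularClass {θ : A.Z1} (hθ : ∀ (a : A.Sec) x,
      lin θ.1 x (a x) = τ.lam (lie (anchorVec a)) x - ν.lam (ad a) x)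
    {c : A.H1} (hc : A.IsModularClass c) :
    c = Submodule.Quotient.mk θ := by
  rcases hc with ⟨-, s, θ', hs, hs0, hc, rfl⟩ | ⟨-, s, θ', hs, hs0, hc, rfl⟩
  · obtain ⟨g, hg⟩ := charCocycle_iff hθ hs hs0
    exact (mk_eq_iff _ _).2 ⟨g, (hg _).1 hc⟩
  · obtain ⟨g, hg⟩ := charCocycleSq_iff hθ hs hs0
    have h1 : (Submodule.Quotient.mk θ' : A.H1) = Submodule.Quotient.mk ((2 : ℝ) • θ) :=
      (mk_eq_iff _ _).2 ⟨g, (hg _).1 hc⟩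
    rw [h1, Submodule.Quotient.mk_smul, smul_smul]
    norm_num

/-- The square of `L^A` has a nowhere vanishing section. -/
theorem exists_section_sq (A : LieAlgebroid.{u}) : ∃ s : ∀ x, A.L x ⊗[ℝ] A.L x, IsSmoothLL s ∧ ∀ x, s x ≠ 0 := by
  obtain ⟨ν⟩ := Dens.nonempty (A := A.toVectorBdl) A.r A.E
  obtain ⟨τ⟩ := Dens.nonempty (A := A.toVectorBdl) A.n A.T
  choose l hl using fun x => ell_surjective ν τ x 1
  have hl0 : ∀ x, l x ≠ 0 := fun x h => by
    have := hl x
    rw [h, map_zero] at this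
    exact zero_ne_one this
  refine ⟨fun x => l x ⊗ₜ[ℝ] l x, fun x₀ => ?_, fun x => tmul_ne_zero (v := l x) (w := l x) (hl0 x) (hl0 x)⟩
  obtain ⟨S, hS⟩ := Frame.exists_validAt (m := A.r) (V := A.E) x₀
  obtain ⟨Z, hZ⟩ := Frame.exists_validAt (m := A.n) (V := A.T) x₀
  -- `l x` is determined by the densities up to sign, so that `l x ⊗ l x` is locally a smooth multiple `k`
  -- of the square of a local section; `k` involves only squares of the densities.
  have hk : ∀ᶠ x in 𝓝 x₀, ContMDiffAt (𝓡 A.n) 𝓘(ℝ, ℝ) ∞ (fun y =>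
      τ.form y (fun i => Z.sec i y) ^ 2 * (ν.form y (fun i => S.sec i y) ^ 2)⁻¹) x := by
    filter_upwards [hS.eventually] with x hx
    refine (τ.smooth Z.sec x).mul ?_
    exact (contDiffAt_inv ℝ (pow_ne_zero 2 (ν.sec_ne hx))).contMDiffAt.comp x (ν.smooth S.sec x)
  obtain ⟨k, hk⟩ := exists_fun_eventuallyEq hk
  let μ : A.VolForm := ⟨Z.vol, Z.vol_smooth⟩
  let μ' : A.VolForm := ⟨fun x => k x • Z.vol x, fun X => k.contMDiff.mul (Z.vol_smooth X)⟩
  refine ⟨S.sec, μ', S.sec, μ, ?_⟩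
  filter_upwards [hS.eventually, hZ.eventually, hk] with x hSx hZx hkx
  change l x ⊗ₜ[ℝ] l x = (wedge S.sec x ⊗ₜ[ℝ] (k x • Z.vol x)) ⊗ₜ[ℝ] (wedge S.sec x ⊗ₜ[ℝ] Z.vol x)
  have h0 := ell_frame_ne ν τ hSx hZx
  rw [TensorProduct.tmul_smul, ← TensorProduct.smul_tmul', eq_smul_frame ν τ hSx hZx (l x), hl,
    TensorProduct.smul_tmul_smul, hkx, ell_tmul, ratio_vol τ hZx]
  congr 1
  have h1 := ν.sec_ne hSx
  have h2 := τ.sec_ne hZx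
  field_simp

/-- The class of the cocycle given by densities is a modular class. -/
theorem isModularClass_mk {θ : A.Z1} (hθ : ∀ (a : A.Sec) x,
      lin θ.1 x (a x) = τ.lam (lie (anchorVec a)) x - ν.lam (ad a) x) :
    A.IsModularClass (Submodule.Quotient.mk θ) := by
  by_cases ho : A.OrientableL
  · obtain ⟨s, hs, hs0⟩ := ho
    obtain ⟨g, hg⟩ := charCocycle_iff hθ hs hs0
    let θ' : A.Z1 := θ + ⟨exact g, exact_mem_Z1 g⟩
    have h : ∀ x v, lin θ'.1 x v = lin θ.1 x v + VectorBdl.deriv (A.anchor x v) g := fun _ _ => rfl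
    exact Or.inl ⟨⟨s, hs, hs0⟩, s, θ', hs, hs0, (hg _).2 h, ((mk_eq_iff _ _).2 ⟨g, h⟩).symm⟩
  · obtain ⟨s, hs, hs0⟩ := exists_section_sq A
    obtain ⟨g, hg⟩ := charCocycleSq_iff hθ hs hs0
    let θ' : A.Z1 := (2 : ℝ) • θ + ⟨exact g, exact_mem_Z1 g⟩
    have h : ∀ x v, lin θ'.1 x v = lin ((2 : ℝ) • θ).1 x v + VectorBdl.deriv (A.anchor x v) g :=
      fun _ _ => rfl
    refine Or.inr ⟨ho, s, θ', hs, hs0, (hg _).2 h, ?_⟩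
    rw [(mk_eq_iff _ _).2 ⟨g, h⟩, Submodule.Quotient.mk_smul, smul_smul]
    norm_num

/-- The modular class is represented by the modular cocycle of any densities. -/
theorem mod_eq {θ : A.Z1} (hθ : ∀ (a : A.Sec) x,
      lin θ.1 x (a x) = τ.lam (lie (anchorVec a)) x - ν.lam (ad a) x) :
    A.mod = Submodule.Quotient.mk θ :=
  eq_of_isModularClass hθ (Classical.epsilon_spec ⟨_, isModularClass_mk hθ⟩)

theorem isModularClass_mod (A : LieAlgebroid.{u}) :
    A.IsModularClass A.mod ∧ ∀ c, A.IsModularClass c → c = A.mod := by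
  obtain ⟨ν⟩ := Dens.nonempty (A := A.toVectorBdl) A.r A.E
  obtain ⟨τ⟩ := Dens.nonempty (A := A.toVectorBdl) A.n A.T
  obtain ⟨θ, hθ⟩ := exists_modForm ν τ
  rw [mod_eq hθ]
  exact ⟨isModularClass_mk hθ, fun c hc => eq_of_isModularClass hθ hc⟩

end LieAlgebroid
end LieAlgd

/-! ### The differential of a submersion -/

namespace LieAlgd
namespace VectorBdl
variable {A Q : VectorBdl.{u}}

/-- The differential of a function at a point, as a functional. -/
def diff (f : A.M → ℝ) (x : A.M) : A.T x →ₗ[ℝ] ℝ := (mfderiv (𝓡 A.n) 𝓘(ℝ, ℝ) f x).toLinearMap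

theorem isSmoothCov_diff (f : A.Fun) : IsSmoothCov (A := A) (V := A.T) A.n (diff f) := by
  have h1 : ContMDiff (𝓡 A.n).tangent 𝓘(ℝ, ℝ).tangent ∞ (tangentMap (𝓡 A.n) 𝓘(ℝ, ℝ) f) :=
    f.contMDiff.contMDiff_tangentMap (by simp)
  have h3 : ContMDiff 𝓘(ℝ, ℝ).tangent 𝓘(ℝ, ℝ) ∞ (fun v : TangentBundle 𝓘(ℝ, ℝ) ℝ => v.2) :=
    contMDiff_snd_tangentBundle_modelSpace ℝ 𝓘(ℝ, ℝ)
  exact h3.comp h1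

/-- Every covector is the differential of a function. -/
theorem exists_fun_deriv_eq {x : A.M} (l : A.T x →ₗ[ℝ] ℝ) : ∃ f : A.Fun, ∀ w, deriv w f = l w := by
  have hfd : FiniteDimensional ℝ (A.T x) := (finrank_fibre (m := A.n) (V := A.T) x).1
  let W : Submodule ℝ (Module.Dual ℝ (A.T x)) :=
    { carrier := {l | ∃ f : A.Fun, diff f x = l}
      add_mem' := by
        rintro _ _ ⟨f, rfl⟩ ⟨g, rfl⟩
        exact ⟨f + g, LinearMap.ext fun w => deriv_add w f.contMDiff g.contMDiff⟩
      zero_mem' := ⟨ContMDiffMap.const 0, LinearMap.ext fun w => deriv_const w 0⟩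
      smul_mem' := by
        rintro c _ ⟨f, rfl⟩
        exact ⟨c • f, LinearMap.ext fun w => deriv_const_mul w c f.contMDiff⟩ }
  have h1 : Submodule.dualCoannihilator W = ⊥ := by
    refine (Submodule.eq_bot_iff _).2 fun w hw => ?_
    rw [Submodule.mem_dualCoannihilator] at hw
    refine eq_of_deriv_eq fun f => ?_
    refine (hw (diff f x) ⟨f, rfl⟩).trans ?_
    exact (map_zero (diff f x)).symm
  have h2 := Subspace.dualCoannihilator_dualAnnihilator_eq (W := W)
  rw [h1, Submodule.dualAnnihilator_bot] at h2
  have h3 : l ∈ W := by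
    rw [← h2]
    exact Submodule.mem_top
  obtain ⟨f, hf⟩ := h3
  exact ⟨f, fun w => DFunLike.congr_fun hf w⟩

/-- The differential of a map of the base manifolds. -/
def tmap (φ : Q.M → A.M) (p : Q.M) : Q.T p →ₗ[ℝ] A.T (φ p) :=
  (mfderiv (𝓡 Q.n) (𝓡 A.n) φ p).toLinearMap

theorem deriv_tmap {φ : Q.M → A.M} (hφ : ContMDiff (𝓡 Q.n) (𝓡 A.n) ∞ φ) {p : Q.M} (w : Q.T p)
    {f : A.M → ℝ} (hf : ContMDiff (𝓡 A.n) 𝓘(ℝ, ℝ) ∞ f) :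
    deriv (tmap φ p w) f = deriv w (fun y => f (φ y)) :=
  (deriv_comp φ hφ w hf).symm

theorem deriv_tmap_at {φ : Q.M → A.M} (hφ : ContMDiff (𝓡 Q.n) (𝓡 A.n) ∞ φ) {p : Q.M} (w : Q.T p)
    {f : A.M → ℝ} (hf : ContMDiffAt (𝓡 A.n) 𝓘(ℝ, ℝ) ∞ f (φ p)) :
    deriv (tmap φ p w) f = deriv w (fun y => f (φ y)) := by
  have h := mfderiv_comp p (hf.mdifferentiableAt (by simp)) (hφ.mdifferentiableAt (x := p) (by simp))
  exact (DFunLike.congr_fun h w).symm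

theorem contMDiff_tmap {φ : Q.M → A.M} (hφ : ContMDiff (𝓡 Q.n) (𝓡 A.n) ∞ φ) :
    ContMDiff (𝓡 Q.n).tangent (𝓡 A.n).tangent ∞
      (fun v : TangentBundle (𝓡 Q.n) Q.M =>
        (⟨φ v.1, tmap φ v.1 v.2⟩ : TangentBundle (𝓡 A.n) A.M)) :=
  hφ.contMDiff_tangentMap (by simp)

/-- Functions which, together with a submersion, form coordinates to first order at a point. -/
theorem exists_vertical_coords {φ : Q.M → A.M} {p : Q.M} (hs : Function.Surjective (tmap φ p)) :
    ∃ y : Fin (Q.n - A.n) → Q.Fun,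
      Function.Bijective (fun w : Q.T p => (tmap φ p w, fun l => deriv w (y l))) := by
  have hfd : FiniteDimensional ℝ (Q.T p) := (finrank_fibre (m := Q.n) (V := Q.T) p).1
  have h1 := LinearMap.finrank_range_add_finrank_ker (tmap φ p)
  rw [LinearMap.range_eq_top.2 hs, finrank_top, (finrank_fibre (m := A.n) (V := A.T) (φ p)).2,
    (finrank_fibre (m := Q.n) (V := Q.T) p).2] at h1
  have e : LinearMap.ker (tmap φ p) ≃ₗ[ℝ] (Fin (Q.n - A.n) → ℝ) :=
    LinearEquiv.ofFinrankEq _ _ (by rw [Module.finrank_fin_fun]; omega)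
  obtain ⟨g, hg⟩ := LinearMap.exists_extend e.toLinearMap
  choose y hy using fun l => exists_fun_deriv_eq ((LinearMap.proj l).comp g)
  have hyg : ∀ w, (fun l => deriv w (y l)) = g w := fun w => funext fun l => hy l w
  refine ⟨y, fun w w' h => ?_, fun ⟨u, c⟩ => ?_⟩
  · simp only [hyg, Prod.mk.injEq] at h
    have hk : w - w' ∈ LinearMap.ker (tmap φ p) := by
      rw [LinearMap.mem_ker, map_sub, h.1, sub_self]
    have h2 : e ⟨w - w', hk⟩ = 0 := by
      refine (DFunLike.congr_fun hg ⟨w - w', hk⟩).symm.trans ?_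
      change g (w - w') = 0
      rw [map_sub, h.2, sub_self]
    have h3 := congrArg Subtype.val (e.map_eq_zero_iff.1 h2)
    exact sub_eq_zero.1 h3
  · obtain ⟨w, rfl⟩ := hs u
    have h2 : g (e.symm (c - g w)) = c - g w := by
      refine (DFunLike.congr_fun hg (e.symm (c - g w))).trans ?_
      exact e.apply_symm_apply _
    refine ⟨w + (e.symm (c - g w)).1, ?_⟩
    simp only [hyg, map_add, h2, Prod.mk.injEq]
    refine ⟨?_, by abel⟩
    have h3 : tmap φ p (e.symm (c - g w)).1 = 0 := LinearMap.mem_ker.1 (e.symm (c - g w)).2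
    rw [h3, add_zero]

/-- The Lie bracket of projectable vector fields, where one of them is projectable only up to function
coefficients. -/
theorem tmap_lie {φ : Q.M → A.M} (hφ : ContMDiff (𝓡 Q.n) (𝓡 A.n) ∞ φ) {ι : Type*} [Fintype ι]
    (f : ι → Q.Fun) (B : ι → A.Vec) (X : A.Vec) (W w : Q.Vec) {p : Q.M}
    (hW : ∀ᶠ y in 𝓝 p, tmap φ y (W y) = ∑ k, f k y • B k (φ y))
    (hw : ∀ᶠ y in 𝓝 p, tmap φ y (w y) = X (φ y)) :
    tmap φ p ((lie W).D w p) = ∑ k, f k p • (lie (B k)).D X (φ p) -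
      ∑ k, deriv (w p) (f k) • B k (φ p) := by
  refine eq_of_deriv_eq fun g => ?_
  have hB : ∀ k, ContMDiff (𝓡 Q.n) 𝓘(ℝ, ℝ) ∞ (fun y => deriv (B k (φ y)) g) :=
    fun k => (contMDiff_deriv (B k) g).comp hφ
  have h1 : ∀ᶠ y in 𝓝 p, deriv (w y) (fun z => g (φ z)) = deriv (X (φ y)) g := by
    filter_upwards [hw] with y hy
    rw [← hy, deriv_tmap hφ _ g.contMDiff]
  have h2 : ∀ᶠ y in 𝓝 p, deriv (W y) (fun z => g (φ z)) = ∑ k, f k y * deriv (B k (φ y)) g := by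
    filter_upwards [hW] with y hy
    rw [← deriv_tmap hφ _ g.contMDiff, hy, deriv_sum_vec]
  have h3 : deriv (W p) (fun y => deriv (X (φ y)) g) =
      ∑ k, f k p * deriv (B k (φ p)) (fun y => deriv (X y) g) := by
    rw [← deriv_sum_vec, ← hW.self_of_nhds, deriv_tmap hφ _ (contMDiff_deriv X g)]
  have h4 : ∀ k, deriv (w p) (fun y => deriv (B k (φ y)) g) =
      deriv (X (φ p)) (fun y => deriv (B k y) g) := by
    intro k
    rw [← hw.self_of_nhds, deriv_tmap hφ _ (contMDiff_deriv (B k) g)]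
  rw [deriv_tmap hφ _ g.contMDiff, sub_eq_add_neg, ← neg_one_smul ℝ (∑ k, _ • _), deriv_add_vec,
    deriv_smul_vec, deriv_sum_vec, deriv_sum_vec]
  simp only [deriv_lie]
  refine (deriv_lie W w ⟨fun y => g (φ y), g.contMDiff.comp hφ⟩ p).trans ?_
  simp only [ContMDiffMap.coeFn_mk]
  rw [deriv_congr _ h1, deriv_congr _ h2, h3,
    deriv_sum (f := fun k y => f k y * deriv (B k (φ y)) g) _ _
      fun k => (f k).contMDiff.mul (hB k)]
  simp only [deriv_mul _ (f _).contMDiff (hB _), h4, Finset.sum_add_distrib, mul_sub,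
    Finset.sum_sub_distrib]
  ring

section Sections
variable {m : ℕ} {V : A.M → Type v} [∀ x, AddCommGroup (V x)] [∀ x, Module ℝ (V x)]
  [∀ x, TopologicalSpace (V x)] [TopologicalSpace (TotalSpace (EuclideanSpace ℝ (Fin m)) V)]
  [FiberBundle (EuclideanSpace ℝ (Fin m)) V] [VectorBundle ℝ (EuclideanSpace ℝ (Fin m)) V]
  [ContMDiffVectorBundle ∞ (EuclideanSpace ℝ (Fin m)) V (𝓡 A.n)]
  {ι κ : Type*} [Fintype ι] [DecidableEq ι] [Fintype κ] [DecidableEq κ]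

/-- A frame with its sections indexed differently. -/
def Frame.reindex (S : Frame m V ι) (e : κ ≃ ι) : Frame m V κ :=
  ⟨fun k => S.sec (e k), fun k => S.coord (e k), fun k => S.smooth (e k)⟩

theorem Frame.ValidAt.reindex {S : Frame m V ι} {x : A.M} (h : S.ValidAt x) (e : κ ≃ ι) :
    (S.reindex e).ValidAt x := by
  refine Filter.Eventually.mono h fun y hy => ⟨fun i j => ?_, fun v => ?_⟩
  · refine (hy.1 (e i) (e j)).trans ?_
    simp only [e.injective.eq_iff]
  · refine (hy.2 v).trans ?_
    exact (e.sum_comp fun i => S.coord i y v • S.sec i y).symm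

theorem Frame.trace_reindex (S : Frame m V ι) (e : κ ≃ ι) (δ : Der m V) (x : A.M) :
    (δ.matrix (S.reindex e) x).trace = (δ.matrix S x).trace :=
  e.sum_comp fun i => S.coord i x (δ.D (S.sec i) x)

theorem Frame.ValidAt.card {S : Frame m V ι} {x : A.M} (h : S.ValidAt x) : Fintype.card ι = m := by
  refine Eq.trans ?_ (finrank_fibre (m := m) (V := V) x).2
  rw [Module.finrank_eq_card_basis h.basis]

/-- `lam` in a frame with an arbitrary index set. -/
theorem Dens.lam_eq_reindex (ν : Dens m V) (δ : Der m V) {S : Frame m V ι} {x : A.M} (h : S.ValidAt x)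
    (e : Fin m ≃ ι) : ν.lam δ x =
      deriv (δ.X x) (fun y => Real.log ((ν.form y).domDomCongr e (fun i => S.sec i y))) -
        (δ.matrix S x).trace := by
  rw [ν.lam_eq δ (h.reindex e), S.trace_reindex e]
  rfl

theorem Dens.reindex_ne (ν : Dens m V) {S : Frame m V ι} {x : A.M} (h : S.ValidAt x)
    (e : Fin m ≃ ι) : (ν.form x).domDomCongr e (fun i => S.sec i x) ≠ 0 :=
  ν.sec_ne (h.reindex e)

theorem Dens.log_reindex_smooth (ν : Dens m V) {S : Frame m V ι} {x : A.M} (h : S.ValidAt x)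
    (e : Fin m ≃ ι) : ContMDiffAt (𝓡 A.n) 𝓘(ℝ, ℝ) ∞
      (fun y => Real.log ((ν.form y).domDomCongr e (fun i => S.sec i y))) x :=
  ν.log_smooth (ν.sec_ne (h.reindex e))

end Sections
end VectorBdl
end LieAlgd

/-! ### The bracket of a pull-back Lie algebroid in adapted frames -/

namespace LieAlgd
namespace LieAlgebroid
open VectorBdl
variable {A Q : LieAlgebroid.{u}} {pr : BdlMap Q.toVectorBdl A.toVectorBdl}

theorem IsPullback.tmap_anchor (h : IsPullback A Q pr) (p : Q.M) (q : Q.E p) :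
    tmap (Q := Q.toVectorBdl) (A := A.toVectorBdl) pr.base p (Q.anchor p q) =
      A.anchor (pr.base p) (pr.fib p q) :=
  (h.anchor_comm p q).symm

/-- An element of the pull-back Lie algebroid is determined by its two components. -/
theorem IsPullback.ext (h : IsPullback A Q pr) {p : Q.M} {q q' : Q.E p}
    (h1 : pr.fib p q = pr.fib p q') (h2 : Q.anchor p q = Q.anchor p q') : q = q' :=
  (h.fiber p (pr.fib p q) (Q.anchor p q) (h.anchor_comm p q)).unique ⟨rfl, rfl⟩ ⟨h1.symm, h2.symm⟩

/-- The bracket of a section with a projectable section. -/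
theorem IsPullback.pr_bracket (h : IsPullback A Q pr) (q s : Q.Sec) {k : ℕ} (f : Fin k → Q.Fun)
    (b : Fin k → A.Sec) (hq : ∀ p, pr.fib p (q p) = ∑ i, f i p • b i (pr.base p)) (e : A.Sec) {p : Q.M}
    (hs : ∀ᶠ y in 𝓝 p, pr.fib y (s y) = e (pr.base y)) :
    pr.fib p (Q.bracket q s p) = ∑ i, f i p • A.bracket (b i) e (pr.base p) -
      ∑ i, VectorBdl.deriv (Q.anchor p (s p)) (f i) • b i (pr.base p) := by
  obtain ⟨χ, hχ1, hχ⟩ := exists_bump hs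
  have h1 : ∀ y, pr.fib y (fsmul χ s y) = ∑ j : Fin 1, χ y • e (pr.base y) := by
    intro y
    rw [Fin.sum_univ_one]
    change pr.fib y (χ y • s y) = _
    by_cases hy : y ∈ tsupport χ
    · rw [map_smul, hχ hy]
    · rw [image_eq_zero_of_notMem_tsupport hy, zero_smul, zero_smul, map_zero]
  have h2 := h.bracket q (fsmul χ s) k 1 f b (fun _ => χ) (fun _ => e) hq h1 p
  rw [bracket_fsmul_of_one _ _ χ hχ1] at h2
  have h3 : fsmul χ s p = s p := by
    change χ p • s p = _
    rw [hχ1.self_of_nhds, one_smul]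
  rw [h2, h3]
  have h4 : VectorBdl.deriv (Q.anchor p (q p)) χ = 0 := by
    rw [deriv_congr (g := fun _ => 1) _ hχ1, deriv_const]
  simp only [Fin.sum_univ_one, h4, zero_smul, add_zero, hχ1.self_of_nhds, mul_one]

variable (pr) in
/-- Frames of `A`, of the tangent bundle of its base, of `Q` and of the tangent bundle of its base, which are
adapted to the projection: the last two consist of lifts of the first two and of common vertical
vectors. -/
structure Adapted (d : ℕ) where
  SA : Frame (A := A.toVectorBdl) A.r A.E (Fin A.r)
  SM : Frame (A := A.toVectorBdl) A.n A.T (Fin A.n)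
  SQ : Frame (A := Q.toVectorBdl) Q.r Q.E (Fin A.r ⊕ Fin d)
  SP : Frame (A := Q.toVectorBdl) Q.n Q.T (Fin A.n ⊕ Fin d)
  coord_fib : ∀ i p q, SQ.coord (Sum.inl i) p q = SA.coord i (pr.base p) (pr.fib p q)
  coord_tmap : ∀ j p w, SP.coord (Sum.inl j) p w =
    SM.coord j (pr.base p) (tmap (Q := Q.toVectorBdl) (A := A.toVectorBdl) pr.base p w)
  coord_anchor : ∀ l p q, SQ.coord (Sum.inr l) p q = SP.coord (Sum.inr l) p (Q.anchor p q)

namespace Adapted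
variable {d : ℕ} (K : Adapted pr d)

/-- All four frames are valid: those of `Q` and of its base at `p`, those of `A` and of its base at the
image of `p`. -/
structure ValidAt (p : Q.M) : Prop where
  va : K.SA.ValidAt (pr.base p)
  vm : K.SM.ValidAt (pr.base p)
  vq : K.SQ.ValidAt p
  vp : K.SP.ValidAt p

variable {K} {p : Q.M}

theorem ValidAt.eventually (hK : K.ValidAt p) : ∀ᶠ y in 𝓝 p, K.ValidAt y := by
  have hc := pr.base_smooth.continuous.continuousAt (x := p)
  filter_upwards [hc.eventually hK.va.eventually, hc.eventually hK.vm.eventually, hK.vq.eventually,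
    hK.vp.eventually] with y h1 h2 h3 h4
  exact ⟨h1, h2, h3, h4⟩

theorem _root_.LieAlgd.VectorBdl.Frame.ValidAt.eq_of_coord {B : VectorBdl.{u}} {m : ℕ} {V : B.M → Type v}
    [∀ x, AddCommGroup (V x)] [∀ x, Module ℝ (V x)]
    [∀ x, TopologicalSpace (V x)] [TopologicalSpace (TotalSpace (EuclideanSpace ℝ (Fin m)) V)]
    [FiberBundle (EuclideanSpace ℝ (Fin m)) V] [VectorBundle ℝ (EuclideanSpace ℝ (Fin m)) V]
    [ContMDiffVectorBundle ∞ (EuclideanSpace ℝ (Fin m)) V (𝓡 B.n)]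
    {ι : Type*} [Fintype ι] [DecidableEq ι] {S : Frame m V ι} {x : B.M} (h : S.ValidAt x) {v w : V x}
    (hvw : ∀ i, S.coord i x v = S.coord i x w) : v = w := by
  rw [h.expand v, h.expand w]
  simp only [hvw]

theorem ValidAt.fib_inl (hK : K.ValidAt p) (i : Fin A.r) :
    pr.fib p (K.SQ.sec (Sum.inl i) p) = K.SA.sec i (pr.base p) :=
  hK.va.eq_of_coord fun j => by
    rw [← K.coord_fib, hK.vq.dual, hK.va.dual]
    simp only [Sum.inl.injEq]

theorem ValidAt.fib_inr (hK : K.ValidAt p) (l : Fin d) : pr.fib p (K.SQ.sec (Sum.inr l) p) = 0 :=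
  hK.va.eq_of_coord fun j => by
    rw [← K.coord_fib, hK.vq.dual, map_zero]
    simp

theorem ValidAt.tmap_inl (hK : K.ValidAt p) (i : Fin A.n) :
    tmap (Q := Q.toVectorBdl) (A := A.toVectorBdl) pr.base p (K.SP.sec (Sum.inl i) p) =
      K.SM.sec i (pr.base p) :=
  hK.vm.eq_of_coord fun j => by
    rw [← K.coord_tmap, hK.vp.dual, hK.vm.dual]
    simp only [Sum.inl.injEq]

theorem ValidAt.tmap_inr (hK : K.ValidAt p) (l : Fin d) :
    tmap (Q := Q.toVectorBdl) (A := A.toVectorBdl) pr.base p (K.SP.sec (Sum.inr l) p) = 0 :=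
  hK.vm.eq_of_coord fun j => by
    rw [← K.coord_tmap, hK.vp.dual, map_zero]
    simp

theorem ValidAt.anchor_inr (h : IsPullback A Q pr) (hK : K.ValidAt p) (l : Fin d) :
    Q.anchor p (K.SQ.sec (Sum.inr l) p) = K.SP.sec (Sum.inr l) p :=
  hK.vp.eq_of_coord fun j => by
    rcases j with j | j
    · rw [K.coord_tmap, h.tmap_anchor, hK.fib_inr, map_zero, map_zero, hK.vp.dual]
      simp
    · rw [← K.coord_anchor, hK.vq.dual, hK.vp.dual]
      simp

/-- The traces of the adjoint actions on the four frames. -/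
theorem ValidAt.trace_sub (h : IsPullback A Q pr) (hK : K.ValidAt p) (q : Q.Sec) {k : ℕ} (f : Fin k → Q.Fun)
    (b : Fin k → A.Sec) (hq : ∀ p, pr.fib p (q p) = ∑ i, f i p • b i (pr.base p)) :
    ((lie (anchorVec q)).matrix K.SP p).trace - ((ad q).matrix K.SQ p).trace =
      ∑ i, f i p * (((lie (anchorVec (b i))).matrix K.SM (pr.base p)).trace -
        ((ad (b i)).matrix K.SA (pr.base p)).trace) := by
  have hq' : ∀ y, tmap (Q := Q.toVectorBdl) (A := A.toVectorBdl) pr.base y (anchorVec q y) =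
      ∑ i, f i y • anchorVec (b i) (pr.base y) := by
    intro y
    refine (h.tmap_anchor y (q y)).trans ?_
    rw [hq, map_sum]
    exact Finset.sum_congr rfl fun i _ => map_smul _ _ _
  have e1 : ∀ i, K.SP.coord (Sum.inl i) p ((lie (anchorVec q)).D (K.SP.sec (Sum.inl i)) p) =
      ∑ k, f k p * K.SM.coord i (pr.base p) ((lie (anchorVec (b k))).D (K.SM.sec i) (pr.base p)) -
      ∑ k, VectorBdl.deriv (K.SP.sec (Sum.inl i) p) (f k) *
        K.SM.coord i (pr.base p) (anchorVec (b k) (pr.base p)) := by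
    intro i
    rw [K.coord_tmap, tmap_lie pr.base_smooth f (fun k => anchorVec (b k)) (K.SM.sec i) _ _
      (Filter.Eventually.of_forall hq') (hK.eventually.mono fun y hy => hy.tmap_inl i), map_sub, map_sum,
      map_sum]
    simp only [map_smul, smul_eq_mul]
  have e2 : ∀ i, K.SQ.coord (Sum.inl i) p (Q.bracket q (K.SQ.sec (Sum.inl i)) p) =
      ∑ k, f k p * K.SA.coord i (pr.base p) (A.bracket (b k) (K.SA.sec i) (pr.base p)) -
      ∑ k, VectorBdl.deriv (Q.anchor p (K.SQ.sec (Sum.inl i) p)) (f k) *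
        K.SA.coord i (pr.base p) (b k (pr.base p)) := by
    intro i
    rw [K.coord_fib, h.pr_bracket q _ f b hq (K.SA.sec i)
      (hK.eventually.mono fun y hy => hy.fib_inl i), map_sub, map_sum, map_sum]
    simp only [map_smul, smul_eq_mul]
  have e3 : ∀ l, K.SP.coord (Sum.inr l) p ((lie (anchorVec q)).D (K.SP.sec (Sum.inr l)) p) =
      K.SQ.coord (Sum.inr l) p (Q.bracket q (K.SQ.sec (Sum.inr l)) p) := by
    intro l
    rw [K.coord_anchor, Q.anchor_bracket]
    congr 1
    have h1 := (lie (anchorVec q)).congr (Y := K.SP.sec (Sum.inr l))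
      (Z := anchorVec (K.SQ.sec (Sum.inr l))) (hK.eventually.mono fun y hy => (ValidAt.anchor_inr h hy l).symm)
    exact h1
  -- the lifts of the values of `b k` to the two frames agree
  have e4 : ∀ k, ∑ i, VectorBdl.deriv (K.SP.sec (Sum.inl i) p) (f k) *
        K.SM.coord i (pr.base p) (anchorVec (b k) (pr.base p)) =
      ∑ i, VectorBdl.deriv (Q.anchor p (K.SQ.sec (Sum.inl i) p)) (f k) *
        K.SA.coord i (pr.base p) (b k (pr.base p)) := by
    intro k
    simp only [mul_comm (VectorBdl.deriv _ _)]
    rw [← deriv_sum_vec, ← deriv_sum_vec]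
    congr 1
    refine hK.vp.eq_of_coord fun j => ?_
    rcases j with j | j
    · have u1 : tmap (Q := Q.toVectorBdl) (A := A.toVectorBdl) pr.base p
          (∑ i, K.SM.coord i (pr.base p) (anchorVec (b k) (pr.base p)) • K.SP.sec (Sum.inl i) p) =
          anchorVec (b k) (pr.base p) := by
        rw [map_sum]
        simp only [map_smul, hK.tmap_inl]
        exact (hK.vm.expand _).symm
      have u2 : tmap (Q := Q.toVectorBdl) (A := A.toVectorBdl) pr.base p
          (∑ i, K.SA.coord i (pr.base p) (b k (pr.base p)) • Q.anchor p (K.SQ.sec (Sum.inl i) p)) =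
          anchorVec (b k) (pr.base p) := by
        rw [map_sum]
        refine (Finset.sum_congr rfl fun i _ => ?_).trans ((map_sum (A.anchor (pr.base p)) _ _).symm.trans
          (congrArg (A.anchor (pr.base p)) (hK.va.expand (b k (pr.base p))).symm))
        rw [map_smul, map_smul, h.tmap_anchor, hK.fib_inl]
      rw [K.coord_tmap, K.coord_tmap, u1, u2]
    · simp only [map_sum, map_smul, ← K.coord_anchor, hK.vp.dual, hK.vq.dual]
      simp
  have t1 : ((lie (anchorVec q)).matrix K.SP p).trace =
      ∑ i, K.SP.coord (Sum.inl i) p ((lie (anchorVec q)).D (K.SP.sec (Sum.inl i)) p) +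
      ∑ l, K.SP.coord (Sum.inr l) p ((lie (anchorVec q)).D (K.SP.sec (Sum.inr l)) p) :=
    Fintype.sum_sum_type _
  have t2 : ((ad q).matrix K.SQ p).trace =
      ∑ i, K.SQ.coord (Sum.inl i) p (Q.bracket q (K.SQ.sec (Sum.inl i)) p) +
      ∑ l, K.SQ.coord (Sum.inr l) p (Q.bracket q (K.SQ.sec (Sum.inr l)) p) :=
    Fintype.sum_sum_type _
  have t3 : ∀ k, ((lie (anchorVec (b k))).matrix K.SM (pr.base p)).trace =
    ∑ i, K.SM.coord i (pr.base p) ((lie (anchorVec (b k))).D (K.SM.sec i) (pr.base p)) := fun k => rfl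
  have t4 : ∀ k, ((ad (b k)).matrix K.SA (pr.base p)).trace =
    ∑ i, K.SA.coord i (pr.base p) (A.bracket (b k) (K.SA.sec i) (pr.base p)) := fun k => rfl
  rw [t1, t2]
  simp only [e1, e2, e3, t3, t4, Finset.sum_sub_distrib, mul_sub, Finset.mul_sum]
  rw [Finset.sum_comm (f := fun i k => VectorBdl.deriv (K.SP.sec (Sum.inl i) p) (f k) * _),
    Finset.sum_comm (f := fun i k => VectorBdl.deriv (Q.anchor p (K.SQ.sec (Sum.inl i) p)) (f k) * _),
    Finset.sum_congr rfl fun k _ => e4 k,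
    Finset.sum_comm (f := fun i k => f k p * K.SM.coord i _ _),
    Finset.sum_comm (f := fun i k => f k p * K.SA.coord i _ _)]
  ring

end Adapted
end LieAlgebroid
end LieAlgd

/-! ### Invariance of the modular class under pull-back -/

namespace LieAlgd

theorem VectorBdl.Frame.ValidAt.bijective {B : VectorBdl.{u}} {m : ℕ} {V : B.M → Type v}
    [∀ x, AddCommGroup (V x)] [∀ x, Module ℝ (V x)]
    [∀ x, TopologicalSpace (V x)] [TopologicalSpace (TotalSpace (EuclideanSpace ℝ (Fin m)) V)]
    [FiberBundle (EuclideanSpace ℝ (Fin m)) V] [VectorBundle ℝ (EuclideanSpace ℝ (Fin m)) V]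
    [ContMDiffVectorBundle ∞ (EuclideanSpace ℝ (Fin m)) V (𝓡 B.n)]
    {ι : Type*} [Fintype ι] [DecidableEq ι] {S : VectorBdl.Frame m V ι} {x : B.M} (h : S.ValidAt x) :
    Function.Bijective (fun (v : V x) i => S.coord i x v) := by
  refine ⟨fun v w hvw => h.eq_of_coord fun i => congrFun hvw i, fun c => ?_⟩
  refine ⟨∑ i, c i • S.sec i x, funext fun i => ?_⟩
  simp only [map_sum, map_smul, h.dual]
  simp

namespace LieAlgebroid
open VectorBdl
variable {A Q : LieAlgebroid.{u}} {pr : BdlMap Q.toVectorBdl A.toVectorBdl}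

namespace Adapted

/-- Vertical coordinate functions of a submersion extend to adapted frames. -/
theorem exists_validAt_of_coords (h : IsPullback A Q pr) {p : Q.M} {y : Fin (Q.n - A.n) → Q.Fun}
    (hy : Function.Bijective (fun w : Q.T p =>
      (tmap (Q := Q.toVectorBdl) (A := A.toVectorBdl) pr.base p w, fun l => VectorBdl.deriv w (y l)))) :
    ∃ K : Adapted pr (Q.n - A.n), K.ValidAt p ∧
      ∀ l x w, K.SP.coord (Sum.inr l) x w = VectorBdl.deriv w (y l) := by
  obtain ⟨SA, hSA⟩ := Frame.exists_validAt (m := A.r) (V := A.E) (pr.base p)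
  obtain ⟨SM, hSM⟩ := Frame.exists_validAt (m := A.n) (V := A.T) (pr.base p)
  let cP : (Fin A.n ⊕ Fin (Q.n - A.n)) → ∀ x, Q.T x →ₗ[ℝ] ℝ :=
    Sum.elim (fun j x => (SM.coord j (pr.base x)).comp
      (tmap (Q := Q.toVectorBdl) (A := A.toVectorBdl) pr.base x))
      (fun l => diff (A := Q.toVectorBdl) (y l))
  let cQ : (Fin A.r ⊕ Fin (Q.n - A.n)) → ∀ x, Q.E x →ₗ[ℝ] ℝ :=
    Sum.elim (fun i x => (SA.coord i (pr.base x)).comp (pr.fib x))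
      (fun l x => (diff (A := Q.toVectorBdl) (y l) x).comp (Q.anchor x))
  have hcP : ∀ i, IsSmoothCov (A := Q.toVectorBdl) (V := Q.T) Q.n (cP i) := by
    rintro (j | l)
    · exact (SM.smooth j).comp (contMDiff_tmap pr.base_smooth)
    · exact isSmoothCov_diff (y l)
  have hcQ : ∀ i, IsSmoothCov (A := Q.toVectorBdl) (V := Q.E) Q.r (cQ i) := by
    rintro (j | l)
    · exact (SA.smooth j).comp pr.smooth
    · exact (isSmoothCov_diff (y l)).comp Q.anchor_smooth
  have hbP : Function.Bijective (fun (w : Q.T p) i => cP i p w) := by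
    refine ⟨fun w w' hw => hy.1 (Prod.ext (hSM.bijective.1 (funext fun j => congrFun hw (Sum.inl j)))
      (funext fun l => congrFun hw (Sum.inr l))), fun c => ?_⟩
    obtain ⟨u, hu⟩ := hSM.bijective.2 (fun j => c (Sum.inl j))
    obtain ⟨w, hw⟩ := hy.2 (u, fun l => c (Sum.inr l))
    simp only [Prod.mk.injEq] at hw
    refine ⟨w, funext fun i => ?_⟩
    rcases i with j | l
    · change SM.coord j (pr.base p) (tmap (Q := Q.toVectorBdl) (A := A.toVectorBdl) pr.base p w) = _
      rw [hw.1]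
      exact congrFun hu j
    · exact congrFun hw.2 l
  have hbQ : Function.Bijective (fun (w : Q.E p) i => cQ i p w) := by
    refine ⟨fun q q' hq => ?_, fun c => ?_⟩
    · have h1 : pr.fib p q = pr.fib p q' :=
        hSA.bijective.1 (funext fun j => congrFun hq (Sum.inl j))
      refine h.ext h1 (hy.1 (Prod.ext ?_ (funext fun l => congrFun hq (Sum.inr l))))
      change tmap (Q := Q.toVectorBdl) (A := A.toVectorBdl) pr.base p (Q.anchor p q) =
        tmap (Q := Q.toVectorBdl) (A := A.toVectorBdl) pr.base p (Q.anchor p q')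
      rw [h.tmap_anchor, h.tmap_anchor, h1]
    · obtain ⟨a, ha⟩ := hSA.bijective.2 (fun j => c (Sum.inl j))
      obtain ⟨w, hw⟩ := hy.2 (A.anchor (pr.base p) a, fun l => c (Sum.inr l))
      simp only [Prod.mk.injEq] at hw
      obtain ⟨q, ⟨hq1, hq2⟩, -⟩ := h.fiber p a w hw.1.symm
      refine ⟨q, funext fun i => ?_⟩
      rcases i with j | l
      · change SA.coord j (pr.base p) (pr.fib p q) = _
        rw [hq1]
        exact congrFun ha j
      · change VectorBdl.deriv (Q.anchor p q) (y l) = _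
        rw [hq2]
        exact congrFun hw.2 l
  obtain ⟨SP, hcP', hSP⟩ := Frame.exists_of_coframe hcP hbP
  obtain ⟨SQ, hcQ', hSQ⟩ := Frame.exists_of_coframe hcQ hbQ
  have eP : ∀ i x w, SP.coord i x w = cP i x w := fun i x w => by rw [hcP']
  have eQ : ∀ i x w, SQ.coord i x w = cQ i x w := fun i x w => by rw [hcQ']
  exact ⟨⟨SA, SM, SQ, SP, fun i p q => eQ _ _ _, fun j p w => eP _ _ _,
    fun l p q => (eQ (Sum.inr l) p q).trans (eP (Sum.inr l) p (Q.anchor p q)).symm⟩, ⟨hSA, hSM, hSQ, hSP⟩,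
    fun l x w => eP (Sum.inr l) x w⟩

/-- Adapted frames exist around every point of a submersion. -/
theorem exists_validAt (h : IsPullback A Q pr) {p : Q.M}
    (hs : Function.Surjective (mfderiv (𝓡 Q.n) (𝓡 A.n) pr.base p)) :
    ∃ K : Adapted pr (Q.n - A.n), K.ValidAt p := by
  obtain ⟨y, hy⟩ := exists_vertical_coords (Q := Q.toVectorBdl) (A := A.toVectorBdl) (φ := pr.base)
    (p := p) hs
  obtain ⟨K, hK, -⟩ := exists_validAt_of_coords h hy
  exact ⟨K, hK⟩

variable {d : ℕ} (νA : Dens (A := A.toVectorBdl) A.r A.E) (τA : Dens (A := A.toVectorBdl) A.n A.T)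
  (νQ : Dens (A := Q.toVectorBdl) Q.r Q.E) (τQ : Dens (A := Q.toVectorBdl) Q.n Q.T)
  (eQ : Fin Q.r ≃ Fin A.r ⊕ Fin d) (eP : Fin Q.n ≃ Fin A.n ⊕ Fin d)

/-- The logarithm of the ratio of the densities of the Lie algebroids and of their bases, computed in
adapted frames. -/
def logRatio (K : Adapted pr d) (p : Q.M) : ℝ :=
  Real.log ((τQ.form p).domDomCongr eP (fun i => K.SP.sec i p)) -
    Real.log ((νQ.form p).domDomCongr eQ (fun i => K.SQ.sec i p)) -
    (Real.log (τA.form (pr.base p) (fun i => K.SM.sec i (pr.base p))) -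
      Real.log (νA.form (pr.base p) (fun i => K.SA.sec i (pr.base p))))

variable {K K' : Adapted pr d} {p : Q.M}

theorem ValidAt.logRatio_smooth (hK : K.ValidAt p) :
    ContMDiffAt (𝓡 Q.n) 𝓘(ℝ, ℝ) ∞ (logRatio νA τA νQ τQ eQ eP K) p :=
  ((τQ.log_reindex_smooth hK.vp eP).sub (νQ.log_reindex_smooth hK.vq eQ)).sub
    (((τA.log_smooth (τA.sec_ne hK.vm)).comp p (pr.base_smooth p)).sub
      ((νA.log_smooth (νA.sec_ne hK.va)).comp p (pr.base_smooth p)))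

/-- The change of adapted frames is block triangular, and its vertical blocks agree. -/
theorem ValidAt.coeff_det (K : Adapted pr d) (h : IsPullback A Q pr) (hK' : K'.ValidAt p) :
    ∃ D : ℝ, (K.SQ.coeff K'.SQ.sec p).det = (K.SA.coeff K'.SA.sec (pr.base p)).det * D ∧
      (K.SP.coeff K'.SP.sec p).det = (K.SM.coeff K'.SM.sec (pr.base p)).det * D := by
  refine ⟨(Matrix.of fun k l => K.SP.coord (Sum.inr l) p (K'.SP.sec (Sum.inr k) p)).det, ?_, ?_⟩
  · rw [← Matrix.det_fromBlocks_zero₂₁ _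
      (Matrix.of fun i l => K.SQ.coord (Sum.inr l) p (K'.SQ.sec (Sum.inl i) p))]
    congr 1
    ext i j
    rcases i with i | i <;> rcases j with j | j
    · change K.SQ.coord (Sum.inl j) p (K'.SQ.sec (Sum.inl i) p) =
        K.SA.coord j (pr.base p) (K'.SA.sec i (pr.base p))
      rw [K.coord_fib, hK'.fib_inl]
    · rfl
    · change K.SQ.coord (Sum.inl j) p (K'.SQ.sec (Sum.inr i) p) = 0
      rw [K.coord_fib, hK'.fib_inr, map_zero]
    · change K.SQ.coord (Sum.inr j) p (K'.SQ.sec (Sum.inr i) p) =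
        K.SP.coord (Sum.inr j) p (K'.SP.sec (Sum.inr i) p)
      rw [K.coord_anchor, hK'.anchor_inr h]
  · rw [← Matrix.det_fromBlocks_zero₂₁ _
      (Matrix.of fun i l => K.SP.coord (Sum.inr l) p (K'.SP.sec (Sum.inl i) p))]
    congr 1
    ext i j
    rcases i with i | i <;> rcases j with j | j
    · change K.SP.coord (Sum.inl j) p (K'.SP.sec (Sum.inl i) p) =
        K.SM.coord j (pr.base p) (K'.SM.sec i (pr.base p))
      rw [K.coord_tmap, hK'.tmap_inl]
    · rfl
    · change K.SP.coord (Sum.inl j) p (K'.SP.sec (Sum.inr i) p) = 0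
      rw [K.coord_tmap, hK'.tmap_inr, map_zero]
    · rfl

/-- The ratio does not depend on the adapted frames. -/
theorem ValidAt.logRatio_eq (h : IsPullback A Q pr) (hK : K.ValidAt p) (hK' : K'.ValidAt p) :
    logRatio νA τA νQ τQ eQ eP K' p = logRatio νA τA νQ τQ eQ eP K p := by
  -- The vertical determinant `D` is the same for both bundles and cancels in the ratio.
  obtain ⟨D, hQ, hP⟩ := hK'.coeff_det K h
  have e1 := hK.vp.eq_smul_vol ((τQ.form p).domDomCongr eP) (fun i => K'.SP.sec i p)
  have e2 := hK.vq.eq_smul_vol ((νQ.form p).domDomCongr eQ) (fun i => K'.SQ.sec i p)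
  have e3 := hK.vm.eq_smul_vol (τA.form (pr.base p)) (fun i => K'.SM.sec i (pr.base p))
  have e4 := hK.va.eq_smul_vol (νA.form (pr.base p)) (fun i => K'.SA.sec i (pr.base p))
  rw [Frame.vol_apply, smul_eq_mul] at e1 e2 e3 e4
  have n1 := τQ.reindex_ne hK.vp eP
  have n2 := νQ.reindex_ne hK.vq eQ
  have n3 := τA.sec_ne hK.vm
  have n4 := νA.sec_ne hK.va
  have m1 := left_ne_zero_of_mul (e1 ▸ τQ.reindex_ne hK'.vp eP)
  have m2 := left_ne_zero_of_mul (e2 ▸ νQ.reindex_ne hK'.vq eQ)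
  have m3 := left_ne_zero_of_mul (e3 ▸ τA.sec_ne hK'.vm)
  have m4 := left_ne_zero_of_mul (e4 ▸ νA.sec_ne hK'.va)
  have hD : D ≠ 0 := right_ne_zero_of_mul (hP ▸ m1)
  rw [logRatio, logRatio, e1, e2, e3, e4, Real.log_mul m1 n1, Real.log_mul m2 n2, Real.log_mul m3 n3,
    Real.log_mul m4 n4, hQ, hP, Real.log_mul m3 hD, Real.log_mul m4 hD]
  ring

variable {νA τA νQ τQ}

/-- The modular cocycles of a pull-back Lie algebroid and of `A` differ by the logarithmic derivative of
the ratio of densities. -/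
theorem ValidAt.modForm_eq (h : IsPullback A Q pr) (hK : K.ValidAt p) {θA : A.Z1} {θQ : Q.Z1}
    (hA : ∀ (a : A.Sec) x, lin θA.1 x (a x) = τA.lam (lie (anchorVec a)) x - νA.lam (ad a) x)
    (hQ : ∀ (a : Q.Sec) x, lin θQ.1 x (a x) = τQ.lam (lie (anchorVec a)) x - νQ.lam (ad a) x)
    (q₀ : Q.E p) : lin θQ.1 p q₀ = lin θA.1 (pr.base p) (pr.fib p q₀) +
      VectorBdl.deriv (Q.anchor p q₀) (logRatio νA τA νQ τQ eQ eP K) := by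
  obtain ⟨q', rfl⟩ := exists_sec (A := Q.toVectorBdl) p q₀
  obtain ⟨χ, hχ, f, b, hfb⟩ := pr.exists_expansion q' p
  set q := fsmul χ q' with hqdef
  have hqp : q p = q' p := by
    change χ p • q' p = _
    rw [hχ.self_of_nhds, one_smul]
  rw [← hqp]
  have hdA : ∀ F : A.M → ℝ, ContMDiffAt (𝓡 A.n) 𝓘(ℝ, ℝ) ∞ F (pr.base p) →
      VectorBdl.deriv (Q.anchor p (q p)) (fun y => F (pr.base y)) =
        ∑ i, f i p * VectorBdl.deriv (A.anchor (pr.base p) (b i (pr.base p))) F := by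
    intro F hF
    rw [← deriv_tmap_at (Q := Q.toVectorBdl) (A := A.toVectorBdl) pr.base_smooth _ hF, h.tmap_anchor,
      hfb, map_sum, ← deriv_sum_vec]
    congr 1
    exact Finset.sum_congr rfl fun i _ => map_smul _ _ _
  have s1 := τQ.log_reindex_smooth hK.vp eP
  have s2 := νQ.log_reindex_smooth hK.vq eQ
  have s3 := τA.log_smooth (τA.sec_ne hK.vm)
  have s4 := νA.log_smooth (νA.sec_ne hK.va)
  have hd : VectorBdl.deriv (Q.anchor p (q p)) (logRatio νA τA νQ τQ eQ eP K) = _ :=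
    (deriv_sub_at _ (mdiff_of_contMDiffAt (s1.sub s2)) (mdiff_of_contMDiffAt
      ((s3.comp p (pr.base_smooth p)).sub (s4.comp p (pr.base_smooth p))))).trans
    (congrArg₂ (· - ·) (deriv_sub_at _ (mdiff_of_contMDiffAt s1) (mdiff_of_contMDiffAt s2))
      (deriv_sub_at _ (mdiff_of_contMDiffAt (s3.comp p (pr.base_smooth p)))
        (mdiff_of_contMDiffAt (s4.comp p (pr.base_smooth p)))))
  have hd3 := hdA _ s3
  have hd4 := hdA _ s4
  have ht := hK.trace_sub h q f b hfb
  have hl : lin θA.1 (pr.base p) (pr.fib p (q p)) =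
      ∑ i, f i p * lin θA.1 (pr.base p) (b i (pr.base p)) := by
    rw [hfb, map_sum]
    exact Finset.sum_congr rfl fun i _ => map_smul _ _ _
  have hl2 : ∀ i, lin θA.1 (pr.base p) (b i (pr.base p)) =
      (VectorBdl.deriv (A.anchor (pr.base p) (b i (pr.base p)))
        (fun y => Real.log (τA.form y (fun i => K.SM.sec i y))) -
      VectorBdl.deriv (A.anchor (pr.base p) (b i (pr.base p)))
        (fun y => Real.log (νA.form y (fun i => K.SA.sec i y)))) -
      (((lie (anchorVec (b i))).matrix K.SM (pr.base p)).trace -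
        ((ad (b i)).matrix K.SA (pr.base p)).trace) := by
    intro i
    rw [hA, τA.lam_eq _ hK.vm, νA.lam_eq _ hK.va]
    exact sub_sub_sub_comm _ _ _ _
  have hl3 : lin θQ.1 p (q p) =
      (VectorBdl.deriv (Q.anchor p (q p))
        (fun y => Real.log ((τQ.form y).domDomCongr eP (fun i => K.SP.sec i y))) -
      VectorBdl.deriv (Q.anchor p (q p))
        (fun y => Real.log ((νQ.form y).domDomCongr eQ (fun i => K.SQ.sec i y)))) -
      (((lie (anchorVec q)).matrix K.SP p).trace - ((ad q).matrix K.SQ p).trace) := by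
    rw [hQ, τQ.lam_eq_reindex _ hK.vp eP, νQ.lam_eq_reindex _ hK.vq eQ]
    exact sub_sub_sub_comm _ _ _ _
  rw [hl3, ht, hl, hd]
  simp only [hl2, mul_sub, Finset.sum_sub_distrib] at *
  erw [hd3, hd4]
  ring

end Adapted

/-- The projection of a pull-back Lie algebroid carries the modular class to the modular class. -/
theorem IsPullback.pullH1_mod (h : IsPullback A Q pr)
    (hs : ∀ p, Function.Surjective (mfderiv (𝓡 Q.n) (𝓡 A.n) pr.base p)) :
    pullH1 pr h.chain_zero h.chain_one A.mod = Q.mod := by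
  obtain ⟨νA⟩ := Dens.nonempty (A := A.toVectorBdl) A.r A.E
  obtain ⟨τA⟩ := Dens.nonempty (A := A.toVectorBdl) A.n A.T
  obtain ⟨νQ⟩ := Dens.nonempty (A := Q.toVectorBdl) Q.r Q.E
  obtain ⟨τQ⟩ := Dens.nonempty (A := Q.toVectorBdl) Q.n Q.T
  obtain ⟨θA, hA⟩ := exists_modForm νA τA
  obtain ⟨θQ, hQ⟩ := exists_modForm νQ τQ
  rw [mod_eq hA, mod_eq hQ]
  have hc := h.chain_one
  let θ' : Q.Z1 := ⟨pr.pull 1 θA.1, hc.mem_Z1 θA.2⟩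
  change (Submodule.Quotient.mk θ' : Q.H1) = _
  refine Eq.symm ((mk_eq_iff θQ θ').2 ?_)
  choose K hK using fun p => Adapted.exists_validAt h (hs p)
  rcases isEmpty_or_nonempty Q.M with hE | ⟨⟨p₀⟩⟩
  · exact ⟨ContMDiffMap.const 0, fun x => hE.elim x⟩
  have eQ : Fin Q.r ≃ Fin A.r ⊕ Fin (Q.n - A.n) :=
    Fintype.equivOfCardEq (by rw [Fintype.card_fin]; exact (hK p₀).vq.card.symm)
  have eP : Fin Q.n ≃ Fin A.n ⊕ Fin (Q.n - A.n) :=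
    Fintype.equivOfCardEq (by rw [Fintype.card_fin]; exact (hK p₀).vp.card.symm)
  have hg : ∀ p, ∀ᶠ y in 𝓝 p, Adapted.logRatio νA τA νQ τQ eQ eP (K y) y =
      Adapted.logRatio νA τA νQ τQ eQ eP (K p) y := by
    intro p
    filter_upwards [(hK p).eventually] with y hy
    exact hy.logRatio_eq νA τA νQ τQ eQ eP h (hK y)
  refine ⟨⟨fun p => Adapted.logRatio νA τA νQ τQ eQ eP (K p) p, fun p =>
    ((hK p).logRatio_smooth νA τA νQ τQ eQ eP).congr_of_eventuallyEq (hg p)⟩, fun p v => ?_⟩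
  rw [(hK p).modForm_eq eQ eP h hA hQ v]
  congr 1
  exact (deriv_congr _ (hg p)).symm

end LieAlgebroid
end LieAlgd

/-! ### The Poincaré lemma with parameters -/

namespace LieAlgd
section Calculus
variable {E G : Type} [NormedAddCommGroup E] [NormedSpace ℝ E] [FiniteDimensional ℝ E]
  [NormedAddCommGroup G] [NormedSpace ℝ G] [CompleteSpace G]

/-- Differentiation under the integral sign. -/
theorem hasFDerivAt_integral_param {f : E × ℝ → G} (hf : ContDiff ℝ 1 f) (x : E) :
    HasFDerivAt (fun x => ∫ t in (0 : ℝ)..1, f (x, t))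
      (∫ t in (0 : ℝ)..1, (fderiv ℝ f (x, t)).comp (ContinuousLinearMap.inl ℝ E ℝ)) x := by
  have hd : Continuous (fun p : E × ℝ => (fderiv ℝ f p).comp (ContinuousLinearMap.inl ℝ E ℝ)) :=
    (hf.continuous_fderiv one_ne_zero).clm_comp continuous_const
  have hK : IsCompact (Metric.closedBall x 1 ×ˢ Set.Icc (0 : ℝ) 1) :=
    (isCompact_closedBall x 1).prod isCompact_Icc
  obtain ⟨C, hC⟩ := hK.exists_bound_of_continuousOn hd.continuousOn
  refine intervalIntegral.hasFDerivAt_integral_of_dominated_of_fderiv_le (𝕜 := ℝ)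
    (bound := fun _ => C) (s := Metric.closedBall x 1)
    (F' := fun x t => (fderiv ℝ f (x, t)).comp (ContinuousLinearMap.inl ℝ E ℝ))
    (Metric.closedBall_mem_nhds x one_pos) ?_ ?_ ?_ ?_ ?_ ?_
  · exact Filter.Eventually.of_forall fun y =>
      (hf.continuous.comp (Continuous.prodMk_right y)).aestronglyMeasurable
  · exact (hf.continuous.comp (Continuous.prodMk_right x)).intervalIntegrable _ _
  · exact (hd.comp (Continuous.prodMk_right x)).aestronglyMeasurable
  · refine Filter.Eventually.of_forall fun t ht y hy => hC (y, t) ⟨hy, ?_⟩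
    rw [Set.uIoc_of_le zero_le_one] at ht
    exact ⟨ht.1.le, ht.2⟩
  · exact intervalIntegrable_const
  · refine Filter.Eventually.of_forall fun t ht y hy => ?_
    have h1 := (hf.differentiable one_ne_zero (y, t)).hasFDerivAt
    have h2 : HasFDerivAt (fun y : E => (y, t)) (ContinuousLinearMap.inl ℝ E ℝ) y :=
      hasFDerivAt_prodMk_left y t
    exact h1.comp y h2

theorem contDiff_integral_param_nat (n : ℕ) : ∀ {G : Type} [NormedAddCommGroup G] [NormedSpace ℝ G]
    [CompleteSpace G] {f : E × ℝ → G}, ContDiff ℝ n f →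
      ContDiff ℝ n (fun x => ∫ t in (0 : ℝ)..1, f (x, t)) := by
  induction n with
  | zero =>
    intro G _ _ _ f hf
    rw [Nat.cast_zero, contDiff_zero] at *
    exact intervalIntegral.continuous_parametric_intervalIntegral_of_continuous'
      (f := fun x t => f (x, t)) hf 0 1
  | succ n ih =>
    intro G _ _ _ f hf
    have hf' : ContDiff ℝ ((n : WithTop ℕ∞) + 1) f := by exact_mod_cast hf
    have h1 : ContDiff ℝ 1 f := hf'.of_le le_add_self
    rw [Nat.cast_add, Nat.cast_one, contDiff_succ_iff_hasFDerivAt]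
    refine ⟨_, ih (f := fun p => (fderiv ℝ f p).comp (ContinuousLinearMap.inl ℝ E ℝ)) ?_,
      hasFDerivAt_integral_param h1⟩
    exact (hf'.fderiv_right le_rfl).clm_comp contDiff_const

theorem contDiff_integral_param {f : E × ℝ → G} (hf : ContDiff ℝ ∞ f) :
    ContDiff ℝ ∞ (fun x => ∫ t in (0 : ℝ)..1, f (x, t)) :=
  contDiff_infty.2 fun n => contDiff_integral_param_nat n (contDiff_infty.1 hf n)

variable {d : ℕ}

/-- The Poincaré lemma in the second of two groups of variables, the first being parameters. -/
theorem exists_partial_primitive {f : Fin d → E × (Fin d → ℝ) → ℝ} (hf : ∀ l, ContDiff ℝ ∞ (f l))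
    {c₀ : E × (Fin d → ℝ)} (hclosed : ∀ᶠ c in 𝓝 c₀, ∀ k l,
      fderiv ℝ (f l) c (0, Pi.single k 1) = fderiv ℝ (f k) c (0, Pi.single l 1)) :
    ∃ h : E × (Fin d → ℝ) → ℝ, ContDiff ℝ ∞ h ∧
      ∀ᶠ c in 𝓝 c₀, ∀ l, fderiv ℝ h c (0, Pi.single l 1) = f l c := by
  -- The primitive is radial: `∫₀¹ ∑ l, f l (x, y₀ + t (y - y₀)) (y l - y₀ l) dt`. Closedness turns the
  -- derivative of the integrand in direction `l` into the `t`-derivative of `t * f l (x, y₀ + t (y - y₀))`.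
  let y₀ := c₀.2
  let σ : (E × (Fin d → ℝ)) × ℝ → E × (Fin d → ℝ) := fun q => (q.1.1, y₀ + q.2 • (q.1.2 - y₀))
  have hσ : ContDiff ℝ ∞ σ := by fun_prop
  let g : (E × (Fin d → ℝ)) × ℝ → ℝ := fun q => ∑ l, f l (σ q) * (q.1.2 l - y₀ l)
  have hg : ContDiff ℝ ∞ g := by
    refine ContDiff.sum fun l _ => ((hf l).comp hσ).mul ?_
    fun_prop
  refine ⟨fun c => ∫ t in (0 : ℝ)..1, g (c, t), contDiff_integral_param hg, ?_⟩
  obtain ⟨r, hr, hball⟩ := Metric.eventually_nhds_iff_ball.1 hclosed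
  filter_upwards [Metric.ball_mem_nhds c₀ hr] with c hc l
  have h1 := hasFDerivAt_integral_param (hg.of_le (by simp)) c
  have hint : IntervalIntegrable
      (fun t => (fderiv ℝ g (c, t)).comp (ContinuousLinearMap.inl ℝ (E × (Fin d → ℝ)) ℝ))
      MeasureTheory.volume 0 1 :=
    ((((hg.continuous_fderiv (by simp)).comp (Continuous.prodMk_right c))).clm_comp
      continuous_const).intervalIntegrable _ _
  rw [h1.fderiv, ContinuousLinearMap.intervalIntegral_apply hint]
  have hderiv : ∀ t ∈ Set.uIcc (0 : ℝ) 1, HasDerivAt (fun t => t * f l (σ (c, t)))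
      (((fderiv ℝ g (c, t)).comp (ContinuousLinearMap.inl ℝ (E × (Fin d → ℝ)) ℝ))
        (0, Pi.single l 1)) t := by
    intro t ht
    rw [Set.uIcc_of_le zero_le_one] at ht
    have hmem : σ (c, t) ∈ Metric.ball c₀ r := by
      rw [Metric.mem_ball, Prod.dist_eq, max_lt_iff] at hc ⊢
      refine ⟨hc.1, lt_of_le_of_lt ?_ hc.2⟩
      change dist (y₀ + t • (c.2 - y₀)) y₀ ≤ dist c.2 y₀
      rw [dist_eq_norm, dist_eq_norm, add_sub_cancel_left, norm_smul, Real.norm_of_nonneg ht.1]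
      exact mul_le_of_le_one_left (norm_nonneg _) ht.2
    have hcl := hball _ hmem
    have hfd : ∀ k, HasFDerivAt (f k) (fderiv ℝ (f k) (σ (c, t))) (σ (c, t)) :=
      fun k => ((hf k).differentiable (by simp) _).hasFDerivAt
    -- the derivative of the integrand along the line through `c` in direction `l`
    have hline : HasDerivAt (fun s : ℝ => (c + s • ((0, Pi.single l 1) : E × (Fin d → ℝ)), t))
        ((0, Pi.single l 1), 0) 0 := by
      have h2 : HasDerivAt (fun s : ℝ => c + s • ((0, Pi.single l 1) : E × (Fin d → ℝ)))
          (0, Pi.single l 1) 0 := by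
        simpa using ((hasDerivAt_id (0 : ℝ)).smul_const
          ((0, Pi.single l 1) : E × (Fin d → ℝ))).const_add c
      exact h2.prodMk (hasDerivAt_const 0 t)
    have hσl : HasDerivAt (fun s : ℝ => σ (c + s • ((0, Pi.single l 1) : E × (Fin d → ℝ)), t))
        (0, t • Pi.single l 1) 0 := by
      have e : (fun s : ℝ => σ (c + s • ((0, Pi.single l 1) : E × (Fin d → ℝ)), t)) =
          fun s => (c.1, (y₀ + t • (c.2 - y₀)) + s • t • Pi.single l 1) := by
        funext s
        ext i
        · simp [σ]
        · simp [σ]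
          ring
      rw [e]
      refine (hasDerivAt_const 0 c.1).prodMk ?_
      simpa using ((hasDerivAt_id (0 : ℝ)).smul_const (t • (Pi.single l 1 : Fin d → ℝ))).const_add
        (y₀ + t • (c.2 - y₀))
    have e0 : σ (c + (0 : ℝ) • ((0, Pi.single l 1) : E × (Fin d → ℝ)), t) = σ (c, t) := by
      rw [zero_smul, add_zero]
    have hgl : HasDerivAt
        (fun s : ℝ => g (c + s • ((0, Pi.single l 1) : E × (Fin d → ℝ)), t))
        (∑ k, (fderiv ℝ (f k) (σ (c, t)) (0, t • Pi.single l 1) * (c.2 k - y₀ k) +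
          f k (σ (c, t)) * (Pi.single l 1 : Fin d → ℝ) k)) 0 := by
      refine HasDerivAt.fun_sum fun k _ => ?_
      have h3 : HasDerivAt
          (fun s : ℝ => f k (σ (c + s • ((0, Pi.single l 1) : E × (Fin d → ℝ)), t)))
          (fderiv ℝ (f k) (σ (c, t)) (0, t • Pi.single l 1)) 0 :=
        (hfd k).comp_hasDerivAt_of_eq 0 hσl e0.symm
      have h4 : HasDerivAt (fun s : ℝ => (c.2 k + s * (Pi.single l 1 : Fin d → ℝ) k) - y₀ k)
          ((Pi.single l 1 : Fin d → ℝ) k) 0 := by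
        simpa using (((hasDerivAt_id (0 : ℝ)).mul_const
          ((Pi.single l 1 : Fin d → ℝ) k)).const_add (c.2 k)).sub_const (y₀ k)
      have h5 := h3.mul h4
      simp only [zero_smul, add_zero, zero_mul] at h5
      exact h5
    have hgl2 : HasDerivAt
        (fun s : ℝ => g (c + s • ((0, Pi.single l 1) : E × (Fin d → ℝ)), t))
        (fderiv ℝ g (c, t) ((0, Pi.single l 1), 0)) 0 :=
      (hg.differentiable (by simp) (c, t)).hasFDerivAt.comp_hasDerivAt_of_eq 0 hline (by simp)
    have hval : fderiv ℝ g (c, t) ((0, Pi.single l 1), 0) = _ := hgl2.unique hgl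
    have hσt : HasDerivAt (fun t => σ (c, t)) (0, c.2 - y₀) t := by
      refine (hasDerivAt_const t c.1).prodMk ?_
      simpa using ((hasDerivAt_id t).smul_const (c.2 - y₀)).const_add y₀
    have h6 := (hasDerivAt_id t).mul ((hfd l).comp_hasDerivAt t hσt)
    refine h6.congr_deriv ?_
    change 1 * f l (σ (c, t)) + t * _ = fderiv ℝ g (c, t) ((0, Pi.single l 1), 0)
    rw [hval]
    have e1 : ∀ k, fderiv ℝ (f k) (σ (c, t)) (0, t • Pi.single l 1) =
        t * fderiv ℝ (f l) (σ (c, t)) (0, Pi.single k 1) := by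
      intro k
      rw [hcl k l]
      have : ((0, t • Pi.single l 1) : E × (Fin d → ℝ)) = t • (0, Pi.single l 1) := by simp
      rw [this, map_smul, smul_eq_mul]
    have e2 : ((0, c.2 - y₀) : E × (Fin d → ℝ)) = ∑ k, (c.2 k - y₀ k) • (0, Pi.single k 1) := by
      ext i
      · simp [Prod.fst_sum]
      · simp [Prod.snd_sum, Finset.sum_apply, Pi.single_apply]
    rw [e2, map_sum]
    simp only [map_smul, smul_eq_mul, e1, Finset.sum_add_distrib, Finset.mul_sum]
    have e3 : ∑ k, f k (σ (c, t)) * (Pi.single l 1 : Fin d → ℝ) k = f l (σ (c, t)) := by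
      simp [Pi.single_apply]
    rw [e3, one_mul, add_comm]
    congr 1
    exact Finset.sum_congr rfl fun k _ => by ring
  have hcont : Continuous fun t => ((fderiv ℝ g (c, t)).comp
      (ContinuousLinearMap.inl ℝ (E × (Fin d → ℝ)) ℝ)) (0, Pi.single l 1) :=
    (((hg.continuous_fderiv (by simp)).comp (Continuous.prodMk_right c)).clm_comp
      continuous_const).clm_apply continuous_const
  rw [intervalIntegral.integral_eq_sub_of_hasDerivAt hderiv (hcont.intervalIntegrable _ _)]
  have : σ (c, 1) = c := by
    change (c.1, y₀ + (1 : ℝ) • (c.2 - y₀)) = c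
    rw [one_smul, add_sub_cancel]
  rw [this]
  ring

end Calculus
end LieAlgd

/-! ### Fibred coordinates -/

namespace LieAlgd

/-- A form of the inverse function theorem, with smoothness of the inverse near the image point. -/
theorem exists_smooth_local_inverse {E F : Type*} [NormedAddCommGroup E] [NormedSpace ℝ E]
    [CompleteSpace E] [NormedAddCommGroup F] [NormedSpace ℝ F] {f : E → F} {a : E}
    (hf : ∀ᶠ x in 𝓝 a, ContDiffAt ℝ ∞ f x) {e : E ≃L[ℝ] F} (he : fderiv ℝ f a = e) :
    ∃ g : F → E, g (f a) = a ∧ (∀ᶠ c in 𝓝 (f a), ContDiffAt ℝ ∞ g c ∧ f (g c) = c) ∧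
      ∀ᶠ x in 𝓝 a, g (f x) = x := by
  have hfa : ContDiffAt ℝ ∞ f a := hf.self_of_nhds
  have h1 : HasFDerivAt f (e : E →L[ℝ] F) a := he ▸ (hfa.differentiableAt (by simp)).hasFDerivAt
  let Φ := hfa.toOpenPartialHomeomorph f h1 (by simp)
  have hΦ : (Φ : E → F) = f := hfa.toOpenPartialHomeomorph_coe h1 (by simp)
  have ha : a ∈ Φ.source := hfa.mem_toOpenPartialHomeomorph_source h1 (by simp)
  have hfat : f a ∈ Φ.target := by
    rw [← hΦ]
    exact Φ.map_source ha
  have hga : Φ.symm (f a) = a := by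
    rw [← hΦ]
    exact Φ.left_inv ha
  have h2 : ∀ᶠ x in 𝓝 a, fderiv ℝ f x ∈ Set.range ((↑) : (E ≃L[ℝ] F) → E →L[ℝ] F) := by
    have hc : ContinuousAt (fderiv ℝ f) a :=
      (hfa.fderiv_right (m := 0) (by simp)).continuousAt
    refine hc.eventually ?_
    rw [he]
    exact ContinuousLinearEquiv.nhds e
  have h3 : Filter.Tendsto Φ.symm (𝓝 (f a)) (𝓝 a) := by
    have h := Φ.symm.continuousAt (x := f a) hfat
    rwa [ContinuousAt, hga] at h
  refine ⟨Φ.symm, hga, ?_, ?_⟩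
  · filter_upwards [h3.eventually (h2.and hf), Φ.open_target.mem_nhds hfat] with c hc hct
    obtain ⟨⟨e', he'⟩, hcf⟩ := hc
    refine ⟨Φ.contDiffAt_symm (f₀' := e') hct ?_ (by rw [hΦ]; exact hcf), ?_⟩
    · rw [hΦ, he']
      exact (hcf.differentiableAt (by simp)).hasFDerivAt
    · rw [← hΦ]
      exact Φ.right_inv hct
  · filter_upwards [Φ.open_source.mem_nhds ha] with x hx
    rw [← hΦ]
    exact Φ.left_inv hx

namespace VectorBdl
variable {A Q : VectorBdl.{u}}

/-- A smooth map to a vector space whose differential at a point is bijective has a smooth inverse near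
that point. -/
theorem exists_local_inverse {E : Type*} [NormedAddCommGroup E] [NormedSpace ℝ E]
    [FiniteDimensional ℝ E] {ψ : A.M → E} (hψ : ContMDiff (𝓡 A.n) 𝓘(ℝ, E) ∞ ψ) {p : A.M}
    (hb : Function.Bijective (mfderiv (𝓡 A.n) 𝓘(ℝ, E) ψ p)) :
    ∃ s : E → A.M, s (ψ p) = p ∧
      (∀ᶠ c in 𝓝 (ψ p), ContMDiffAt 𝓘(ℝ, E) (𝓡 A.n) ∞ s c ∧ ψ (s c) = c) ∧
      ∀ᶠ x in 𝓝 p, s (ψ x) = x := by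
  let k := extChartAt (𝓡 A.n) p
  let f : EuclideanSpace ℝ (Fin A.n) → E := ψ ∘ k.symm
  have hkt : IsOpen k.target := isOpen_extChartAt_target p
  have hpt : k p ∈ k.target := mem_extChartAt_target p
  have hkp : k.symm (k p) = p := extChartAt_to_inv p
  have hfp : f (k p) = ψ p := congrArg ψ hkp
  have hks : ∀ x ∈ k.target, ContMDiffAt 𝓘(ℝ, EuclideanSpace ℝ (Fin A.n)) (𝓡 A.n) ∞ k.symm x :=
    fun x hx => (contMDiffOn_extChartAt_symm (I := 𝓡 A.n) (n := ∞) p).contMDiffAt (hkt.mem_nhds hx)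
  have hf : ∀ᶠ x in 𝓝 (k p), ContDiffAt ℝ ∞ f x := by
    filter_upwards [hkt.mem_nhds hpt] with x hx
    exact (hψ.contMDiffAt.comp x (hks x hx)).contDiffAt
  have hd : fderiv ℝ f (k p) = mfderiv (𝓡 A.n) 𝓘(ℝ, E) ψ p := by
    refine Eq.trans ?_ (hψ.mdifferentiableAt (by simp)).mfderiv.symm
    simp only [writtenInExtChartAt, f, k, mfld_simps, fderivWithin_univ, modelWithCornersSelf_coe,
      Set.range_id]
    rfl
  let e : EuclideanSpace ℝ (Fin A.n) ≃L[ℝ] E :=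
    (LinearEquiv.ofBijective (fderiv ℝ f (k p)).toLinearMap (by rw [hd]; exact hb)).toContinuousLinearEquiv
  obtain ⟨g, hga, hg, hgf⟩ := exists_smooth_local_inverse (e := e) hf (by ext; rfl)
  rw [hfp] at hga hg
  have hgc : ContinuousAt g (ψ p) := hg.self_of_nhds.1.continuousAt
  refine ⟨fun c => k.symm (g c), by simp only [hga, hkp], ?_, ?_⟩
  · filter_upwards [hg, hgc.preimage_mem_nhds (by rw [hga]; exact hkt.mem_nhds hpt)] with c hc hct
    exact ⟨(hks _ hct).comp c hc.1.contMDiffAt, hc.2⟩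
  · have h1 : ∀ᶠ x in 𝓝 p, x ∈ k.source := extChartAt_source_mem_nhds p
    filter_upwards [h1, (continuousAt_extChartAt (I := 𝓡 A.n) p).eventually hgf] with x hx hgx
    have h2 : k.symm (k x) = x := k.left_inv hx
    have h3 : f (k x) = ψ x := congrArg ψ h2
    change g (f (k x)) = k x at hgx
    rw [← h3, hgx, h2]

/-- Coordinates adapted to a submersion `φ` near a point `p`: coordinates `z` of the target near `φ p`
and functions `y` such that `(z ∘ φ, y)` has the inverse `inv`, while `invBase` is the inverse of `z`. All of
them are globally defined; the inverse properties are required only near `p`, by `ValidAt`. -/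
structure FibredChart (φ : Q.M → A.M) (d : ℕ) where
  z : Fin A.n → A.Fun
  y : Fin d → Q.Fun
  invBase : (Fin A.n → ℝ) → A.M
  inv : (Fin A.n → ℝ) × (Fin d → ℝ) → Q.M

namespace FibredChart
variable {φ : Q.M → A.M} {d : ℕ} (K : FibredChart φ d)

/-- The coordinates of the target. -/
def zmap (x : A.M) : Fin A.n → ℝ := fun i => K.z i x

/-- The vertical coordinates. -/
def ymap (q : Q.M) : Fin d → ℝ := fun l => K.y l q

/-- The coordinates. -/
def map (q : Q.M) : (Fin A.n → ℝ) × (Fin d → ℝ) := (K.zmap (φ q), K.ymap q)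

/-- The coordinates are valid near `p`. -/
structure ValidAt (p : Q.M) : Prop where
  invBase_eq : ∀ᶠ x in 𝓝 (φ p), K.invBase (K.zmap x) = x
  inv_eq : ∀ᶠ q in 𝓝 p, K.inv (K.map q) = q
  map_eq : ∀ᶠ c in 𝓝 (K.map p), K.map (K.inv c) = c
  smooth : ∀ᶠ c in 𝓝 (K.map p), ContMDiffAt 𝓘(ℝ, (Fin A.n → ℝ) × (Fin d → ℝ)) (𝓡 Q.n) ∞ K.inv c

theorem contMDiff_zmap : ContMDiff (𝓡 A.n) 𝓘(ℝ, Fin A.n → ℝ) ∞ K.zmap :=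
  contMDiff_pi_space.2 fun i => (K.z i).contMDiff

theorem contMDiff_ymap : ContMDiff (𝓡 Q.n) 𝓘(ℝ, Fin d → ℝ) ∞ K.ymap :=
  contMDiff_pi_space.2 fun i => (K.y i).contMDiff

theorem contMDiff_map (hφ : ContMDiff (𝓡 Q.n) (𝓡 A.n) ∞ φ) :
    ContMDiff (𝓡 Q.n) 𝓘(ℝ, (Fin A.n → ℝ) × (Fin d → ℝ)) ∞ K.map :=
  (K.contMDiff_zmap.comp hφ).prodMk_space K.contMDiff_ymap

end FibredChart

theorem clm_mfderiv {E : Type*} [NormedAddCommGroup E] [NormedSpace ℝ E] (L : E →L[ℝ] ℝ) {f : A.M → E}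
    (hf : ContMDiff (𝓡 A.n) 𝓘(ℝ, E) ∞ f) (x : A.M) (w : A.T x) :
    L (mfderiv (𝓡 A.n) 𝓘(ℝ, E) f x w) = deriv w (fun y => L (f y)) := by
  have h := mfderiv_comp x (I' := 𝓘(ℝ, E)) (I'' := 𝓘(ℝ, ℝ)) (g := L)
    L.differentiableAt.mdifferentiableAt (hf.mdifferentiableAt (x := x) (by simp))
  refine Eq.trans ?_ (DFunLike.congr_fun h w).symm
  rw [mfderiv_eq_fderiv, L.fderiv]
  rfl

/-- Coordinates near a point can be chosen among globally defined smooth functions. -/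
theorem exists_base_coords (x : A.M) : ∃ z : Fin A.n → A.Fun,
    Function.Bijective (fun w : A.T x => fun i => deriv w (z i)) := by
  have hfd : FiniteDimensional ℝ (A.T x) := (finrank_fibre (m := A.n) (V := A.T) x).1
  have e : A.T x ≃ₗ[ℝ] (Fin A.n → ℝ) :=
    LinearEquiv.ofFinrankEq _ _ (by
      rw [Module.finrank_fin_fun, (finrank_fibre (m := A.n) (V := A.T) x).2])
  choose z hz using fun i => exists_fun_deriv_eq ((LinearMap.proj i).comp e.toLinearMap)
  refine ⟨z, ?_⟩
  have h : (fun w : A.T x => fun i => deriv w (z i)) = e := funext fun w => funext fun i => hz i w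
  rw [h]
  exact e.bijective

/-- Fibred charts exist at every point where the differential of `φ` is onto; both inverses come from the
inverse function theorem. -/
theorem exists_fibredChart {φ : Q.M → A.M} (hφ : ContMDiff (𝓡 Q.n) (𝓡 A.n) ∞ φ) {p : Q.M}
    (hs : Function.Surjective (tmap φ p)) :
    ∃ K : FibredChart φ (Q.n - A.n), K.ValidAt p ∧
      Function.Bijective (fun w : Q.T p => (tmap φ p w, fun l => deriv w (K.y l))) := by
  obtain ⟨z, hz⟩ := exists_base_coords (φ p)
  obtain ⟨y, hy⟩ := exists_vertical_coords hs
  let K₀ : FibredChart φ (Q.n - A.n) := ⟨z, y, fun _ => φ p, fun _ => p⟩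
  have hzi : ∀ (i : Fin A.n) (u : A.T (φ p)),
      (show Fin A.n → ℝ from mfderiv (𝓡 A.n) 𝓘(ℝ, Fin A.n → ℝ) K₀.zmap (φ p) u) i = deriv u (z i) :=
    fun i u => clm_mfderiv (ContinuousLinearMap.proj i) K₀.contMDiff_zmap (φ p) u
  have hqi : ∀ (i : Fin A.n) (w : Q.T p), (show (Fin A.n → ℝ) × (Fin (Q.n - A.n) → ℝ) from
      mfderiv (𝓡 Q.n) 𝓘(ℝ, (Fin A.n → ℝ) × (Fin (Q.n - A.n) → ℝ)) K₀.map p w).1 i =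
        deriv (tmap φ p w) (z i) := fun i w =>
    (clm_mfderiv ((ContinuousLinearMap.proj i).comp (ContinuousLinearMap.fst ℝ _ _))
      (K₀.contMDiff_map hφ) p w).trans (deriv_tmap hφ w (z i).contMDiff).symm
  have hql : ∀ (l : Fin (Q.n - A.n)) (w : Q.T p), (show (Fin A.n → ℝ) × (Fin (Q.n - A.n) → ℝ) from
      mfderiv (𝓡 Q.n) 𝓘(ℝ, (Fin A.n → ℝ) × (Fin (Q.n - A.n) → ℝ)) K₀.map p w).2 l =
        deriv w (y l) := fun l w =>
    clm_mfderiv ((ContinuousLinearMap.proj l).comp (ContinuousLinearMap.snd ℝ _ _))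
      (K₀.contMDiff_map hφ) p w
  obtain ⟨sA, -, -, hA⟩ := exists_local_inverse (p := φ p) K₀.contMDiff_zmap (by
    have h : (fun u => mfderiv (𝓡 A.n) 𝓘(ℝ, Fin A.n → ℝ) K₀.zmap (φ p) u) =
        (fun u : A.T (φ p) => fun i => deriv u (z i)) :=
      funext fun u => funext fun i => hzi i u
    exact (congrArg (fun F : A.T (φ p) → Fin A.n → ℝ => Function.Bijective F) h).mpr hz)
  obtain ⟨s, -, hs1, hs2⟩ := exists_local_inverse (p := p) (K₀.contMDiff_map hφ) (by
    refine ⟨fun w w' h => hy.1 (Prod.ext (hz.1 (funext fun i => ?_)) (funext fun l => ?_)),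
      fun c => ?_⟩
    · exact (hqi i w).symm.trans ((congrArg (fun c => c.1 i) h).trans (hqi i w'))
    · exact (hql l w).symm.trans ((congrArg (fun c => c.2 l) h).trans (hql l w'))
    · obtain ⟨u, hu⟩ := hz.2 c.1
      obtain ⟨w, hw⟩ := hy.2 (u, c.2)
      rw [Prod.mk.injEq] at hw
      refine ⟨w, Prod.ext (funext fun i => ?_) (funext fun l => ?_)⟩
      · refine (hqi i w).trans ?_
        rw [hw.1]
        exact congrFun hu i
      · exact (hql l w).trans (congrFun hw.2 l))
  exact ⟨⟨z, y, sA, s⟩, ⟨hA, hs2, hs1.mono fun _ h => h.2, hs1.mono fun _ h => h.1⟩, hy⟩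

end VectorBdl
end LieAlgd

/-! ### Functions along the fibres of a submersion -/

namespace LieAlgd
namespace VectorBdl
variable {A Q : VectorBdl.{u}} {φ : Q.M → A.M}

theorem FibredChart.ValidAt.inv_map {d : ℕ} {K : FibredChart φ d} {p : Q.M} (h : K.ValidAt p) :
    K.inv (K.map p) = p := h.inv_eq.self_of_nhds

theorem FibredChart.ValidAt.continuousAt {d : ℕ} {K : FibredChart φ d} {p : Q.M} (h : K.ValidAt p) :
    ContinuousAt K.inv (K.map p) := h.smooth.self_of_nhds.continuousAt

theorem FibredChart.ValidAt.tendsto {d : ℕ} {K : FibredChart φ d} {p : Q.M} (h : K.ValidAt p) :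
    Filter.Tendsto K.inv (𝓝 (K.map p)) (𝓝 p) := by
  have := h.continuousAt
  rwa [ContinuousAt, h.inv_map] at this

/-- In fibred coordinates the submersion is the first projection. -/
theorem FibredChart.ValidAt.proj_inv (hφ : Continuous φ) {d : ℕ} {K : FibredChart φ d} {p : Q.M}
    (h : K.ValidAt p) : ∀ᶠ c in 𝓝 (K.map p), φ (K.inv c) = K.invBase c.1 := by
  have h1 := h.tendsto.eventually (hφ.continuousAt.eventually h.invBase_eq)
  filter_upwards [h1, h.map_eq] with c hc hm
  rw [← hc]
  exact congrArg (fun c => K.invBase c.1) hm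

/-- A submersion has local sections through every point. -/
theorem exists_local_section (hφ : ContMDiff (𝓡 Q.n) (𝓡 A.n) ∞ φ) {p : Q.M}
    (hs : Function.Surjective (tmap φ p)) : ∃ σ : A.M → Q.M, σ (φ p) = p ∧
      ∀ᶠ x in 𝓝 (φ p), ContMDiffAt (𝓡 A.n) (𝓡 Q.n) ∞ σ x ∧ φ (σ x) = x := by
  obtain ⟨K, hK, -⟩ := exists_fibredChart hφ hs
  have hc : ContMDiff (𝓡 A.n) 𝓘(ℝ, (Fin A.n → ℝ) × (Fin (Q.n - A.n) → ℝ)) ∞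
      (fun x => (K.zmap x, K.ymap p)) := K.contMDiff_zmap.prodMk_space contMDiff_const
  refine ⟨fun x => K.inv (K.zmap x, K.ymap p), hK.inv_map, ?_⟩
  have h1 := (hc.continuous.continuousAt (x := φ p)).eventually
    (hK.smooth.and (hK.proj_inv hφ.continuous))
  filter_upwards [h1, hK.invBase_eq] with x hx hxb
  exact ⟨hx.1.comp x hc.contMDiffAt, hx.2.trans hxb⟩

/-- Every point has small neighbourhoods in which points of the same fibre are joined by smooth curves in
the fibre. -/
theorem exists_box (hφ : ContMDiff (𝓡 Q.n) (𝓡 A.n) ∞ φ) {p : Q.M}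
    (hs : Function.Surjective (tmap φ p)) {N : Set Q.M} (hN : N ∈ 𝓝 p) :
    ∃ U ∈ 𝓝 p, U ⊆ N ∧ ∀ q ∈ U, ∀ q' ∈ U, φ q = φ q' → ∃ γ : ℝ → Q.M, γ 0 = q ∧ γ 1 = q' ∧
      ∀ t ∈ Set.Icc (0 : ℝ) 1, ContMDiffAt 𝓘(ℝ, ℝ) (𝓡 Q.n) ∞ γ t ∧
        ∀ᶠ t' in 𝓝 t, γ t' ∈ U ∧ φ (γ t') = φ q := by
  obtain ⟨K, hK, -⟩ := exists_fibredChart hφ hs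
  obtain ⟨ε, hε, hb⟩ := Metric.eventually_nhds_iff_ball.1
    (((hK.map_eq.and hK.smooth).and (hK.proj_inv hφ.continuous)).and (hK.tendsto.eventually hN))
  refine ⟨{q | K.map q ∈ Metric.ball (K.map p) ε ∧ K.inv (K.map q) = q}, ?_, ?_, ?_⟩
  · exact ((K.contMDiff_map hφ).continuous.continuousAt.eventually
      (Metric.ball_mem_nhds _ hε)).and hK.inv_eq
  · rintro q ⟨hq, hq'⟩
    rw [← hq']
    exact (hb _ hq).2
  · rintro q ⟨hq, hqi⟩ q' ⟨hq', hqi'⟩ hqq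
    let c : ℝ → (Fin A.n → ℝ) × (Fin (Q.n - A.n) → ℝ) := fun t => K.map q + t • (K.map q' - K.map q)
    have hc0 : c 0 = K.map q := by simp [c]
    have hc1 : c 1 = K.map q' := by simp [c]
    have hfst : ∀ t, (c t).1 = K.zmap (φ q) := by
      intro t
      simp [c, FibredChart.map, hqq]
    have hcd : ContDiff ℝ ∞ c := contDiff_const.add (contDiff_id.smul contDiff_const)
    have hcb : ∀ t ∈ Set.Icc (0 : ℝ) 1, c t ∈ Metric.ball (K.map p) ε := fun t ht =>
      (convex_ball (K.map p) ε).add_smul_sub_mem hq hq' ht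
    refine ⟨fun t => K.inv (c t), by simp only [hc0, hqi], by simp only [hc1, hqi'],
      fun t ht => ⟨?_, ?_⟩⟩
    · exact (hb _ (hcb t ht)).1.1.2.comp t hcd.contMDiff.contMDiffAt
    · have h1 : ∀ᶠ t' in 𝓝 t, c t' ∈ Metric.ball (K.map p) ε :=
        hcd.continuous.continuousAt.eventually (Metric.isOpen_ball.mem_nhds (hcb t ht))
      filter_upwards [h1] with t' ht'
      have h2 := (hb _ ht').1.1.1
      refine ⟨⟨?_, ?_⟩, ?_⟩
      · rwa [h2]
      · rw [h2]
      · rw [(hb _ ht').1.2, hfst, ← hfst 0, hc0, ← (hb _ hq).1.2, hqi]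

/-- The velocity of a curve. -/
theorem exists_velocity {γ : ℝ → Q.M} {t : ℝ} (hγ : ContMDiffAt 𝓘(ℝ, ℝ) (𝓡 Q.n) ∞ γ t) :
    ∃ w : Q.T (γ t), ∀ u : Q.M → ℝ, ContMDiffAt (𝓡 Q.n) 𝓘(ℝ, ℝ) ∞ u (γ t) →
      HasDerivAt (fun t' => u (γ t')) (deriv w u) t := by
  refine ⟨mfderiv 𝓘(ℝ, ℝ) (𝓡 Q.n) γ t (1 : ℝ), fun u hu => ?_⟩
  have h := mfderiv_comp t (hu.mdifferentiableAt (by simp)) (hγ.mdifferentiableAt (by simp))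
  have h1 : DifferentiableAt ℝ (fun t' => u (γ t')) t :=
    ((hu.comp t hγ).mdifferentiableAt (by simp)).differentiableAt
  have h2 := h1.hasDerivAt
  have h3 : _root_.deriv (fun t' => u (γ t')) t =
      deriv (mfderiv 𝓘(ℝ, ℝ) (𝓡 Q.n) γ t (1 : ℝ)) u := by
    refine Eq.trans ?_ (DFunLike.congr_fun h (1 : ℝ))
    rw [mfderiv_eq_fderiv]
    exact fderiv_apply_one_eq_deriv.symm
  rwa [h3] at h2

/-- A function is constant along the fibres of `φ` near `p`: on a neighbourhood of `p` it has equal values at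
points of the same fibre. -/
def LocConstOnFibres (φ : Q.M → A.M) {R : Type*} (u : Q.M → R) (p : Q.M) : Prop :=
  ∃ U ∈ 𝓝 p, ∀ q ∈ U, ∀ q' ∈ U, φ q = φ q' → u q = u q'

/-- If the derivatives along all smooth curves in the fibres vanish, the function is constant along the
fibres, since near `p` two points of a fibre are joined by a smooth curve in it. No smoothness of `u` is assumed. -/
theorem locConstOnFibres_of_hasDerivAt (hφ : ContMDiff (𝓡 Q.n) (𝓡 A.n) ∞ φ) {p : Q.M}
    (hs : Function.Surjective (tmap φ p)) {u : Q.M → ℝ}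
    (h : ∀ᶠ x in 𝓝 p, ∀ (γ : ℝ → Q.M) (t : ℝ), γ t = x → ContMDiffAt 𝓘(ℝ, ℝ) (𝓡 Q.n) ∞ γ t →
      (∀ᶠ t' in 𝓝 t, φ (γ t') = φ x) → HasDerivAt (fun t' => u (γ t')) 0 t) :
    LocConstOnFibres φ u p := by
  obtain ⟨U, hU, hUN, hb⟩ := exists_box hφ hs h
  refine ⟨U, hU, fun q hq q' hq' hqq => ?_⟩
  obtain ⟨γ, h0, h1, hγ⟩ := hb q hq q' hq' hqq
  have hd : ∀ t ∈ Set.Icc (0 : ℝ) 1, HasDerivAt (fun t' => u (γ t')) 0 t := by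
    intro t ht
    obtain ⟨hs, he⟩ := hγ t ht
    refine hUN he.self_of_nhds.1 γ t rfl hs (he.mono fun t' ht' => ?_)
    rw [ht'.2, he.self_of_nhds.2]
  have h2 := constant_of_has_deriv_right_zero (f := fun t' => u (γ t')) (a := 0) (b := 1)
    (fun t ht => (hd t ht).continuousAt.continuousWithinAt)
    (fun t ht => (hd t ⟨ht.1, ht.2.le⟩).hasDerivWithinAt) 1 (by simp)
  simpa only [h0, h1] using h2.symm

/-- A smooth function without vertical derivatives is locally constant along the fibres. -/
theorem locConstOnFibres_of_deriv (hφ : ContMDiff (𝓡 Q.n) (𝓡 A.n) ∞ φ) {p : Q.M}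
    (hs : Function.Surjective (tmap φ p)) {u : Q.M → ℝ}
    (hu : ∀ᶠ q in 𝓝 p, ContMDiffAt (𝓡 Q.n) 𝓘(ℝ, ℝ) ∞ u q)
    (h : ∀ᶠ q in 𝓝 p, ∀ w, tmap φ q w = 0 → deriv w u = 0) : LocConstOnFibres φ u p := by
  refine locConstOnFibres_of_hasDerivAt hφ hs ?_
  filter_upwards [hu, h] with x hux hx γ t hγx hγ hγφ
  subst hγx
  obtain ⟨w, hw⟩ := exists_velocity hγ
  have h2 : tmap φ (γ t) w = 0 := by
    refine eq_of_deriv_eq fun f => ?_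
    rw [deriv_tmap hφ _ f.contMDiff]
    have h3 := (hw _ (f.contMDiff.comp hφ).contMDiffAt).congr_of_eventuallyEq
      (f₁ := fun _ => f (φ (γ t))) (hγφ.mono fun t' ht' => by simp [ht'])
    refine (h3.unique (hasDerivAt_const _ _)).trans ?_
    exact (map_zero (diff f (φ (γ t)))).symm
  have h3 := hw u hux
  rwa [hx w h2] at h3

/-- Local constancy on the single fibres is locally uniform. -/
theorem locConstOnFibres_of_eventually (hφ : ContMDiff (𝓡 Q.n) (𝓡 A.n) ∞ φ) {p : Q.M}
    (hs : Function.Surjective (tmap φ p)) {u : Q.M → ℝ}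
    (h : ∀ᶠ x in 𝓝 p, ∀ᶠ y in 𝓝 x, φ y = φ x → u y = u x) : LocConstOnFibres φ u p := by
  refine locConstOnFibres_of_hasDerivAt hφ hs ?_
  filter_upwards [h] with x hx γ t hγx hγ hγφ
  subst hγx
  refine (hasDerivAt_const t (u (γ t))).congr_of_eventuallyEq ?_
  filter_upwards [hγφ, hγ.continuousAt.eventually hx] with t' h1 h2
  exact h2 h1

/-- A function which is locally constant along the fibres has no vertical derivatives. -/
theorem LocConstOnFibres.deriv_eq_zero (hφ : ContMDiff (𝓡 Q.n) (𝓡 A.n) ∞ φ) {p : Q.M}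
    (hs : Function.Surjective (tmap φ p)) {u : Q.M → ℝ} (hu : ContMDiffAt (𝓡 Q.n) 𝓘(ℝ, ℝ) ∞ u p)
    (h : LocConstOnFibres φ u p) {w : Q.T p} (hw : tmap φ p w = 0) : deriv w u = 0 := by
  obtain ⟨U, hU, hc⟩ := h
  obtain ⟨σ, h1, h2⟩ := exists_local_section hφ hs
  have hσ := h2.self_of_nhds.1
  have h3 : ∀ᶠ y in 𝓝 p, u y = u (σ (φ y)) := by
    have h4 : ∀ᶠ y in 𝓝 p, σ (φ y) ∈ U :=
      ((hσ.continuousAt.comp hφ.continuous.continuousAt).eventually (by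
        rw [Function.comp_apply, h1]
        exact hU))
    filter_upwards [hU, h4, hφ.continuous.continuousAt.eventually h2] with y hy hy' hyφ
    exact hc _ hy _ hy' hyφ.2.symm
  have h5 : ContMDiffAt (𝓡 A.n) 𝓘(ℝ, ℝ) ∞ (fun x => u (σ x)) (φ p) := by
    refine ContMDiffAt.comp (φ p) ?_ hσ
    rwa [h1]
  rw [deriv_congr _ h3, ← deriv_tmap_at hφ w h5, hw]
  exact map_zero (diff (fun x => u (σ x)) (φ p))

/-- The fibres of a submersion are locally path connected, as covering space theory requires. -/
theorem locallyPathConnectedSpace_fibre (hφ : ContMDiff (𝓡 Q.n) (𝓡 A.n) ∞ φ)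
    (hs : ∀ p, Function.Surjective (tmap φ p)) (x : A.M) :
    LocallyPathConnectedSpace {p // φ p = x} := by
  refine ⟨fun p => Filter.hasBasis_self.2 fun N hN => ?_⟩
  obtain ⟨N', hN', hNN⟩ := mem_nhds_subtype _ _ _ |>.1 hN
  obtain ⟨U, hU, hUN, hb⟩ := exists_box hφ (hs p.1) hN'
  refine ⟨Subtype.val ⁻¹' U, continuous_subtype_val.continuousAt.preimage_mem_nhds hU, ?_,
    fun q hq => hNN (hUN hq)⟩
  have hpU : p.1 ∈ U := mem_of_mem_nhds hU
  refine ⟨p, hpU, fun {q} hq => ?_⟩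
  obtain ⟨γ, h0, h1, hγ⟩ := hb p.1 hpU q.1 hq (p.2.trans q.2.symm)
  have hx : ∀ t : unitInterval, φ (γ t) = x := fun t => (hγ t t.2).2.self_of_nhds.2.trans p.2
  refine ⟨⟨⟨fun t => ⟨γ t, hx t⟩, ?_⟩, ?_, ?_⟩, fun t => (hγ t t.2).2.self_of_nhds.1⟩
  · refine Continuous.subtype_mk (continuous_iff_continuousAt.2 fun t => ?_) _
    exact (hγ t t.2).1.continuousAt.comp continuous_subtype_val.continuousAt
  · exact Subtype.ext h0
  · exact Subtype.ext h1

/-- A function which is locally constant on connected fibres is constant on them. -/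
theorem const_on_fibres {R : Type*} {u : Q.M → R} {x : A.M}
    [PreconnectedSpace {p // φ p = x}] (h : ∀ p, φ p = x → LocConstOnFibres φ u p) {p p' : Q.M}
    (hp : φ p = x) (hp' : φ p' = x) : u p = u p' := by
  have h1 : IsLocallyConstant (fun q : {p // φ p = x} => u q.1) := by
    refine (IsLocallyConstant.iff_eventually_eq _).2 fun q => ?_
    obtain ⟨U, hU, hc⟩ := h q.1 q.2
    filter_upwards [continuous_subtype_val.continuousAt.preimage_mem_nhds hU] with q' hq'
    exact hc _ hq' _ (mem_of_mem_nhds hU) (q'.2.trans q.2.symm)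
  exact h1.apply_eq_of_preconnectedSpace ⟨p, hp⟩ ⟨p', hp'⟩

/-- A smooth function which is constant on the fibres of a surjective submersion is a smooth function on
the target. -/
theorem exists_descent (hφ : ContMDiff (𝓡 Q.n) (𝓡 A.n) ∞ φ) (hsurj : Function.Surjective φ)
    (hs : ∀ p, Function.Surjective (tmap φ p)) {u : Q.M → ℝ}
    (hu : ContMDiff (𝓡 Q.n) 𝓘(ℝ, ℝ) ∞ u) (hc : ∀ p p', φ p = φ p' → u p = u p') :
    ∃ f : A.Fun, ∀ p, u p = f (φ p) := by
  choose r hr using hsurj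
  refine ⟨⟨fun x => u (r x), fun x => ?_⟩, fun p => hc _ _ (hr _).symm⟩
  obtain ⟨σ, h1, h2⟩ := exists_local_section hφ (hs (r x))
  rw [hr x] at h1 h2
  have h3 : (fun y => u (r y)) =ᶠ[𝓝 x] fun y => u (σ y) :=
    h2.mono fun y hy => hc _ _ ((hr y).trans hy.2.symm)
  exact (hu.contMDiffAt.comp x h2.self_of_nhds.1).congr_of_eventuallyEq h3

end VectorBdl
end LieAlgd

/-! ### The Poincaré lemma along the fibres -/

namespace LieAlgd

/-- A function which is smooth near a point agrees near that point with a smooth function. -/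
theorem exists_contDiff_eventuallyEq {E : Type*} [NormedAddCommGroup E] [NormedSpace ℝ E]
    [FiniteDimensional ℝ E] {c₀ : E} {f : E → ℝ} (hf : ∀ᶠ c in 𝓝 c₀, ContDiffAt ℝ ∞ f c) :
    ∃ g : E → ℝ, ContDiff ℝ ∞ g ∧ g =ᶠ[𝓝 c₀] f := by
  obtain ⟨ε, hε, hb⟩ := Metric.eventually_nhds_iff_ball.1 hf
  let χ : ContDiffBump c₀ := ⟨ε / 4, ε / 2, by positivity, by linarith⟩
  refine ⟨fun c => χ c * f c, contDiff_iff_contDiffAt.2 fun c => ?_, ?_⟩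
  · by_cases hc : c ∈ Metric.ball c₀ ε
    · exact χ.contDiffAt.mul (hb c hc)
    · have h1 : ∀ᶠ c' in 𝓝 c, χ c' * f c' = 0 := by
        have h2 : c ∉ tsupport χ := by
          rw [χ.tsupport_eq]
          intro h
          refine hc (Metric.closedBall_subset_ball ?_ h)
          change ε / 2 < ε
          linarith
        filter_upwards [(isClosed_tsupport (χ : E → ℝ)).isOpen_compl.mem_nhds h2] with c' hc'
        rw [image_eq_zero_of_notMem_tsupport hc', zero_mul]
      exact (contDiffAt_const (c := (0 : ℝ))).congr_of_eventuallyEq h1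
  · filter_upwards [χ.eventuallyEq_one] with c hc
    rw [hc]
    exact one_mul _

namespace VectorBdl
variable {A Q : VectorBdl.{u}} {φ : Q.M → A.M}

theorem deriv_comp_vec {E : Type*} [NormedAddCommGroup E] [NormedSpace ℝ E] {f : Q.M → E}
    (hf : ContMDiff (𝓡 Q.n) 𝓘(ℝ, E) ∞ f) {g : E → ℝ} (hg : ContDiff ℝ ∞ g) {x : Q.M} (w : Q.T x) :
    deriv w (fun y => g (f y)) = fderiv ℝ g (f x) (mfderiv (𝓡 Q.n) 𝓘(ℝ, E) f x w) := by
  have h := mfderiv_comp x (hg.contMDiff.mdifferentiableAt (x := f x) (by simp))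
    (hf.mdifferentiableAt (x := x) (by simp))
  refine (DFunLike.congr_fun h w).trans ?_
  rw [mfderiv_eq_fderiv]
  rfl

/-- The differential of fibred coordinates on a vertical vector. -/
theorem FibredChart.mfderiv_map_vertical (hφ : ContMDiff (𝓡 Q.n) (𝓡 A.n) ∞ φ) {d : ℕ}
    (C : FibredChart φ d) {x : Q.M} {w : Q.T x} (hw : tmap φ x w = 0) :
    mfderiv (𝓡 Q.n) 𝓘(ℝ, (Fin A.n → ℝ) × (Fin d → ℝ)) C.map x w =
      ((0 : Fin A.n → ℝ), fun l => deriv w (C.y l)) := by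
  refine Prod.ext (funext fun i => ?_) (funext fun l => ?_)
  · refine (clm_mfderiv ((ContinuousLinearMap.proj i).comp (ContinuousLinearMap.fst ℝ _ _))
      (C.contMDiff_map hφ) x w).trans ?_
    refine (deriv_tmap hφ w (C.z i).contMDiff).symm.trans ?_
    rw [hw]
    exact map_zero (diff (C.z i) (φ x))
  · exact clm_mfderiv ((ContinuousLinearMap.proj l).comp (ContinuousLinearMap.snd ℝ _ _))
      (C.contMDiff_map hφ) x w

end VectorBdl

namespace LieAlgebroid
open VectorBdl
variable {A Q : LieAlgebroid.{u}} {pr : BdlMap Q.toVectorBdl A.toVectorBdl}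

/-- Vertical sections of `Q` which near a point form a frame of the kernel of the projection, dual to the
differentials of given vertical coordinates. -/
theorem IsPullback.exists_vertical_frame (h : IsPullback A Q pr) {p : Q.M} {y : Fin (Q.n - A.n) → Q.Fun}
    (hy : Function.Bijective (fun w : Q.T p =>
      (tmap (Q := Q.toVectorBdl) (A := A.toVectorBdl) pr.base p w, fun l => VectorBdl.deriv w (y l)))) :
    ∃ κ : Fin (Q.n - A.n) → Q.Sec, (∀ l x, pr.fib x (κ l x) = 0) ∧
      ∀ᶠ x in 𝓝 p, (∀ l k, VectorBdl.deriv (Q.anchor x (κ k x)) (y l) = if l = k then 1 else 0) ∧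
        ∀ q : Q.E x, pr.fib x q = 0 →
          q = ∑ l, VectorBdl.deriv (Q.anchor x q) (y l) • κ l x := by
  obtain ⟨K, hK, hKy⟩ := Adapted.exists_validAt_of_coords h hy
  obtain ⟨χ, hχ1, hχ⟩ := exists_bump hK.eventually
  have hval : ∀ l x, fsmul χ (K.SQ.sec (Sum.inr l)) x = χ x • K.SQ.sec (Sum.inr l) x :=
    fun _ _ => rfl
  refine ⟨fun l => fsmul χ (K.SQ.sec (Sum.inr l)), fun l x => ?_, ?_⟩
  · rw [hval, map_smul]
    by_cases hx : x ∈ tsupport χ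
    · rw [(hχ hx).fib_inr, smul_zero]
    · rw [image_eq_zero_of_notMem_tsupport hx, zero_smul]
  · filter_upwards [hχ1, hK.eventually] with x hx hKx
    have hv : ∀ l, fsmul χ (K.SQ.sec (Sum.inr l)) x = K.SQ.sec (Sum.inr l) x := fun l => by
      rw [hval, hx, one_smul]
    simp only [hv, ← hKy, ← K.coord_anchor]
    refine ⟨fun l k => ?_, fun q hq => ?_⟩
    · rw [hKx.vq.dual]
      simp only [Sum.inr.injEq]
    · conv_lhs => rw [hKx.vq.expand q, Fintype.sum_sum_type]
      simp only [K.coord_fib, hq, map_zero, zero_smul, Finset.sum_const_zero, zero_add]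

theorem IsPullback.tmap_anchor_eq_zero (h : IsPullback A Q pr) {p : Q.M} {q : Q.E p}
    (hq : pr.fib p q = 0) :
    tmap (Q := Q.toVectorBdl) (A := A.toVectorBdl) pr.base p (Q.anchor p q) = 0 := by
  rw [h.tmap_anchor, hq, map_zero]

/-- Vertical tangent vectors are the anchors of vertical elements. -/
theorem IsPullback.exists_vertical (h : IsPullback A Q pr) {p : Q.M} {w : Q.T p}
    (hw : tmap (Q := Q.toVectorBdl) (A := A.toVectorBdl) pr.base p w = 0) :
    ∃ q : Q.E p, pr.fib p q = 0 ∧ Q.anchor p q = w := by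
  obtain ⟨q, hq, -⟩ := h.fiber p 0 w (by rw [map_zero]; exact hw.symm)
  exact ⟨q, hq⟩

/-- The bracket of vertical sections is vertical. -/
theorem IsPullback.pr_bracket_vertical (h : IsPullback A Q pr) {κ κ' : Q.Sec}
    (hκ : ∀ x, pr.fib x (κ x) = 0) (hκ' : ∀ x, pr.fib x (κ' x) = 0) (x : Q.M) :
    pr.fib x (Q.bracket κ κ' x) = 0 := by
  have h1 := h.bracket κ κ' 0 0 Fin.elim0 Fin.elim0 Fin.elim0 Fin.elim0 (fun p => by simp [hκ])
    (fun p => by simp [hκ']) x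
  simpa using h1

/-- The Poincaré lemma along the fibres: near every point a closed 1-form on the pull-back Lie algebroid
is, on vertical elements, the differential of a function. -/
theorem IsPullback.exists_vertical_primitive (h : IsPullback A Q pr) {p : Q.M}
    (hs : Function.Surjective (mfderiv (𝓡 Q.n) (𝓡 A.n) pr.base p)) {η : Q.Form 1} (hη : η ∈ Q.Z1) :
    ∃ H : Q.Fun, ∀ᶠ x in 𝓝 p, ∀ q : Q.E x, pr.fib x q = 0 →
      lin η x q = VectorBdl.deriv (Q.anchor x q) H := by
  obtain ⟨C, hC, hy⟩ := exists_fibredChart (Q := Q.toVectorBdl) (A := A.toVectorBdl) pr.base_smooth hs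
  obtain ⟨κ, hκ, hκ'⟩ := h.exists_vertical_frame hy
  have hmap := C.contMDiff_map pr.base_smooth
  let F : Fin (Q.n - A.n) → Q.Fun := fun l => ⟨fun x => lin η x (κ l x), lin_smooth η (κ l)⟩
  -- the values of the form on the vertical frame, in coordinates
  have hf : ∀ l, ∃ f : (Fin A.n → ℝ) × (Fin (Q.n - A.n) → ℝ) → ℝ, ContDiff ℝ ∞ f ∧
      ∀ᶠ x in 𝓝 p, f (C.map x) = F l x := by
    intro l
    obtain ⟨f, hf, hfe⟩ := exists_contDiff_eventuallyEq (c₀ := C.map p) (f := fun c => F l (C.inv c))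
      (hC.smooth.mono fun c hc => ((F l).contMDiff.contMDiffAt.comp c hc).contDiffAt)
    refine ⟨f, hf, ?_⟩
    filter_upwards [hmap.continuous.continuousAt.eventually hfe, hC.inv_eq] with x hx hxi
    rw [hx, hxi]
  choose f hf hfF using hf
  have hvert : ∀ {g : (Fin A.n → ℝ) × (Fin (Q.n - A.n) → ℝ) → ℝ}, ContDiff ℝ ∞ g →
      ∀ᶠ x in 𝓝 p, ∀ k, VectorBdl.deriv (Q.anchor x (κ k x)) (fun y => g (C.map y)) =
        fderiv ℝ g (C.map x) (0, Pi.single k 1) := by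
    intro g hg
    filter_upwards [hκ'] with x hx k
    rw [deriv_comp_vec hmap hg]
    congr 1
    refine (C.mfderiv_map_vertical pr.base_smooth (h.tmap_anchor_eq_zero (hκ k x))).trans ?_
    refine Prod.ext rfl (funext fun l => ?_)
    exact (hx.1 l k).trans (Pi.single_apply _ _ _).symm
  have hbr : ∀ᶠ x in 𝓝 p, ∀ k l, Q.bracket (κ k) (κ l) x = 0 := by
    filter_upwards [hκ', eventually_eventually_nhds.2 hκ'] with x hx hxe k l
    rw [hx.2 _ (h.pr_bracket_vertical (hκ k) (hκ l) x)]
    refine Finset.sum_eq_zero fun m _ => ?_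
    have e : ∀ k l, VectorBdl.deriv (Q.anchor x (κ k x))
        (fun z => VectorBdl.deriv (Q.anchor z (κ l z)) (C.y m)) = 0 := fun k l => by
      rw [deriv_congr (g := fun _ => if m = l then 1 else 0) _ (hxe.mono fun z hz => hz.1 m l),
        VectorBdl.deriv_const]
    rw [deriv_anchor_bracket, e, e, sub_zero, zero_smul]
  have hclosed : ∀ᶠ x in 𝓝 p, ∀ k l, fderiv ℝ (f l) (C.map x) (0, Pi.single k 1) =
      fderiv ℝ (f k) (C.map x) (0, Pi.single l 1) := by
    have h1 : ∀ᶠ x in 𝓝 p, ∀ l, f l (C.map x) = F l x := Filter.eventually_all.2 hfF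
    have h2 : ∀ᶠ x in 𝓝 p, ∀ l k, VectorBdl.deriv (Q.anchor x (κ k x)) (fun y => f l (C.map y)) =
        fderiv ℝ (f l) (C.map x) (0, Pi.single k 1) := Filter.eventually_all.2 fun l => hvert (hf l)
    filter_upwards [h2, hbr, eventually_eventually_nhds.2 h1] with x hx hb he k l
    rw [← hx l k, ← hx k l, deriv_congr _ (he.mono fun z hz => hz l),
      deriv_congr _ (he.mono fun z hz => hz k)]
    have h3 := (mem_Z1_iff η).1 hη (κ k) (κ l) x
    rw [hb, map_zero] at h3
    exact (sub_eq_zero.1 h3.symm)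
  obtain ⟨H, hH, hHf⟩ := exists_partial_primitive hf (c₀ := C.map p) (by
    filter_upwards [hC.map_eq, hC.tendsto.eventually hclosed] with c hc hcc k l
    have := hcc k l
    rwa [hc] at this)
  refine ⟨⟨fun x => H (C.map x), hH.contMDiff.comp hmap⟩, ?_⟩
  filter_upwards [hκ', hvert hH, hmap.continuous.continuousAt.eventually hHf,
    Filter.eventually_all.2 hfF] with x hx hxH hxf hxF q hq
  conv_lhs => rw [hx.2 q hq]
  conv_rhs => rw [hx.2 q hq]
  rw [map_sum, map_sum]
  simp only [map_smul, deriv_sum_vec, smul_eq_mul]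
  refine Finset.sum_congr rfl fun l _ => ?_
  congr 1
  refine (hxF l).symm.trans ?_
  rw [← hxf l]
  exact (hxH l).symm

end LieAlgebroid
end LieAlgd

/-! ### Gluing primitives on a simply connected space -/

namespace LieAlgd

/-- The real numbers with the discrete topology: the fibre of the covering whose sections are the primitives
of locally defined functions. -/
def DiscreteReal : Type := ℝ

instance : TopologicalSpace DiscreteReal := ⊥
instance : DiscreteTopology DiscreteReal := ⟨rfl⟩

/-- On a simply connected and locally path connected space, functions which are given locally up to locally
constant functions come from a global function. It is a section of the covering with fibre `ℝ` glued
from the differences of the local functions. -/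
theorem exists_global_primitive {X : Type*} [TopologicalSpace X] [SimplyConnectedSpace X]
    [LocallyPathConnectedSpace X] (H : X → X → ℝ) (U : X → Set X) (hU : ∀ i, IsOpen (U i))
    (hmem : ∀ x, x ∈ U x)
    (hc : ∀ i j, ∀ x ∈ U i, x ∈ U j → ∀ᶠ y in 𝓝 x, H i y - H j y = H i x - H j x) :
    ∃ G : X → ℝ, ∀ i, ∀ x ∈ U i, ∀ᶠ y in 𝓝 x, G y - H i y = G x - H i x := by
  let Z : FiberBundleCore X X DiscreteReal :=
    { baseSet := U
      isOpen_baseSet := hU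
      indexAt := fun x => x
      mem_baseSet_at := hmem
      coordChange := fun i j x v => (show ℝ from v) + (H i x - H j x)
      coordChange_self := fun i x _ v => by
        change (show ℝ from v) + (H i x - H i x) = v
        rw [sub_self, add_zero]
      continuousOn_coordChange := fun i j => by
        rintro ⟨x, v⟩ ⟨⟨hi, hj⟩, -⟩
        have hv : ∀ᶠ w in 𝓝 v, w = v :=
          (isOpen_discrete ({v} : Set DiscreteReal)).mem_nhds (Set.mem_singleton v)
        have h1 : ∀ᶠ q : X × DiscreteReal in 𝓝 (x, v), q.2 = v ∧
            H i q.1 - H j q.1 = H i x - H j x :=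
          ((continuous_snd.tendsto (x, v)).eventually hv).and
            ((continuous_fst.tendsto (x, v)).eventually (hc i j x hi hj))
        refine ContinuousAt.continuousWithinAt (ContinuousAt.congr (f := fun _ =>
          (show DiscreteReal from (show ℝ from v) + (H i x - H j x))) continuousAt_const ?_)
        filter_upwards [h1] with q hq
        rw [hq.2, hq.1]
      coordChange_comp := fun i j k x _ v => by
        change (show ℝ from v) + (H i x - H j x) + (H j x - H k x) = (show ℝ from v) + (H i x - H k x)
        ring }
  have hcov : IsCoveringMap (Z.proj) := FiberBundle.isCoveringMap (F := DiscreteReal) (E := Z.Fiber)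
  obtain ⟨x₀⟩ : Nonempty X := inferInstance
  obtain ⟨s, ⟨-, hs⟩, -⟩ := hcov.existsUnique_continuousMap_lifts (ContinuousMap.id X) x₀
    (⟨x₀, (0 : ℝ)⟩ : Z.TotalSpace) rfl
  have hs1 : ∀ x, (s x).1 = x := fun x => congrFun hs x
  refine ⟨fun x => (show ℝ from (s x).2) + H x x, fun i x hx => ?_⟩
  have hval : ∀ y, (Z.localTriv i (s y)).2 = (show ℝ from (s y).2) + (H y y - H i y) := by
    intro y
    rw [Z.localTriv_apply]
    change (show ℝ from (s y).2) + (H (s y).1 (s y).1 - H i (s y).1) = _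
    rw [hs1 y]
  have hcont : ContinuousAt (fun y => (Z.localTriv i (s y)).2) x := by
    refine continuous_snd.continuousAt.comp (ContinuousAt.comp ?_ s.continuous.continuousAt)
    refine (Z.localTriv i).continuousAt ?_
    rw [Z.mem_localTriv_source, ← Z.baseSet_at, hs1]
    exact hx
  filter_upwards [hcont.eventually (IsOpen.mem_nhds (isOpen_discrete
    {(Z.localTriv i (s x)).2}) rfl)] with y hy
  have h1 : (Z.localTriv i (s y)).2 = (Z.localTriv i (s x)).2 := hy
  rw [hval, hval] at h1
  have h2 : (show ℝ from (s y).2) + (H y y - H i y) = (show ℝ from (s x).2) + (H x x - H i x) := h1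
  linarith

end LieAlgd

/-! ### Integration along 1-connected fibres -/

namespace LieAlgd
namespace VectorBdl
variable {A Q : VectorBdl.{u}} {φ : Q.M → A.M}

/-- If `G` differs from a smooth function by a function constant along the fibres, then its smoothness at a
point of a fibre is equivalent to its smoothness at nearby points of the same fibre. -/
theorem locConstOnFibres_contMDiffAt (hφ : ContMDiff (𝓡 Q.n) (𝓡 A.n) ∞ φ)
    (hs : ∀ p, Function.Surjective (tmap φ p)) {G : Q.M → ℝ} {p : Q.M} (H : Q.Fun)
    (hG : LocConstOnFibres φ (fun q => G q - H q) p) :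
    LocConstOnFibres φ (fun q => ContMDiffAt (𝓡 Q.n) 𝓘(ℝ, ℝ) ∞ G q) p := by
  obtain ⟨U, hU, hc⟩ := hG
  have key : ∀ q ∈ interior U, ∀ q' ∈ interior U, φ q = φ q' →
      ContMDiffAt (𝓡 Q.n) 𝓘(ℝ, ℝ) ∞ G q → ContMDiffAt (𝓡 Q.n) 𝓘(ℝ, ℝ) ∞ G q' := by
    intro q hq q' hq' hqq hGq
    obtain ⟨σ, h1, h2⟩ := exists_local_section hφ (hs q)
    rw [hqq] at h1 h2
    have hσφ : ContMDiffAt (𝓡 Q.n) (𝓡 Q.n) ∞ (fun y => σ (φ y)) q' :=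
      h2.self_of_nhds.1.comp q' hφ.contMDiffAt
    have h3 : ∀ᶠ y in 𝓝 q', G y = H y + (G (σ (φ y)) - H (σ (φ y))) := by
      have h4 : ∀ᶠ y in 𝓝 q', σ (φ y) ∈ U := hσφ.continuousAt.eventually (by
        beta_reduce
        rw [h1]
        exact mem_interior_iff_mem_nhds.1 hq)
      filter_upwards [mem_interior_iff_mem_nhds.1 hq', h4, hφ.continuous.continuousAt.eventually h2]
        with y hy hy' hyφ
      have := hc _ hy _ hy' hyφ.2.symm
      linarith
    refine ContMDiffAt.congr_of_eventuallyEq ?_ h3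
    have h5 : ContMDiffAt (𝓡 Q.n) 𝓘(ℝ, ℝ) ∞ (fun y => G y - H y) (σ (φ q')) := by
      rw [h1]
      exact hGq.sub H.contMDiff.contMDiffAt
    exact H.contMDiff.contMDiffAt.add (h5.comp q' hσφ)
  exact ⟨interior U, interior_mem_nhds.2 hU, fun q hq q' hq' hqq =>
    propext ⟨key q hq q' hq' hqq, key q' hq' q hq hqq.symm⟩⟩

/-- If `G` differs locally from smooth functions by functions constant along the fibres, then it becomes
smooth after subtracting its values along a local section. -/
theorem contMDiffAt_sub_section (hφ : ContMDiff (𝓡 Q.n) (𝓡 A.n) ∞ φ)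
    (hs : ∀ p, Function.Surjective (tmap φ p)) {G : Q.M → ℝ}
    (hG : ∀ p, ∃ H : Q.Fun, LocConstOnFibres φ (fun q => G q - H q) p) {σ : A.M → Q.M} {x : A.M}
    [PreconnectedSpace {p // φ p = x}]
    (hσ : ∀ᶠ y in 𝓝 x, ContMDiffAt (𝓡 A.n) (𝓡 Q.n) ∞ σ y ∧ φ (σ y) = y) {p : Q.M} (hp : φ p = x) :
    ContMDiffAt (𝓡 Q.n) 𝓘(ℝ, ℝ) ∞ (fun q => G q - G (σ (φ q))) p := by
  have hG' : ∀ p, ∃ H : Q.Fun, LocConstOnFibres φ (fun q => G q - G (σ (φ q)) - H q) p := by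
    intro p
    obtain ⟨H, U, hU, hc⟩ := hG p
    refine ⟨H, U, hU, fun q hq q' hq' hqq => ?_⟩
    have := hc q hq q' hq' hqq
    beta_reduce at this ⊢
    rw [hqq]
    linarith
  have hσx := hσ.self_of_nhds
  have h1 : ContMDiffAt (𝓡 Q.n) 𝓘(ℝ, ℝ) ∞ (fun q => G q - G (σ (φ q))) (σ x) := by
    obtain ⟨H, U, hU, hc⟩ := hG (σ x)
    have hσφ : ContMDiffAt (𝓡 Q.n) (𝓡 Q.n) ∞ (fun y => σ (φ y)) (σ x) := by
      refine ContMDiffAt.comp (σ x) ?_ hφ.contMDiffAt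
      rw [hσx.2]
      exact hσx.1
    have h3 : ∀ᶠ y in 𝓝 (σ x), G y - G (σ (φ y)) = H y - H (σ (φ y)) := by
      have h4 : ∀ᶠ y in 𝓝 (σ x), σ (φ y) ∈ U := hσφ.continuousAt.eventually (by
        beta_reduce
        rw [hσx.2]
        exact hU)
      have h5 : ∀ᶠ y in 𝓝 (σ x), φ (σ (φ y)) = φ y :=
        hφ.continuous.continuousAt.eventually (by
          rw [hσx.2]
          exact hσ.mono fun y hy => hy.2)
      filter_upwards [hU, h4, h5] with y hy hy' hyφ
      have := hc _ hy _ hy' hyφ.symm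
      linarith
    exact (H.contMDiff.contMDiffAt.sub (H.contMDiff.contMDiffAt.comp (σ x) hσφ)).congr_of_eventuallyEq h3
  have h2 := const_on_fibres (φ := φ) (x := x)
    (u := fun q => ContMDiffAt (𝓡 Q.n) 𝓘(ℝ, ℝ) ∞ (fun q => G q - G (σ (φ q))) q)
    (fun p _ => locConstOnFibres_contMDiffAt hφ hs _ (hG' p).choose_spec) hσx.2 hp
  exact h2.mp h1

/-- A function which differs locally from smooth functions by functions constant along the fibres becomes
smooth after subtracting a function of the base point, if the fibres are connected. -/
theorem exists_smooth_of_locConstOnFibres (hφ : ContMDiff (𝓡 Q.n) (𝓡 A.n) ∞ φ)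
    (hsurj : Function.Surjective φ) (hs : ∀ p, Function.Surjective (tmap φ p))
    (hconn : ∀ x, PreconnectedSpace {p // φ p = x}) {G : Q.M → ℝ}
    (hG : ∀ p, ∃ H : Q.Fun, LocConstOnFibres φ (fun q => G q - H q) p) :
    ∃ (g : Q.Fun) (D : A.M → ℝ), ∀ q, g q = G q - D (φ q) := by
  have := A.sigmaCompact
  have := A.locallyCompact
  choose r hr using hsurj
  choose σ hσr hσ using fun x => exists_local_section hφ (hs (r x))
  simp only [hr] at hσ
  let V : A.M → Set A.M := fun i =>
    interior {x | ContMDiffAt (𝓡 A.n) (𝓡 Q.n) ∞ (σ i) x ∧ φ (σ i x) = x}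
  obtain ⟨ρ, hρ⟩ := SmoothPartitionOfUnity.exists_isSubordinate (𝓡 A.n) isClosed_univ V
    (fun i => isOpen_interior)
    (fun x _ => Set.mem_iUnion.2 ⟨x, mem_interior_iff_mem_nhds.2 (hσ x)⟩)
  have hfin : ∀ x, (Function.support fun i => ρ i x).Finite := fun x => ρ.locallyFinite.point_finite x
  -- Since the `ρ i` sum up to `1`, the sum of the `f i` is `G` minus a function of the base point.
  let f : A.M → Q.M → ℝ := fun i q => ρ i (φ q) * (G q - G (σ i (φ q)))
  have hsupp : ∀ i, Function.support (f i) ⊆ φ ⁻¹' Function.support (ρ i) := by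
    intro i q hq h
    exact hq (by simp only [f, h, zero_mul])
  have hf : ∀ i, ContMDiff (𝓡 Q.n) 𝓘(ℝ, ℝ) ∞ (f i) := by
    intro i q
    by_cases hq : φ q ∈ tsupport (ρ i)
    · refine (((ρ i).contMDiff.comp hφ).contMDiffAt).mul ?_
      exact contMDiffAt_sub_section hφ hs hG (mem_interior_iff_mem_nhds.1 (hρ i hq)) rfl
    · have h1 : ∀ᶠ q' in 𝓝 q, f i q' = 0 := by
        filter_upwards [hφ.continuous.continuousAt.preimage_mem_nhds
          ((isClosed_tsupport (ρ i)).isOpen_compl.mem_nhds hq)] with q' hq'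
        simp only [f, image_eq_zero_of_notMem_tsupport hq', zero_mul]
      exact contMDiffAt_const.congr_of_eventuallyEq h1
  refine ⟨⟨fun q => ∑ᶠ i, f i q, contMDiff_finsum hf ?_⟩, fun x => ∑ᶠ i, ρ i x * G (σ i x), fun q => ?_⟩
  · exact (ρ.locallyFinite.preimage_continuous hφ.continuous).subset hsupp
  · have h1 : ∑ᶠ i, f i q = ∑ᶠ i, (ρ i (φ q) * G q - ρ i (φ q) * G (σ i (φ q))) :=
      finsum_congr fun i => mul_sub _ _ _
    refine h1.trans ?_
    rw [finsum_sub_distrib, ← finsum_mul, ρ.sum_eq_one (Set.mem_univ _), one_mul]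
    · exact (hfin (φ q)).subset fun i hi h => hi (by simp only [h, zero_mul])
    · exact (hfin (φ q)).subset fun i hi h => hi (by simp only [h, zero_mul])

/-- Integration along 1-connected fibres: a family of covectors on the vertical vectors which locally is
given by differentials of functions is given by the differential of one function. -/
theorem exists_vertical_integral (hφ : ContMDiff (𝓡 Q.n) (𝓡 A.n) ∞ φ)
    (hsurj : Function.Surjective φ) (hs : ∀ p, Function.Surjective (tmap φ p))
    (hsc : ∀ x, SimplyConnectedSpace {p // φ p = x}) (γ : ∀ x, Q.T x → ℝ)
    (hγ : ∀ p, ∃ H : Q.Fun, ∀ᶠ x in 𝓝 p, ∀ w, tmap φ x w = 0 → deriv w H = γ x w) :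
    ∃ g : Q.Fun, ∀ x w, tmap φ x w = 0 → deriv w g = γ x w := by
  choose H hH using hγ
  let V : Q.M → Set Q.M := fun i => {x | ∀ᶠ y in 𝓝 x, ∀ w, tmap φ y w = 0 → deriv w (H i) = γ y w}
  have hV : ∀ i, IsOpen (V i) := fun i => isOpen_setOfPred_eventually_nhds
  have hdiff : ∀ i j, ∀ x ∈ V i, x ∈ V j → LocConstOnFibres φ (fun y => H i y - H j y) x := by
    intro i j x hi hj
    refine locConstOnFibres_of_deriv hφ (hs x)
      (Filter.Eventually.of_forall fun q => ((H i).contMDiff.sub (H j).contMDiff).contMDiffAt) ?_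
    filter_upwards [hi, hj] with y hyi hyj w hw
    rw [deriv_sub_at _ ((H i).mdiff y) ((H j).mdiff y), hyi w hw, hyj w hw, sub_self]
  have hG : ∀ x, ∃ G : {p // φ p = x} → ℝ, ∀ i p, p.1 ∈ V i →
      ∀ᶠ q in 𝓝 p, G q - H i q.1 = G p - H i p.1 := by
    intro x
    have := locallyPathConnectedSpace_fibre hφ hs x
    have := hsc x
    obtain ⟨G, hG⟩ := exists_global_primitive (X := {p // φ p = x}) (fun i q => H i.1 q.1)
      (fun i => Subtype.val ⁻¹' V i.1) (fun i => (hV i.1).preimage continuous_subtype_val)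
      (fun p => hH p.1) (fun i j p hi hj => by
        obtain ⟨U, hU, hc⟩ := hdiff i.1 j.1 p.1 hi hj
        filter_upwards [continuous_subtype_val.continuousAt.preimage_mem_nhds hU] with q hq
        exact hc _ hq _ (mem_of_mem_nhds hU) (q.2.trans p.2.symm))
    refine ⟨G, fun i p hp => ?_⟩
    obtain ⟨U, hU, hc⟩ := hdiff i p.1 p.1 hp (hH p.1)
    filter_upwards [hG p p (hH p.1), continuous_subtype_val.continuousAt.preimage_mem_nhds hU] with q hq hqU
    have := hc _ hqU _ (mem_of_mem_nhds hU) (q.2.trans p.2.symm)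
    linarith
  choose G hG using hG
  have hGφ : ∀ {x} (p : {p // φ p = x}), G (φ p.1) ⟨p.1, rfl⟩ = G x p := by
    rintro x ⟨p, rfl⟩
    rfl
  have hGH : ∀ p, LocConstOnFibres φ (fun q => G (φ q) ⟨q, rfl⟩ - H p q) p := by
    intro p
    refine locConstOnFibres_of_eventually hφ (hs p) ?_
    filter_upwards [(hV p).mem_nhds (hH p)] with x hx
    obtain ⟨N, hN, hNs⟩ := (mem_nhds_subtype _ _ _).1 (hG (φ x) p ⟨x, rfl⟩ hx)
    filter_upwards [hN] with y hy hyx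
    have h1 := hNs (show (⟨y, hyx⟩ : {p // φ p = φ x}) ∈ _ from hy)
    have h2 : G (φ x) ⟨y, hyx⟩ - H p y = G (φ x) ⟨x, rfl⟩ - H p x := h1
    rw [← hGφ ⟨y, hyx⟩] at h2
    exact h2
  obtain ⟨g, D, hg⟩ := exists_smooth_of_locConstOnFibres hφ hsurj hs (fun x => by
    have := hsc x
    infer_instance) fun p => ⟨H p, hGH p⟩
  refine ⟨g, fun x w hw => ?_⟩
  have h1 : LocConstOnFibres φ (fun q => g q - H x q) x := by
    obtain ⟨U, hU, hc⟩ := hGH x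
    refine ⟨U, hU, fun q hq q' hq' hqq => ?_⟩
    have := hc q hq q' hq' hqq
    have hD := congrArg D hqq
    beta_reduce at this ⊢
    rw [hg, hg]
    linarith
  have h2 := h1.deriv_eq_zero hφ (hs x) (g.contMDiff.sub (H x).contMDiff).contMDiffAt hw
  rw [deriv_sub_at _ (g.mdiff x) ((H x).mdiff x), (hH x).self_of_nhds w hw] at h2
  linarith

end VectorBdl
end LieAlgd

/-! ### The first cohomology of a pull-back Lie algebroid -/

namespace LieAlgd
namespace LieAlgebroid
open VectorBdl
variable {A Q : LieAlgebroid.{u}} {pr : BdlMap Q.toVectorBdl A.toVectorBdl}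

/-- Elements of `A` lift to the pull-back along a submersion. -/
theorem IsPullback.exists_lift (h : IsPullback A Q pr) {p : Q.M}
    (hs : Function.Surjective (mfderiv (𝓡 Q.n) (𝓡 A.n) pr.base p)) (v : A.E (pr.base p)) :
    ∃ q : Q.E p, pr.fib p q = v := by
  obtain ⟨w, hw⟩ := hs (A.anchor (pr.base p) v)
  obtain ⟨q, hq, -⟩ := h.fiber p v w hw.symm
  exact ⟨q, hq.1⟩

/-- Sections of `A` lift locally to the pull-back along a submersion. -/
theorem IsPullback.exists_sec_lift (h : IsPullback A Q pr) {p : Q.M}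
    (hs : Function.Surjective (mfderiv (𝓡 Q.n) (𝓡 A.n) pr.base p)) (a : A.Sec) :
    ∃ (χ : Q.Fun) (s : Q.Sec), (∀ᶠ x in 𝓝 p, χ x = 1) ∧
      ∀ x, pr.fib x (s x) = χ x • a (pr.base x) := by
  obtain ⟨K, hK⟩ := Adapted.exists_validAt h hs
  obtain ⟨χ, hχ1, hχ⟩ := exists_bump hK.eventually
  let c : Fin A.r → Q.Fun := fun i =>
    ⟨fun x => (K.SA.smooth i).app a (pr.base x), ((K.SA.smooth i).app a).contMDiff.comp pr.base_smooth⟩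
  refine ⟨χ, ∑ i, fsmul (χ * c i) (K.SQ.sec (Sum.inl i)), hχ1, fun x => ?_⟩
  rw [sec_sum_apply, map_sum]
  by_cases hx : x ∈ tsupport χ
  · conv_rhs => rw [(hχ hx).va.expand (a (pr.base x)), Finset.smul_sum]
    refine Finset.sum_congr rfl fun i _ => ?_
    change pr.fib x ((χ x * K.SA.coord i (pr.base x) (a (pr.base x))) • K.SQ.sec (Sum.inl i) x) = _
    rw [map_smul, (hχ hx).fib_inl, smul_smul]
  · rw [image_eq_zero_of_notMem_tsupport hx, zero_smul]
    refine Finset.sum_eq_zero fun i _ => ?_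
    change pr.fib x ((χ x * _) • _) = 0
    rw [image_eq_zero_of_notMem_tsupport hx, zero_mul, zero_smul, map_zero]

/-- The value of a closed form vanishing on vertical elements on a lift of a section has no vertical
derivatives. -/
theorem IsPullback.deriv_lift_eq_zero (h : IsPullback A Q pr) {η : Q.Form 1} (hη : η ∈ Q.Z1)
    (hv : ∀ x (q : Q.E x), pr.fib x q = 0 → lin η x q = 0) {a : A.Sec} {s : Q.Sec} {p : Q.M}
    (hs : Function.Surjective (mfderiv (𝓡 Q.n) (𝓡 A.n) pr.base p))
    (hsa : ∀ᶠ x in 𝓝 p, pr.fib x (s x) = a (pr.base x)) {q : Q.E p} (hq : pr.fib p q = 0) :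
    VectorBdl.deriv (Q.anchor p q) (fun x => lin η x (s x)) = 0 := by
  obtain ⟨y, hy⟩ := exists_vertical_coords (Q := Q.toVectorBdl) (A := A.toVectorBdl) (φ := pr.base)
    (p := p) hs
  obtain ⟨κ, hκ, hκ'⟩ := h.exists_vertical_frame hy
  rw [(hκ'.self_of_nhds).2 q hq, map_sum]
  simp only [map_smul, deriv_sum_vec]
  refine Finset.sum_eq_zero fun l _ => ?_
  have h1 := (mem_Z1_iff η).1 hη (κ l) s p
  have h2 := h.pr_bracket (κ l) s (k := 0) Fin.elim0 Fin.elim0 (fun x => by simp [hκ]) a hsa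
  have h3 : VectorBdl.deriv (Q.anchor p (s p)) (fun x => lin η x (κ l x)) = 0 := by
    have h4 : (fun x => lin η x (κ l x)) = fun _ => 0 := funext fun x => hv x _ (hκ l x)
    rw [h4, VectorBdl.deriv_const]
  rw [hv _ _ (by simpa using h2), h3, sub_zero] at h1
  rw [← h1, mul_zero]

/-- A closed 1-form on the pull-back Lie algebroid which vanishes on vertical elements is a pull-back, if
the fibres are connected. -/
theorem IsPullback.exists_basic (h : IsPullback A Q pr) (hsurj : Function.Surjective pr.base)
    (hs : ∀ p, Function.Surjective (mfderiv (𝓡 Q.n) (𝓡 A.n) pr.base p))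
    (hconn : ∀ x, PreconnectedSpace {p // pr.base p = x}) {η : Q.Form 1} (hη : η ∈ Q.Z1)
    (hv : ∀ x (q : Q.E x), pr.fib x q = 0 → lin η x q = 0) :
    ∃ β : A.Z1, ∀ p q, lin η p q = lin β.1 (pr.base p) (pr.fib p q) := by
  have hwd : ∀ {p} {q q' : Q.E p}, pr.fib p q = pr.fib p q' → lin η p q = lin η p q' := by
    intro p q q' hqq
    have h1 := hv p (q - q') (by rw [map_sub, hqq, sub_self])
    rw [map_sub] at h1
    exact sub_eq_zero.1 h1
  have hdesc : ∀ a : A.Sec, ∃ f : A.Fun, ∀ p (q : Q.E p), pr.fib p q = a (pr.base p) →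
      lin η p q = f (pr.base p) := by
    intro a
    choose l hl using fun p => h.exists_lift (hs p) (a (pr.base p))
    have hloc : ∀ p, ∃ s : Q.Sec, (∀ᶠ x in 𝓝 p, pr.fib x (s x) = a (pr.base x)) ∧
        ∀ᶠ x in 𝓝 p, lin η x (l x) = lin η x (s x) := by
      intro p
      obtain ⟨χ, s, hχ, hsa⟩ := h.exists_sec_lift (hs p) a
      have h1 : ∀ᶠ x in 𝓝 p, pr.fib x (s x) = a (pr.base x) :=
        hχ.mono fun x hx => by rw [hsa, hx, one_smul]
      exact ⟨s, h1, h1.mono fun x hx => hwd ((hl x).trans hx.symm)⟩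
    have hsm : ContMDiff (𝓡 Q.n) 𝓘(ℝ, ℝ) ∞ (fun p => lin η p (l p)) := by
      intro p
      obtain ⟨s, -, he⟩ := hloc p
      exact (lin_smooth η s p).congr_of_eventuallyEq he
    have hlc : ∀ p, LocConstOnFibres (Q := Q.toVectorBdl) (A := A.toVectorBdl) pr.base
        (fun p => lin η p (l p)) p := by
      intro p
      refine locConstOnFibres_of_deriv pr.base_smooth (hs p)
        (Filter.Eventually.of_forall fun x => hsm x) (Filter.Eventually.of_forall fun x w hw => ?_)
      obtain ⟨q, hq, rfl⟩ := h.exists_vertical hw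
      obtain ⟨s, h1, he⟩ := hloc x
      rw [deriv_congr _ he]
      exact h.deriv_lift_eq_zero hη hv (hs x) h1 hq
    obtain ⟨f, hf⟩ := exists_descent pr.base_smooth hsurj hs hsm (fun p p' hpp => by
      have := hconn (pr.base p')
      exact const_on_fibres (fun p _ => hlc p) hpp rfl)
    exact ⟨f, fun p q hq => (hwd (hq.trans (hl p).symm)).trans (hf p)⟩
  choose Θ hΘ using hdesc
  obtain ⟨β, hβ⟩ := exists_form_one (fun a x => Θ a x)
    (fun a b x => by
      obtain ⟨p, rfl⟩ := hsurj x
      obtain ⟨q, hq⟩ := h.exists_lift (hs p) (a (pr.base p))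
      obtain ⟨q', hq'⟩ := h.exists_lift (hs p) (b (pr.base p))
      rw [← hΘ a p q hq, ← hΘ b p q' hq', ← hΘ (a + b) p (q + q') (by rw [map_add, hq, hq']; rfl), map_add])
    (fun f a x => by
      obtain ⟨p, rfl⟩ := hsurj x
      obtain ⟨q, hq⟩ := h.exists_lift (hs p) (a (pr.base p))
      rw [← hΘ a p q hq, ← hΘ (fsmul f a) p (f (pr.base p) • q) (by rw [map_smul, hq]; rfl), map_smul,
        smul_eq_mul])
    (fun a => (Θ a).contMDiff)
  have hpull : ∀ p (q : Q.E p), lin η p q = lin β (pr.base p) (pr.fib p q) := by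
    intro p q
    obtain ⟨a, ha⟩ := exists_sec (A := A.toVectorBdl) (pr.base p) (pr.fib p q)
    rw [hΘ a p q ha.symm, ← hβ, ha]
  refine ⟨⟨β, (mem_Z1_iff β).2 fun a b x => ?_⟩, hpull⟩
  obtain ⟨p, rfl⟩ := hsurj x
  obtain ⟨χ, s, hχ, hsa⟩ := h.exists_sec_lift (hs p) a
  obtain ⟨χ', t, hχ', htb⟩ := h.exists_sec_lift (hs p) b
  have ht : ∀ᶠ x in 𝓝 p, pr.fib x (t x) = b (pr.base x) :=
    hχ'.mono fun x hx => by rw [htb, hx, one_smul]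
  have hs' : ∀ᶠ x in 𝓝 p, pr.fib x (s x) = a (pr.base x) :=
    hχ.mono fun x hx => by rw [hsa, hx, one_smul]
  have hbr := h.pr_bracket s t (k := 1) (fun _ => χ) (fun _ => a) (fun x => by simp [hsa]) b ht
  have hχd : VectorBdl.deriv (Q.anchor p (t p)) χ = 0 := by
    rw [deriv_congr (g := fun _ => 1) _ hχ, VectorBdl.deriv_const]
  simp only [Fin.sum_univ_one, hχ.self_of_nhds, one_smul, hχd, zero_smul, sub_zero] at hbr
  have e : ∀ {s t : Q.Sec} {a b : A.Sec}, (∀ᶠ x in 𝓝 p, pr.fib x (s x) = a (pr.base x)) →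
      (∀ᶠ x in 𝓝 p, pr.fib x (t x) = b (pr.base x)) →
      VectorBdl.deriv (Q.anchor p (s p)) (fun x => lin η x (t x)) =
        VectorBdl.deriv (A.anchor (pr.base p) (a (pr.base p))) (fun x => lin β x (b x)) := by
    intro s t a b hs ht
    rw [deriv_congr (g := fun x => lin β (pr.base x) (b (pr.base x))) _
      (ht.mono fun x hx => by rw [hpull, hx]),
      ← deriv_tmap (A := A.toVectorBdl) pr.base_smooth _ (lin_smooth β b), h.tmap_anchor,
      hs.self_of_nhds]
  have h1 := (mem_Z1_iff η).1 hη s t p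
  rwa [hpull, hbr, e hs' ht, e ht hs'] at h1

/-- The pull-back along a submersion with 1-connected fibres is bijective on the first cohomology. -/
theorem IsPullback.pullH1_bijective (h : IsPullback A Q pr) (hsurj : Function.Surjective pr.base)
    (hs : ∀ p, Function.Surjective (mfderiv (𝓡 Q.n) (𝓡 A.n) pr.base p))
    (hsc : ∀ x, SimplyConnectedSpace {p // pr.base p = x}) :
    Function.Bijective (pullH1 pr h.chain_zero h.chain_one) := by
  have hconn : ∀ x, PreconnectedSpace {p // pr.base p = x} := fun x => by
    have := hsc x
    infer_instance
  constructor
  · intro c c' hcc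
    induction c using Submodule.Quotient.induction_on with | _ α
    induction c' using Submodule.Quotient.induction_on with | _ β
    obtain ⟨g, hg⟩ := (mk_eq_iff ⟨pr.pull 1 α.1, h.chain_one.mem_Z1 α.2⟩
      ⟨pr.pull 1 β.1, h.chain_one.mem_Z1 β.2⟩).1 hcc
    have hg' : ∀ p (q : Q.E p), lin α.1 (pr.base p) (pr.fib p q) =
        lin β.1 (pr.base p) (pr.fib p q) + VectorBdl.deriv (Q.anchor p q) g := hg
    obtain ⟨f, hf⟩ := exists_descent pr.base_smooth hsurj hs g.contMDiff (fun p p' hpp => by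
      have := hconn (pr.base p')
      refine const_on_fibres (A := A.toVectorBdl) (Q := Q.toVectorBdl) (φ := pr.base) (fun p _ =>
        locConstOnFibres_of_deriv pr.base_smooth (hs p)
          (Filter.Eventually.of_forall fun x => g.contMDiff x)
          (Filter.Eventually.of_forall fun x w hw => ?_)) hpp rfl
      obtain ⟨q, hq, rfl⟩ := h.exists_vertical hw
      have h1 := hg' x q
      rw [hq, map_zero, map_zero] at h1
      linarith)
    refine (mk_eq_iff _ _).2 ⟨f, fun x v => ?_⟩
    obtain ⟨p, rfl⟩ := hsurj x
    obtain ⟨q, rfl⟩ := h.exists_lift (hs p) v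
    have h2 : (g : Q.M → ℝ) = fun y => f (pr.base y) := funext hf
    rw [hg', h2, ← deriv_tmap (A := A.toVectorBdl) pr.base_smooth _ f.contMDiff, h.tmap_anchor]
  · intro c
    induction c using Submodule.Quotient.induction_on with | _ η
    classical
    -- The restriction of `η` to vertical elements, as a function of vertical tangent vectors; a vertical
    -- tangent vector is the anchor of exactly one vertical element.
    let γ : ∀ x, Q.T x → ℝ := fun x w =>
      if hw : ∃ q : Q.E x, pr.fib x q = 0 ∧ Q.anchor x q = w then lin η.1 x hw.choose else 0
    have hγ : ∀ x (q : Q.E x), pr.fib x q = 0 → γ x (Q.anchor x q) = lin η.1 x q := by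
      intro x q hq
      have hw : ∃ q' : Q.E x, pr.fib x q' = 0 ∧ Q.anchor x q' = Q.anchor x q := ⟨q, hq, rfl⟩
      simp only [γ, dif_pos hw]
      rw [h.ext (hw.choose_spec.1.trans hq.symm) hw.choose_spec.2]
    obtain ⟨g, hg⟩ := exists_vertical_integral (A := A.toVectorBdl) pr.base_smooth hsurj hs hsc γ
      (fun p => by
        obtain ⟨H, hH⟩ := h.exists_vertical_primitive (hs p) η.2
        refine ⟨H, hH.mono fun x hx w hw => ?_⟩
        obtain ⟨q, hq, rfl⟩ := h.exists_vertical hw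
        rw [hγ x q hq, hx q hq])
    have hsub : ∀ x v, lin (η.1 - exact g) x v = lin η.1 x v - VectorBdl.deriv (Q.anchor x v) g :=
      fun _ _ => rfl
    obtain ⟨β, hβ⟩ := h.exists_basic hsurj hs hconn (η := η.1 - exact g)
      (Submodule.sub_mem _ η.2 (exact_mem_Z1 g)) (fun x q hq => by
        rw [hsub, hg x _ (h.tmap_anchor_eq_zero hq), hγ x q hq, sub_self])
    refine ⟨Submodule.Quotient.mk β, ?_⟩
    refine ((mk_eq_iff η ⟨pr.pull 1 β.1, h.chain_one.mem_Z1 β.2⟩).2 ⟨g, fun x v => ?_⟩).symm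
    have h1 := hβ x v
    rw [hsub] at h1
    change _ = lin β.1 (pr.base x) (pr.fib x v) + _
    linarith

end LieAlgebroid
end LieAlgd

/-! ### Generalized morphisms and their composites -/

namespace LieAlgd
namespace LieAlgebroid
open VectorBdl
variable {A B C : LieAlgebroid.{u}}

theorem Hom.pullH1_comp (Φ : A ⟶ B) (Ψ : B ⟶ C) :
    Hom.pullH1 (Φ ≫ Ψ) = Hom.pullH1 Φ ∘ₗ Hom.pullH1 Ψ := by
  refine LinearMap.ext fun c => ?_
  induction c using Submodule.Quotient.induction_on
  rfl

theorem Hom.pullH1_id (A : LieAlgebroid.{u}) : Hom.pullH1 (𝟙 A) = LinearMap.id := by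
  refine LinearMap.ext fun c => ?_
  induction c using Submodule.Quotient.induction_on
  rfl

/-- A bundle map which commutes with the differential of functions commutes with the anchors. -/
theorem IsChainMapAt.deriv_anchor {Φ : BdlMap A.toVectorBdl B.toVectorBdl} (h : IsChainMapAt Φ 0)
    {x : A.M} (q : A.E x) (f : B.Fun) :
    VectorBdl.deriv (B.anchor (Φ.base x) (Φ.fib x q)) f =
      VectorBdl.deriv (A.anchor x q) (fun y => f (Φ.base y)) := by
  let f₀ : B.Form 0 := ⟨fun x => AlternatingMap.constOfIsEmpty ℝ (B.E x) (Fin 0) (f x),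
    fun a => f.contMDiff⟩
  have h1 : B.IsDiff f₀ (exact f) := by
    funext a x
    exact (d_zero_apply f₀ a x).symm
  obtain ⟨a, rfl⟩ := exists_sec (A := A.toVectorBdl) x q
  have h2 := congrFun (congrFun (h f₀ (exact f) h1) (fun _ => a)) x
  rw [d_zero_apply] at h2
  exact h2

theorem invMap_apply_eq {V W : Type u} [AddCommGroup V] [Module ℝ V] [AddCommGroup W] [Module ℝ W]
    {f : V →ₗ[ℝ] W} (hf : Function.Bijective f) {v : V} {w : W} (h : f v = w) : invMap f w = v := by
  rw [invMap, dif_pos hf, ← h]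
  exact (LinearEquiv.ofBijective f hf).symm_apply_apply v

theorem apply_invMap {V W : Type u} [AddCommGroup V] [Module ℝ V] [AddCommGroup W] [Module ℝ W]
    {f : V →ₗ[ℝ] W} (hf : Function.Bijective f) (w : W) : f (invMap f w) = w := by
  rw [invMap, dif_pos hf]
  exact (LinearEquiv.ofBijective f hf).apply_symm_apply w

namespace GenMor

theorem hat_bijective {P : GenMor A B} (hP : P.Fibers1Connected) : Function.Bijective P.hat :=
  P.isPullback.pullH1_bijective P.surj P.submersion hP

theorem hat_pull {P : GenMor A B} (hP : P.Fibers1Connected) (c : B.H1) :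
    P.hat (P.pull c) = Hom.pullH1 P.Ψ c := apply_invMap (hat_bijective hP) _

theorem pull_eq_of_hat {P : GenMor A B} (hP : P.Fibers1Connected) {b : B.H1} {a : A.H1}
    (h : P.hat a = Hom.pullH1 P.Ψ b) : P.pull b = a := invMap_apply_eq (hat_bijective hP) h

/-- The projection and the morphism of the identity coincide, so both induce the same map. -/
theorem pull_ofHom_id (A : LieAlgebroid.{u}) : (ofHom (𝟙 A)).pull = LinearMap.id := by
  refine LinearMap.ext fun c => pull_eq_of_hat (ofHom_fibers _) ?_
  induction c using Submodule.Quotient.induction_on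
  rfl

/-- The modular class of a generalized morphism, by the invariance of the modular class under pull-back. -/
theorem mod_eq {P : GenMor A B} (hP : P.Fibers1Connected) : P.mod = A.mod - P.pull B.mod := by
  refine invMap_apply_eq (hat_bijective hP) ?_
  rw [map_sub, hat_pull hP]
  congr 1
  exact P.isPullback.pullH1_mod P.submersion

theorem exists_tot_eq {V : VectorBdl.{u}} (t : V.Tot) {x : V.M} (h : t.1 = x) :
    ∃ v : V.E x, (⟨x, v⟩ : V.Tot) = t := by
  subst h
  exact ⟨t.2, rfl⟩

theorem lin_congr {β : A.Form 1} {s t : A.Tot} (h : s = t) : lin β s.1 s.2 = lin β t.1 t.2 := by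
  rw [h]

theorem deriv_anchor_congr {s t : A.Tot} (h : s = t) (f : A.M → ℝ) :
    VectorBdl.deriv (A.anchor s.1 s.2) f = VectorBdl.deriv (A.anchor t.1 t.2) f := by
  rw [h]

/-- An element of the pull-back Lie algebroid is determined by its components, the first of which may be
given over an equal base point. -/
theorem exists_of_components (P : GenMor A B) {p : P.Q.M} (t : A.Tot) (w : P.Q.T p)
    (ht : t.1 = P.pr.base p) (h : ∀ f : A.Fun, VectorBdl.deriv (A.anchor t.1 t.2) f =
      VectorBdl.deriv w (fun y => f (P.pr.base y))) :
    ∃ q : P.Q.E p, P.pr.tot ⟨p, q⟩ = t ∧ P.Q.anchor p q = w := by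
  obtain ⟨v, hv⟩ := exists_tot_eq t ht
  obtain ⟨q, ⟨hq1, hq2⟩, -⟩ := P.isPullback.fiber p v w (eq_of_deriv_eq fun f => by
    refine (deriv_anchor_congr hv f).trans ((h f).trans ?_)
    exact (deriv_tmap (Q := P.Q.toVectorBdl) (A := A.toVectorBdl) P.pr.base_smooth w f.contMDiff).symm)
  refine ⟨q, ?_, hq2⟩
  rw [← hv, ← hq1]
  rfl

/-- Composites act contravariantly: primitives for the two factors add up to a primitive for the composite. -/
theorem IsComposite.pull_eq {P₁ : GenMor A B} {P₂ : GenMor B C} {P₃ : GenMor A C}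
    (h : IsComposite P₁ P₂ P₃) (h₁ : P₁.Fibers1Connected) (h₂ : P₂.Fibers1Connected)
    (h₃ : P₃.Fibers1Connected) : P₃.pull = P₁.pull ∘ₗ P₂.pull := by
  obtain ⟨χ, ξ, h⟩ := h
  refine LinearMap.ext fun c => pull_eq_of_hat h₃ ?_
  have e₂ := hat_pull h₂ c
  have e₁ := hat_pull h₁ (P₂.pull c)
  rw [LinearMap.comp_apply]
  generalize P₂.pull c = b at e₁ e₂
  generalize P₁.pull b = a at e₁
  induction a using Submodule.Quotient.induction_on with | _ α
  induction b using Submodule.Quotient.induction_on with | _ β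
  induction c using Submodule.Quotient.induction_on with | _ γ
  obtain ⟨g₂, hg₂⟩ := (mk_eq_iff ⟨P₂.Ψ.pull 1 γ.1, (P₂.Ψ.chain 1).mem_Z1 γ.2⟩
    ⟨P₂.pr.pull 1 β.1, P₂.isPullback.chain_one.mem_Z1 β.2⟩).1 e₂.symm
  obtain ⟨g₁, hg₁⟩ := (mk_eq_iff ⟨P₁.Ψ.pull 1 β.1, (P₁.Ψ.chain 1).mem_Z1 β.2⟩
    ⟨P₁.pr.pull 1 α.1, P₁.isPullback.chain_one.mem_Z1 α.2⟩).1 e₁.symm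
  have k₂ : ∀ p (q : P₂.Q.E p), lin γ.1 (P₂.Ψ.base p) (P₂.Ψ.fib p q) =
      lin β.1 (P₂.pr.base p) (P₂.pr.fib p q) + VectorBdl.deriv (P₂.Q.anchor p q) g₂ := hg₂
  have k₁ : ∀ p (q : P₁.Q.E p), lin β.1 (P₁.Ψ.base p) (P₁.Ψ.fib p q) =
      lin α.1 (P₁.pr.base p) (P₁.pr.fib p q) + VectorBdl.deriv (P₁.Q.anchor p q) g₁ := hg₁
  have s₁ : ContMDiff (𝓡 P₃.Q.n) 𝓘(ℝ, ℝ) ∞ (fun z => g₁ (χ z)) := g₁.contMDiff.comp h.smooth_fst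
  have s₂ : ContMDiff (𝓡 P₃.Q.n) 𝓘(ℝ, ℝ) ∞ (fun z => g₂ (ξ z)) := g₂.contMDiff.comp h.smooth_snd
  refine ((mk_eq_iff ⟨P₃.Ψ.pull 1 γ.1, (P₃.Ψ.chain 1).mem_Z1 γ.2⟩
    ⟨P₃.pr.pull 1 α.1, P₃.isPullback.chain_one.mem_Z1 α.2⟩).2
    ⟨⟨fun z => g₁ (χ z) + g₂ (ξ z), s₁.add s₂⟩, fun z q₃ => ?_⟩).symm
  -- the chain rule for functions on the two factors
  have t₁ : ∀ (w : P₃.Q.T z) (f : P₁.Q.Fun), VectorBdl.deriv (A := P₁.Q.toVectorBdl)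
      (mfderiv (𝓡 P₃.Q.n) (𝓡 P₁.Q.n) χ z w) f = VectorBdl.deriv w (fun y => f (χ y)) := fun w f =>
    deriv_tmap (Q := P₃.Q.toVectorBdl) (A := P₁.Q.toVectorBdl) h.smooth_fst w f.contMDiff
  have t₂ : ∀ (w : P₃.Q.T z) (f : P₂.Q.Fun), VectorBdl.deriv (A := P₂.Q.toVectorBdl)
      (mfderiv (𝓡 P₃.Q.n) (𝓡 P₂.Q.n) ξ z w) f = VectorBdl.deriv w (fun y => f (ξ y)) := fun w f =>
    deriv_tmap (Q := P₃.Q.toVectorBdl) (A := P₂.Q.toVectorBdl) h.smooth_snd w f.contMDiff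
  have hfib : ∀ y, P₁.Ψ.base (χ y) = P₂.pr.base (ξ y) := fun y => by
    have : (χ y, ξ y) ∈ Set.range (fun z => (χ z, ξ z)) := ⟨y, rfl⟩
    rw [h.range] at this
    exact this
  obtain ⟨q₁, hq₁, hw₁⟩ := P₁.exists_of_components (p := χ z) (P₃.pr.tot ⟨z, q₃⟩)
    (mfderiv (𝓡 P₃.Q.n) (𝓡 P₁.Q.n) χ z (P₃.Q.anchor z q₃)) (h.base z) (fun f => by
      refine (P₃.isPullback.chain_zero.deriv_anchor q₃ f).trans ?_
      rw [funext fun y => congrArg f (h.base y)]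
      exact (t₁ _ ⟨fun y => f (P₁.pr.base y), f.contMDiff.comp P₁.pr.base_smooth⟩).symm)
  obtain ⟨q₂, hq₂, hw₂⟩ := P₂.exists_of_components (p := ξ z) (P₁.Ψ.tot ⟨χ z, q₁⟩)
    (mfderiv (𝓡 P₃.Q.n) (𝓡 P₂.Q.n) ξ z (P₃.Q.anchor z q₃)) (hfib z) (fun f => by
      refine ((P₁.Ψ.chain 0).deriv_anchor q₁ f).trans ?_
      rw [hw₁]
      refine (t₁ _ ⟨fun y => f (P₁.Ψ.base y), f.contMDiff.comp P₁.Ψ.base_smooth⟩).trans ?_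
      refine Eq.trans ?_ (t₂ _ ⟨fun y => f (P₂.pr.base y), f.contMDiff.comp P₂.pr.base_smooth⟩).symm
      exact congrArg _ (funext fun y => congrArg f (hfib y)))
  have hmap := h.map z q₃ q₁ q₂ hq₁ hw₁ hq₂ hw₂
  have l₃ : lin γ.1 (P₃.Ψ.base z) (P₃.Ψ.fib z q₃) = lin γ.1 (P₂.Ψ.base (ξ z)) (P₂.Ψ.fib (ξ z) q₂) :=
    lin_congr hmap
  have l₂ : lin β.1 (P₂.pr.base (ξ z)) (P₂.pr.fib (ξ z) q₂) =
    lin β.1 (P₁.Ψ.base (χ z)) (P₁.Ψ.fib (χ z) q₁) := lin_congr hq₂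
  have l₁ : lin α.1 (P₁.pr.base (χ z)) (P₁.pr.fib (χ z) q₁) =
    lin α.1 (P₃.pr.base z) (P₃.pr.fib z q₃) := lin_congr hq₁
  have hd : VectorBdl.deriv (P₃.Q.anchor z q₃) (fun z => g₁ (χ z) + g₂ (ξ z)) =
      VectorBdl.deriv (P₁.Q.anchor (χ z) q₁) g₁ + VectorBdl.deriv (P₂.Q.anchor (ξ z) q₂) g₂ := by
    rw [VectorBdl.deriv_add _ s₁ s₂, hw₁, hw₂, t₁, t₂]
  change lin γ.1 (P₃.Ψ.base z) (P₃.Ψ.fib z q₃) = lin α.1 (P₃.pr.base z) (P₃.pr.fib z q₃) +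
    VectorBdl.deriv (P₃.Q.anchor z q₃) (fun z => g₁ (χ z) + g₂ (ξ z))
  rw [l₃, k₂, l₂, k₁, l₁, hd]
  ring

end GenMor
end LieAlgebroid
end LieAlgd

end

theorem proposition6p4 :
    -- every Lie algebroid has exactly one modular class, namely `Mod A`
    (∀ A : LieAlgd.LieAlgebroid.{u},
      A.IsModularClass A.mod ∧ ∀ c, A.IsModularClass c → c = A.mod) ∧
    -- morphisms: `H^1` is an anti-representation, and the modular class is the coboundary of `Mod`
    ((∀ A : LieAlgd.LieAlgebroid.{u}, LieAlgd.LieAlgebroid.Hom.pullH1 (𝟙 A) = LinearMap.id) ∧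
      (∀ (A B C : LieAlgd.LieAlgebroid.{u}) (Φ : A ⟶ B) (Ψ : B ⟶ C),
        LieAlgd.LieAlgebroid.Hom.pullH1 (Φ ≫ Ψ) =
          LieAlgd.LieAlgebroid.Hom.pullH1 Φ ∘ₗ LieAlgd.LieAlgebroid.Hom.pullH1 Ψ) ∧
      ∀ (A B : LieAlgd.LieAlgebroid.{u}) (Φ : A ⟶ B),
        LieAlgd.LieAlgebroid.Hom.mod Φ =
          LieAlgd.coboundary (H := LieAlgd.LieAlgebroid.H1)
            (fun f => LieAlgd.LieAlgebroid.Hom.pullH1 f) LieAlgd.LieAlgebroid.mod Φ) ∧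
    -- the same for generalized morphisms with 1-connected fibres
    ((∀ (A B : LieAlgd.LieAlgebroid.{u}) (P : LieAlgd.GenMor1 A B),
        Function.Bijective P.1.hat) ∧
      (∀ A : LieAlgd.Algd1.{u}, LieAlgd.Algd1.pullH1 (LieAlgd.Algd1.id A) = LinearMap.id) ∧
      (∀ (A B C : LieAlgd.Algd1.{u}) (f : A ⟶ B) (g : B ⟶ C) (h : A ⟶ C),
        LieAlgd.Algd1.IsComp f g h →
          LieAlgd.Algd1.pullH1 h = LieAlgd.Algd1.pullH1 f ∘ₗ LieAlgd.Algd1.pullH1 g) ∧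
      ∀ (A B : LieAlgd.Algd1.{u}) (P : LieAlgd.GenMor1 A.alg B.alg),
        P.1.mod =
          LieAlgd.coboundary (H := fun A : LieAlgd.Algd1.{u} => A.alg.H1)
            (fun f => LieAlgd.Algd1.pullH1 f) (fun A => A.alg.mod)
            (LieAlgd.Algd1.cls P)) := by
  open LieAlgd LieAlgebroid in
  refine ⟨isModularClass_mod, ⟨Hom.pullH1_id, fun A B C Φ Ψ => Hom.pullH1_comp Φ Ψ, fun A B Φ => rfl⟩,
    fun A B P => GenMor.hat_bijective P.2, fun A => GenMor.pull_ofHom_id A.alg, ?_,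
    fun A B P => GenMor.mod_eq P.2⟩
  rintro A B C - - - ⟨P₁, P₂, P₃, rfl, rfl, rfl, h⟩
  exact h.pull_eq P₁.2 P₂.2 P₃.2
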